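/- **Notation.** A filter is a finitely supported sequence $u:\mathbb Z^d\to\mathbb C$, with symbol $\widehat u(\omega)=\sum_k u(k)e^{-ik\cdot\omega}$. For an invertible integer matrix $M$ put $\Omega_M=[(M^\top)^{-1}\mathbb Z^d]\cap[0,1)^d$. A finite family of filters $\{b_0;b_1,\dots,b_L\}$ is a tight $M$-framelet filter bank if $\sum_{\ell=0}^L|\widehat{b_\ell}(\omega)|^2=1$ and $\sum_{\ell=0}^L\overline{\widehat{b_\ell}(\omega)}\,\widehat{b_\ell}(\omega+2\pi\xi)=0$ for all $\omega\in\mathbb R^d$ and $\xi\in\Omega_M\setminus\{0\}$; $b_0$ is its low-pass filter and $b_1,\dots,b_L$ are its high-pass filters. It is $s$-multiple canonical if $L=2s-1$ and $\widehat{b_{2\ell+1}}(\omega)=e^{-i\omega_1}\overline{\widehat{b_{2\ell}}(\omega+(\pi,\dots,\pi))}$ for $0\le\ell<s$ ("double" means $s=2$). This is used for $M=2$, $d=1$ and, under the name "quincunx", for $M=M_{\sqrt2}=\begin{pmatrix}1&1\\1&-1\end{pmatrix}$, $d=2$; put also $N_{\sqrt2}=\begin{pmatrix}1&-1\\1&1\end{pmatrix}$.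 A filter on $\mathbb Z$ has symmetry if $u(c-k)=\varepsilon u(k)$ for all $k$, with some $c\in\mathbb Z$, $\varepsilon\in\{1,-1\}$; a filter on $\mathbb Z^2$ has symmetry if it has this property in each of the two coordinates (with some $c_i$, $\varepsilon_i$). $D_4$ is the group of the eight signed $2\times2$ permutation matrices; $u$ is $D_4$-symmetric if for some $c\in\mathbb R^2$, $u(E(k-c)+c)=u(k)$ for all $k\in\mathbb Z^2$, $E\in D_4$. $\operatorname{sr}(a,M)$ is the largest $m$ such that $\widehat a(0)=1$ and $\widehat a(\omega+2\pi\xi)=O(\|\omega\|^m)$ as $\omega\to0$ for all $\xi\in\Omega_M\setminus\{0\}$. A filter $b$ has order $n$ vanishing moments if $\widehat b(\omega)=O(\|\omega\|^n)$ as $\omega\to0$. $\operatorname{lpm}(a)$ is the largest $n$ such that $\widehat a(\omega)=e^{-ic\cdot\omega}+O(\|\omega\|^n)$ as $\omega\to 0$ for some $c\in\mathbb R^d$. With $[\mathcal S_{a,M}v](n)=|\det M|\sum_k v(k)a(n-Mk)$, $\delta$ the Dirac sequence, $\nabla^\mu$ the product of the differences $\nabla_{e_j}u=u-u(\cdot-e_j)$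 and $m=\operatorname{sr}(a,M)$, $$\operatorname{sm}(a,M)=\tfrac d2-d\log_{|\det M|}\ \sup_{|\mu|=m}\ \lim_{n\to\infty}\|\nabla^\mu\mathcal S_{a,M}^n\delta\|_{\ell_2}^{1/n}.$$ For $\phi\in L_2(\mathbb R^2)$, $\operatorname{sm}(\phi)=\sup\{\tau\in\mathbb R:\int|\widehat\phi(\omega)|^2(1+\|\omega\|^2)^\tau d\omega<\infty\}$, and $\phi$ has order $n$ vanishing moments if $\int x^\mu\phi(x)\,dx$ exists and is $0$ for all $|\mu|<n$. $\{\phi;\psi_1,\dots,\psi_L\}\subset L_2(\mathbb R^2)$ is a tight $M$-framelet if for all $f\in L_2(\mathbb R^2)$ $$\|f\|^2=\sum_{k\in\mathbb Z^2}|\langle f,\phi(\cdot-k)\rangle|^2+\sum_{j=0}^\infty\sum_{\ell=1}^L\sum_{k\in\mathbb Z^2}|\langle f,|\det M|^{j/2}\psi_\ell(M^j\cdot-k)\rangle|^2 .$$ **Theorem.** Let $a$ be a real-valued filter on $\mathbb Z$ with symmetry, $\widehat a(0)=1$ and $1-|\widehat a(\omega)|^2-|\widehat a(\omega+\pi)|^2\ge0$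 for all $\omega\in\mathbb R$. Then there exist real-valued filters $b_1,b_2,b_3$ with symmetry such that $\{a;b_1,b_2,b_3\}$ is a double canonical tight $2$-framelet filter bank, and real-valued filters $u_1,u_2$ with symmetry such that $|\widehat a|^2+|\widehat{u_1}|^2+|\widehat{u_2}|^2=1$. For all such $b_1,b_2,b_3,u_1,u_2$, put $b_0=u_0=a$ and define, for $j=0,1$ and $k=0,1,2$, $$\widehat{b^{2D}_{2j,k}}(\omega)=\widehat{b_{2j}}(\omega_1)\widehat{u_k}(\omega_2),\qquad \widehat{b^{2D}_{2j+1,k}}(\omega)=\widehat{b_{2j+1}}(\omega_1)\overline{\widehat{u_k}(\omega_2+\pi)},\qquad a^{2D}=b^{2D}_{0,0}=a\otimes a .$$ Then $$\{a^{2D};b^{2D}_{1,0},b^{2D}_{2,0},b^{2D}_{3,0},b^{2D}_{0,1},b^{2D}_{1,1},b^{2D}_{2,1},b^{2D}_{3,1},b^{2D}_{0,2},b^{2D}_{1,2},b^{2D}_{2,2},b^{2D}_{3,2}\}$$ is a $6$-multiple canonical quincunx tight framelet filter bank; $a^{2D}$ is real-valued and $D_4$-symmetric, with $$\operatorname{sr}(a^{2D},M_{\sqrt2})=\operatorname{sr}(a^{2D},N_{\sqrt2})\ge2\operatorname{sr}(a,2),\qquad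 \operatorname{sm}(a^{2D},M_{\sqrt2})=\operatorname{sm}(a^{2D},N_{\sqrt2})\ge2\operatorname{sm}(a,2);$$ and the eleven high-pass filters are real-valued and have symmetry and at least order $\min(2\operatorname{sr}(a,2),\operatorname{lpm}(a)/2)$ vanishing moments. In particular, for every $n\ge1$ the filter $a=a^I_{2n}$ with $\widehat{a^I_{2n}}(\omega)=\cos^{2n}(\omega/2)\sum_{j=0}^{n-1}\binom{n-1+j}{j}\sin^{2j}(\omega/2)$ satisfies the assumptions, so that this construction gives $6$-multiple canonical quincunx tight framelet filter banks, and: (i) all eleven high-pass filters have symmetry and at least order $n$ vanishing moments; (ii) $a^{2D}=a^I_{2n}\otimes a^I_{2n}$ is $D_4$-symmetric with $\operatorname{sr}(a^{2D},M_{\sqrt2})=\operatorname{sr}(a^{2D},N_{\sqrt2})\ge4n$, and $\operatorname{sm}(a^I_{2n}\otimes a^I_{2n},M_{\sqrt2})\to\infty$ and $\operatorname{sm}(a^I_{2n}\otimes a^I_{2n},N_{\sqrt2})\to\infty$ as $n\to\infty$; (iii) for $M=M_{\sqrt2}$ and for $M=N_{\sqrt2}$, with $\beta_1,\dots,\beta_{11}$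 the high-pass filters, the formulas $\widehat\phi(\omega)=\prod_{j\ge1}\widehat{a^{2D}}((M^\top)^{-j}\omega)$ and $\widehat{\psi_\ell}(\omega)=\widehat{\beta_\ell}((M^\top)^{-1}\omega)\,\widehat\phi((M^\top)^{-1}\omega)$ define functions in $L_2(\mathbb R^2)$ and $\{\phi;\psi_1,\dots,\psi_{11}\}$ is a tight $M$-framelet for $L_2(\mathbb R^2)$; for some $c\in\mathbb R^2$, $\phi(E(x-c)+c)=\phi(x)$ for all $E\in D_4$ and almost all $x$; for every $\ell$ there is $c_\ell\in\mathbb R^2$ such that for each $E\in\{\pm I_2,\pm\begin{pmatrix}0&1\\1&0\end{pmatrix}\}$ there is a sign $\varepsilon\in\{1,-1\}$ with $\psi_\ell(E(x-c_\ell)+c_\ell)=\varepsilon\,\psi_\ell(x)$ for almost all $x$; every $\psi_\ell$ has at least order $n$ vanishing moments; and for every $R\in\mathbb R$ there is $n_0$ such that $\operatorname{sm}(\phi)\ge R$ and $\operatorname{sm}(\psi_\ell)\ge R$ for all $\ell$, for all $n\ge n_0$ and all choices of the $b$'s and $u$'s. -/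

import Mathlib

open MeasureTheory Filter Topology Asymptotics
open scoped ENNReal FourierTransform ComplexConjugate

noncomputable section

namespace Framelet

/-! ### Filters (finitely supported sequences) and their symbols -/

/-- Finitely supported complex sequences on `ℤ^d`. -/
abbrev Mask (d : ℕ) := (Fin d → ℤ) →₀ ℂ

/-- The dot product `k · ω` of an integer vector and a real vector. -/
def dotR {d : ℕ} (k : Fin d → ℤ) (ω : Fin d → ℝ) : ℝ := ∑ i, (k i : ℝ) * ω i

/-- The Fourier series `∑ k, u(k) e^{-i k·ω}` of a filter. -/
def symbol {d : ℕ} (u : Mask d) (ω : Fin d → ℝ) : ℂ :=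
  u.sum fun k c => c * Complex.exp (-(Complex.I * (dotR k ω : ℂ)))

/-- All coefficients are real numbers. -/
def IsRealMask {d : ℕ} (u : Mask d) : Prop := ∀ k, (u k).im = 0

/-- Symmetry or antisymmetry in every coordinate separately: for every coordinate `i`, the
reflection `k_i ↦ c_i - k_i` (about the point `c_i / 2`) multiplies `u` by a sign `ε_i`.
For `d = 1` this is `u(c - k) = ± u(k)`. -/
def HasSymmetry {d : ℕ} (u : Mask d) : Prop :=
  ∃ (c : Fin d → ℤ) (ε : Fin d → ℤˣ), ∀ (k : Fin d → ℤ) (i : Fin d),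
    u (Function.update k i (c i - k i)) = ((ε i : ℤ) : ℂ) * u k

/-! ### Dilation matrices and the group `D_4` -/

/-- Dilation by two in dimension one. -/
def dil2 : Matrix (Fin 1) (Fin 1) ℤ := !![2]

/-- The quincunx matrix `M_{√2}`. -/
def quincunxM : Matrix (Fin 2) (Fin 2) ℤ := !![1, 1; 1, -1]

/-- The quincunx matrix `N_{√2}`. -/
def quincunxN : Matrix (Fin 2) (Fin 2) ℤ := !![1, -1; 1, 1]

/-- An integer matrix regarded as a real matrix. -/
def toReal {d : ℕ} (M : Matrix (Fin d) (Fin d) ℤ) : Matrix (Fin d) (Fin d) ℝ :=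
  M.map (fun z : ℤ => (z : ℝ))

/-- The dihedral group `D_4`. -/
def D4 : Set (Matrix (Fin 2) (Fin 2) ℤ) :=
  {!![1, 0; 0, 1], !![-1, 0; 0, -1], !![1, 0; 0, -1], !![-1, 0; 0, 1],
   !![0, 1; 1, 0], !![0, -1; -1, 0], !![0, 1; -1, 0], !![0, -1; 1, 0]}

/-- The subgroup of `D_4` generated by `-I_2` and the exchange of the two coordinates. -/
def D4minus : Set (Matrix (Fin 2) (Fin 2) ℤ) :=
  {!![1, 0; 0, 1], !![-1, 0; 0, -1], !![0, 1; 1, 0], !![0, -1; -1, 0]}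

/-- `u` is `G`-symmetric about the point `c`: for `k ∈ ℤ^d` and `E ∈ G` the point `E(k - c) + c`
is an integer vector, and `u (E(k - c) + c) = u k`. -/
def IsGSymmetricAbout {d : ℕ} (G : Set (Matrix (Fin d) (Fin d) ℤ)) (c : Fin d → ℝ)
    (u : Mask d) : Prop :=
  ∀ k : Fin d → ℤ, ∀ E ∈ G, ∃ k' : Fin d → ℤ,
    (∀ i, (k' i : ℝ) = (toReal E).mulVec (fun j => (k j : ℝ) - c j) i + c i) ∧ u k' = u k

/-! ### Tight framelet filter banks -/

/-- `Ω_M = [(Mᵀ)⁻¹ ℤ^d] ∩ [0,1)^d`. -/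
def OmegaM {d : ℕ} (M : Matrix (Fin d) (Fin d) ℤ) : Set (Fin d → ℝ) :=
  {ξ | (∃ k : Fin d → ℤ, (toReal M).transpose.mulVec ξ = fun i => (k i : ℝ)) ∧
    ∀ i, 0 ≤ ξ i ∧ ξ i < 1}

/-- `ω + 2πξ`. -/
def shift2Pi {d : ℕ} (ω ξ : Fin d → ℝ) : Fin d → ℝ := fun i => ω i + 2 * Real.pi * ξ i

/-- `ω + (π, …, π)`. -/
def shiftPi {d : ℕ} (ω : Fin d → ℝ) : Fin d → ℝ := fun i => ω i + Real.pi

/-- The family `b` (its low-pass filter being one of its members) is a tight `M`-framelet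
filter bank. -/
def IsTightFilterBank {d : ℕ} (M : Matrix (Fin d) (Fin d) ℤ) {ι : Type} [Fintype ι]
    (b : ι → Mask d) : Prop :=
  (∀ ω, ∑ l, ‖symbol (b l) ω‖ ^ 2 = 1) ∧
  ∀ ξ ∈ OmegaM M, ξ ≠ 0 → ∀ ω,
    ∑ l, conj (symbol (b l) ω) * symbol (b l) (shift2Pi ω ξ) = 0

/-- `b̂(ω) = e^{-i ω_1} conj (â(ω + (π,…,π)))`. -/
def IsCanonicalPartner {d : ℕ} [NeZero d] (a b : Mask d) : Prop :=
  ∀ ω, symbol b ω = Complex.exp (-(Complex.I * (ω 0 : ℂ))) * conj (symbol a (shiftPi ω))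

/-- The `s`-multiple canonical property of a tight `M`-framelet filter bank
`{b_0; b_1, …, b_{2s-1}}`: `b_{2l+1}` is the canonical partner of `b_{2l}` for `0 ≤ l < s`.
It is used for `M = 2` in dimension one and for `M = M_{√2}` in dimension two. -/
def IsMultipleCanonicalTightBank {d : ℕ} [NeZero d] (M : Matrix (Fin d) (Fin d) ℤ) (s : ℕ)
    (b : Fin (2 * s) → Mask d) : Prop :=
  IsTightFilterBank M b ∧
  ∀ l : Fin s, IsCanonicalPartner (b ⟨2 * l, by omega⟩) (b ⟨2 * l + 1, by omega⟩)

/-! ### Sum rules, vanishing moments, linear-phase moments -/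

/-- Order `m` sum rules with respect to `M`. -/
def HasSumRules {d : ℕ} (a : Mask d) (M : Matrix (Fin d) (Fin d) ℤ) (m : ℕ) : Prop :=
  symbol a 0 = 1 ∧ ∀ ξ ∈ OmegaM M, ξ ≠ 0 →
    (fun ω => symbol a (shift2Pi ω ξ)) =O[𝓝 0] fun ω => ‖ω‖ ^ m

/-- `sr(a, M)`. -/
def sr {d : ℕ} (a : Mask d) (M : Matrix (Fin d) (Fin d) ℤ) : ℕ∞ :=
  ⨆ (m : ℕ) (_ : HasSumRules a M m), (m : ℕ∞)

/-- Order `n` vanishing moments of a filter. -/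
def HasVanishingMoments {d : ℕ} (b : Mask d) (n : ℕ) : Prop :=
  symbol b =O[𝓝 0] fun ω => ‖ω‖ ^ n

/-- `vm(b)`. -/
def vm {d : ℕ} (b : Mask d) : ℕ∞ := ⨆ (n : ℕ) (_ : HasVanishingMoments b n), (n : ℕ∞)

/-- Order `n` linear-phase moments with phase `c`. -/
def HasLinearPhaseMoments {d : ℕ} (a : Mask d) (c : Fin d → ℝ) (n : ℕ) : Prop :=
  (fun ω => symbol a ω - Complex.exp (-(Complex.I * ((∑ i, c i * ω i : ℝ) : ℂ))))
    =O[𝓝 0] fun ω => ‖ω‖ ^ n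

/-- `lpm(a)`. -/
def lpm {d : ℕ} (a : Mask d) : ℕ∞ :=
  ⨆ (n : ℕ) (_ : ∃ c, HasLinearPhaseMoments a c n), (n : ℕ∞)

/-! ### The smoothness exponent `sm(a, M)` -/

/-- The subdivision operator
`[S_{a,M} v](n) = |det M| ∑ k, v(k) a(n - M k)`. For invertible `M` the sum is finite. -/
def subdivision {d : ℕ} (a : Mask d) (M : Matrix (Fin d) (Fin d) ℤ) (v : (Fin d → ℤ) → ℂ) :
    (Fin d → ℤ) → ℂ :=
  fun n => ((|M.det| : ℤ) : ℂ) * ∑ᶠ k : Fin d → ℤ, v k * a (n - M.mulVec k)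

/-- The Dirac sequence. -/
def dirac {d : ℕ} : (Fin d → ℤ) → ℂ := Pi.single 0 1

/-- `∇_k u = u - u(· - k)`. -/
def nabla {d : ℕ} (k : Fin d → ℤ) (u : (Fin d → ℤ) → ℂ) : (Fin d → ℤ) → ℂ :=
  fun n => u n - u (n - k)

/-- `∇^μ = ∇_{e_1}^{μ_1} ⋯ ∇_{e_d}^{μ_d}`. -/
def nablaPow {d : ℕ} (μ : Fin d → ℕ) (u : (Fin d → ℤ) → ℂ) : (Fin d → ℤ) → ℂ :=
  (List.finRange d).foldr (fun j v => (nabla (Pi.single j 1))^[μ j] v) u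

/-- The `l_2` norm of a sequence, as an extended nonnegative number. -/
def l2norm {d : ℕ} (u : (Fin d → ℤ) → ℂ) : ℝ≥0∞ := (∑' k, ‖u k‖ₑ ^ 2) ^ (1 / 2 : ℝ)

/-- `ρ_m(a, M)_2 = sup_{|μ| = m} lim_n ‖∇^μ S_{a,M}^n δ‖_{l_2}^{1/n}`. The limit exists
(it is the spectral radius of an operator on a finite-dimensional invariant subspace), so it is
written as an upper limit. -/
def rho {d : ℕ} (a : Mask d) (M : Matrix (Fin d) (Fin d) ℤ) (m : ℕ) : ℝ≥0∞ :=
  ⨆ (μ : Fin d → ℕ) (_ : ∑ i, μ i = m),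
    limsup (fun n : ℕ => l2norm (nablaPow μ ((subdivision a M)^[n] dirac)) ^ (1 / (n : ℝ))) atTop

/-- The smoothness exponent `sm(a, M) = d/2 - d log_{|det M|} ρ_m(a, M)_2`, `m = sr(a, M)`. -/
def sm {d : ℕ} (a : Mask d) (M : Matrix (Fin d) (Fin d) ℤ) : EReal :=
  (((d : ℝ) / 2 : ℝ) : EReal) -
    (((d : ℝ) / Real.log ((|M.det| : ℤ) : ℝ) : ℝ) : EReal) * ENNReal.log (rho a M (sr a M).toNat)

/-! ### The interpolatory filters `a^I_{2n}` -/

/-- The one-dimensional filter with symbol `e^{i s ω} p(e^{-iω})`. -/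
def polyMask (p : Polynomial ℂ) (s : ℕ) : Mask 1 :=
  p.sum fun j c => Finsupp.single (fun _ => (j : ℤ) - (s : ℤ)) c

/-- The filter `a^I_{2n}`, obtained by expanding
`cos²(ω/2) = e^{iω} (1 + e^{-iω})² / 4` and `sin²(ω/2) = - e^{iω} (1 - e^{-iω})² / 4`;
`symbol_interpMask` below computes its symbol. -/
def interpMask (n : ℕ) : Mask 1 :=
  ∑ j ∈ Finset.range n,
    polyMask (Polynomial.C (((n - 1 + j).choose j : ℂ) * (-1) ^ j / 4 ^ (n + j)) *
      (1 + Polynomial.X) ^ (2 * n) * (1 - Polynomial.X) ^ (2 * j)) (n + j)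

/-! ### The tensor-type construction -/

/-- The tensor product `(u ⊗ v)(k_1, k_2) = u(k_1) v(k_2)`. -/
def tensor (u v : Mask 1) : Mask 2 :=
  u.sum fun j α => v.sum fun k β => Finsupp.single ![j 0, k 0] (α * β)

/-- The filter with symbol `conj (û(ω + π))`, that is `k ↦ (-1)^k conj (u(-k))`. -/
def conjMod (u : Mask 1) : Mask 1 :=
  u.sum fun k α => Finsupp.single (-k) ((-1 : ℂ) ^ (k 0) * conj α)

/-- The two-dimensional filters `b^{2D}_{l,k}`, listed as
`b_{0,0}, b_{1,0}, b_{2,0}, b_{3,0}, b_{0,1}, …, b_{3,2}` (position `l + 4 k`), where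
`b_{2j,k} = b_{2j} ⊗ u_k` and `b_{2j+1,k}` has symbol
`b̂_{2j+1}(ω_1) conj (û_k(ω_2 + π))`. -/
def bank2D (b : Fin 4 → Mask 1) (u : Fin 3 → Mask 1) (p : Fin (2 * 6)) : Mask 2 :=
  let l : Fin 4 := ⟨p % 4, by omega⟩
  let k : Fin 3 := ⟨p / 4, by omega⟩
  if (l : ℕ) % 2 = 0 then tensor (b l) (u k) else tensor (b l) (conjMod (u k))

/-- A real-valued one-dimensional low-pass filter `a` with symmetry, `â(0) = 1` and
`1 - |â(ω)|² - |â(ω+π)|² ≥ 0`. -/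
structure IsSymLowPass (a : Mask 1) : Prop where
  real : IsRealMask a
  symm : HasSymmetry a
  low : symbol a 0 = 1
  sub : ∀ ω, 0 ≤ 1 - ‖symbol a ω‖ ^ 2 - ‖symbol a (shiftPi ω)‖ ^ 2

/-- The one-dimensional ingredients built on `a`: a real-valued double canonical tight
`2`-framelet filter bank `{a; b_1, b_2, b_3}` with symmetry and real-valued filters `u_1, u_2`
with symmetry such that `|â|² + |û_1|² + |û_2|² = 1` (with `b_0 = u_0 = a`). -/
structure IsIngredients (a : Mask 1) (b : Fin 4 → Mask 1) (u : Fin 3 → Mask 1) : Prop where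
  b_zero : b 0 = a
  b_real : ∀ l, IsRealMask (b l)
  b_symm : ∀ l, HasSymmetry (b l)
  b_bank : IsMultipleCanonicalTightBank dil2 2 b
  u_zero : u 0 = a
  u_real : ∀ k, IsRealMask (u k)
  u_symm : ∀ k, HasSymmetry (u k)
  u_sum : ∀ ω, ‖symbol a ω‖ ^ 2 + ‖symbol (u 1) ω‖ ^ 2 + ‖symbol (u 2) ω‖ ^ 2 = 1

/-! ### Tight framelets in `L_2(ℝ^d)` -/

/-- `ℝ^d`. -/
abbrev E (d : ℕ) := EuclideanSpace ℝ (Fin d)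

/-- `L_2(ℝ^d)`. -/
abbrev L2 (d : ℕ) := Lp ℂ 2 (volume : Measure (E d))

/-- The Fourier transform of `f` at the frequency `2πξ`, in the normalization
`f̂(ω) = ∫ f(x) e^{-i x·ω} dx`; this is Mathlib's `𝓕 f` at `ξ`. -/
def HasFourier {d : ℕ} (f : L2 d) (F : (Fin d → ℝ) → ℂ) : Prop :=
  ∀ᵐ ξ : E d, (𝓕 f : L2 d) ξ = F fun i => 2 * Real.pi * ξ i

/-- `Φ(ω) = ∏_{j ≥ 1} â((Mᵀ)^{-j} ω)`, as a convergent infinite product at every `ω`. -/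
def IsRefinableProduct {d : ℕ} (M : Matrix (Fin d) (Fin d) ℤ) (a : Mask d)
    (Φ : (Fin d → ℝ) → ℂ) : Prop :=
  ∀ ω, Tendsto
    (fun J : ℕ => ∏ j ∈ Finset.range J,
      symbol a (((toReal M).transpose⁻¹ ^ (j + 1)).mulVec ω))
    atTop (𝓝 (Φ ω))

/-- `φ` and `ψ_l` are the functions in `L_2(ℝ^d)` generated by the filters `a` and `b_l`:
`φ̂(ω) = ∏_{j ≥ 1} â((Mᵀ)^{-j} ω)` and `ψ̂_l(ω) = b̂_l((Mᵀ)⁻¹ ω) φ̂((Mᵀ)⁻¹ ω)`. -/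
def IsGenerated {d : ℕ} (M : Matrix (Fin d) (Fin d) ℤ) {ι : Type} (a : Mask d)
    (b : ι → Mask d) (φ : L2 d) (ψ : ι → L2 d) : Prop :=
  ∃ Φ : (Fin d → ℝ) → ℂ, IsRefinableProduct M a Φ ∧ HasFourier φ Φ ∧
    ∀ l, HasFourier (ψ l) fun ω =>
      symbol (b l) ((toReal M).transpose⁻¹.mulVec ω) * Φ ((toReal M).transpose⁻¹.mulVec ω)

/-- The point `A x - k`. -/
def affine {d : ℕ} (A : Matrix (Fin d) (Fin d) ℝ) (k : Fin d → ℤ) (x : E d) : E d :=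
  WithLp.toLp 2 fun i => A.mulVec x.ofLp i - (k i : ℝ)

/-- The point `A (x - c) + c`. -/
def moveAbout {d : ℕ} (A : Matrix (Fin d) (Fin d) ℝ) (c x : E d) : E d :=
  WithLp.toLp 2 fun i => A.mulVec (x - c).ofLp i + c i

/-- `⟨f, |det M|^{j/2} g(M^j · - k)⟩`. -/
def frameCoeff {d : ℕ} (M : Matrix (Fin d) (Fin d) ℤ) (f g : L2 d) (j : ℕ) (k : Fin d → ℤ) : ℂ :=
  ∫ x : E d, f x *
    conj ((((((|M.det| : ℤ) : ℝ) ^ ((j : ℝ) / 2)) : ℝ) : ℂ) * g (affine (toReal M ^ j) k x))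

/-- `{φ; ψ_l}` is a tight `M`-framelet for `L_2(ℝ^d)`. -/
def IsTightFramelet {d : ℕ} (M : Matrix (Fin d) (Fin d) ℤ) {ι : Type} [Fintype ι]
    (φ : L2 d) (ψ : ι → L2 d) : Prop :=
  ∀ f : L2 d, ‖f‖ₑ ^ 2 =
    ∑' k : Fin d → ℤ, ‖frameCoeff M f φ 0 k‖ₑ ^ 2 +
    ∑' j : ℕ, ∑ l, ∑' k : Fin d → ℤ, ‖frameCoeff M f (ψ l) j k‖ₑ ^ 2

/-- Order `n` vanishing moments of a function: the moments of order less than `n` exist and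
are zero. -/
def FunVanishingMoments {d : ℕ} (ψ : L2 d) (n : ℕ) : Prop :=
  ∀ μ : Fin d → ℕ, ∑ i, μ i < n →
    Integrable (fun x : E d => ((∏ i, x i ^ μ i : ℝ) : ℂ) * ψ x) ∧
    ∫ x : E d, ((∏ i, x i ^ μ i : ℝ) : ℂ) * ψ x = 0

/-- The Sobolev smoothness exponent
`sm(φ) = sup {τ : ∫ |φ̂(ω)|² (1 + ‖ω‖²)^τ dω < ∞}` (written with `ω = 2πξ`). -/
def funSm {d : ℕ} (φ : L2 d) : EReal :=
  ⨆ (τ : ℝ) (_ : ∫⁻ ξ : E d, ‖(𝓕 φ : L2 d) ξ‖ₑ ^ 2 *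
      ENNReal.ofReal ((1 + ‖(2 * Real.pi) • ξ‖ ^ 2) ^ τ) < ∞), (τ : EReal)

/-- `φ` is `D_4`-symmetric about some point. -/
def FunD4Symmetric (φ : L2 2) : Prop :=
  ∃ c : E 2, ∀ A ∈ D4, ∀ᵐ x : E 2, φ (moveAbout (toReal A) c x) = φ x

/-- `ψ` is symmetric or antisymmetric about some point under each of `-I_2` and the reflections
exchanging the two coordinates (up to sign). -/
def FunSymmetric (ψ : L2 2) : Prop :=
  ∃ c : E 2, ∀ A ∈ D4minus, ∃ ε : ℤˣ,
    ∀ᵐ x : E 2, ψ (moveAbout (toReal A) c x) = ((ε : ℤ) : ℂ) * ψ x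

/-! ### Symbols of the explicit filters -/

lemma symbol_single {d : ℕ} (k : Fin d → ℤ) (c : ℂ) (ω : Fin d → ℝ) :
    symbol (Finsupp.single k c) ω = c * Complex.exp (-(Complex.I * (dotR k ω : ℂ))) := by
  simp [symbol]

lemma symbol_add {d : ℕ} (u v : Mask d) (ω : Fin d → ℝ) :
    symbol (u + v) ω = symbol u ω + symbol v ω := by
  unfold symbol
  exact Finsupp.sum_add_index' (by simp) (by intros; ring)

lemma symbol_zero {d : ℕ} (ω : Fin d → ℝ) : symbol (0 : Mask d) ω = 0 := by simp [symbol]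

lemma symbol_sum {d : ℕ} {ι : Type*} (s : Finset ι) (f : ι → Mask d) (ω : Fin d → ℝ) :
    symbol (∑ i ∈ s, f i) ω = ∑ i ∈ s, symbol (f i) ω := by
  classical
  induction s using Finset.induction_on with
  | empty => simp [symbol_zero]
  | insert i s hi ih => rw [Finset.sum_insert hi, Finset.sum_insert hi, symbol_add, ih]

lemma symbol_tensor (u v : Mask 1) (ω : Fin 2 → ℝ) :
    symbol (tensor u v) ω = symbol u ![ω 0] * symbol v ![ω 1] := by
  unfold tensor Finsupp.sum
  simp only [symbol_sum, symbol_single]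
  unfold symbol Finsupp.sum
  rw [Finset.sum_mul_sum]
  refine Finset.sum_congr rfl fun j _ => Finset.sum_congr rfl fun k _ => ?_
  have : Complex.exp (-(Complex.I * (dotR ![j 0, k 0] ω : ℂ))) =
      Complex.exp (-(Complex.I * (dotR j ![ω 0] : ℂ))) *
        Complex.exp (-(Complex.I * (dotR k ![ω 1] : ℂ))) := by
    rw [← Complex.exp_add]
    congr 1
    simp [dotR]
    ring
  rw [this]
  ring

lemma symbol_conjMod (u : Mask 1) (ω : Fin 1 → ℝ) :
    symbol (conjMod u) ω = conj (symbol u (shiftPi ω)) := by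
  unfold conjMod Finsupp.sum
  simp only [symbol_sum, symbol_single]
  unfold symbol Finsupp.sum
  rw [map_sum]
  refine Finset.sum_congr rfl fun k _ => ?_
  rw [map_mul, ← Complex.exp_conj]
  have h : Complex.exp (conj (-(Complex.I * (dotR k (shiftPi ω) : ℂ)))) =
      (-1 : ℂ) ^ (k 0) * Complex.exp (-(Complex.I * (dotR (-k) ω : ℂ))) := by
    rw [← Complex.exp_pi_mul_I, ← Complex.exp_int_mul, ← Complex.exp_add]
    congr 1
    simp [dotR, shiftPi]
    ring
  rw [h]
  ring

lemma symbol_polyMask (p : Polynomial ℂ) (s : ℕ) (ω : Fin 1 → ℝ) :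
    symbol (polyMask p s) ω =
      Complex.exp (Complex.I * (ω 0 : ℂ)) ^ s * p.eval (Complex.exp (-(Complex.I * (ω 0 : ℂ)))) := by
  unfold polyMask Polynomial.sum
  simp only [symbol_sum, symbol_single]
  rw [Polynomial.eval_eq_sum, Polynomial.sum, Finset.mul_sum]
  refine Finset.sum_congr rfl fun j _ => ?_
  rw [← Complex.exp_nat_mul, ← Complex.exp_nat_mul, mul_left_comm, ← Complex.exp_add]
  congr 2
  simp [dotR]
  ring

/-- The defining formula of the symbol of `a^I_{2n}`. -/
lemma symbol_interpMask (n : ℕ) (ω : Fin 1 → ℝ) :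
    symbol (interpMask n) ω =
      ((Real.cos (ω 0 / 2) ^ (2 * n) * ∑ j ∈ Finset.range n,
        ((n - 1 + j).choose j : ℝ) * Real.sin (ω 0 / 2) ^ (2 * j) : ℝ) : ℂ) := by
  set z : ℂ := Complex.exp (Complex.I * (ω 0 / 2 : ℂ)) with hz
  set w : ℂ := Complex.exp (-(Complex.I * (ω 0 / 2 : ℂ))) with hw
  have hzw : z * w = 1 := by rw [hz, hw, ← Complex.exp_add]; simp
  have h1 : Complex.exp (Complex.I * (ω 0 : ℂ)) = z ^ 2 := by
    rw [hz, ← Complex.exp_nat_mul]; congr 1; push_cast; ring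
  have h2 : Complex.exp (-(Complex.I * (ω 0 : ℂ))) = w ^ 2 := by
    rw [hw, ← Complex.exp_nat_mul]; congr 1; push_cast; ring
  have hc : Complex.cos (ω 0 / 2 : ℂ) = (z + w) / 2 := by
    rw [Complex.cos, hz, hw]; congr 3 <;> ring
  have hs : Complex.sin (ω 0 / 2 : ℂ) = (w - z) * Complex.I / 2 := by
    rw [Complex.sin, hz, hw]
    have e1 : -(ω 0 / 2 : ℂ) * Complex.I = -(Complex.I * (ω 0 / 2 : ℂ)) := by ring
    have e2 : (ω 0 / 2 : ℂ) * Complex.I = Complex.I * (ω 0 / 2 : ℂ) := by ring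
    rw [e1, e2]
  unfold interpMask
  rw [symbol_sum]
  push_cast
  rw [hc, hs, Finset.mul_sum]
  refine Finset.sum_congr rfl fun j _ => ?_
  rw [symbol_polyMask, h1, h2]
  simp only [Polynomial.eval_mul, Polynomial.eval_pow, Polynomial.eval_add, Polynomial.eval_sub,
    Polynomial.eval_one, Polynomial.eval_X, Polynomial.eval_C]
  have hA : z ^ 2 * (1 + w ^ 2) ^ 2 = (z + w) ^ 2 := by
    linear_combination (2 * (z * w) + w ^ 2 * (z * w + 1)) * hzw
  have hB : z ^ 2 * (1 - w ^ 2) ^ 2 = (w - z) ^ 2 := by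
    linear_combination (-2 * (z * w) + w ^ 2 * (z * w + 1)) * hzw
  have hI : ((w - z) * Complex.I / 2) ^ 2 = -(z ^ 2 * (1 - w ^ 2) ^ 2) / 4 := by
    rw [hB]
    linear_combination ((w - z) ^ 2 / 4) * Complex.I_sq
  have hC : ((z + w) / 2) ^ 2 = (z ^ 2 * (1 + w ^ 2) ^ 2) / 4 := by rw [hA]; ring
  rw [pow_mul ((z + w) / 2), pow_mul ((w - z) * Complex.I / 2), hI, hC, div_pow, div_pow,
    neg_pow (z ^ 2 * (1 - w ^ 2) ^ 2), mul_pow (z ^ 2) ((1 + w ^ 2) ^ 2),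
    mul_pow (z ^ 2) ((1 - w ^ 2) ^ 2), pow_mul (1 + w ^ 2), pow_mul (1 - w ^ 2), pow_add, pow_add]
  field_simp

end Framelet

end

/-!
**The one-dimensional filters.** The hypothesis on `a` makes both `1 - |â(ω)|²` and
`1 - |â(ω)|² - |â(ω + π)|²` nonnegative, and the latter is a function of `2ω`. By the theorem of
Fejér and Riesz (`isSquaredModulus_of_nonneg`) they are `|p̂(ω)|²` and `|q̂(2ω)|²` for real filters
`p`, `q`. Symmetry is then restored by the parallelogram identity: with `p̃ = p(-·)` and
`Q̂ = q̂(2·)`, the filters `(p ± p̃) / 2` serve as `u₁, u₂`, and `(Q̂ + e^{-iω} conj Q̂) / 2` together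
with its canonical partner as `b₂, b₃` (`exists_isIngredients`).

**The two-dimensional bank.** Both quincunx matrices have `(1/2, 1/2)` as their only nontrivial dual
coset, so tightness follows from the two one-dimensional identities (`IsIngredients.tight`). The sum
rule order of `a ⊗ a` is the order of vanishing of `â(ω₁ + π) â(ω₂ + π)` at `0`, which the diagonal
shows to be twice that of `â` at `π` (`sr_tensor`). For `ℓ, k ≠ 0` the squares `|b̂_ℓ|²` and
`|û_k|²` are at most `1 - |â|² = O(|ω|^{lpm(a)})`, whence the vanishing moments
(`IsIngredients.min_le_two_vm`).

**Smoothness exponents.** The square of a quincunx matrix is a dyadic dilation up to signs and an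
exchange of the coordinates. Hence the symbol of the `2n`-fold subdivision of `δ` has the modulus
`4ⁿ P(ω₁) P(ω₂) P(ω₁ + ω₂) P(ω₁ - ω₂)` with `P(t) = ∏_{i < n} |â(2ⁱ t)|` (`prod_cascade_even`), for
both matrices (`sm_quincunx_eq`). Drop the factor `P(ω₁ - ω₂) ≤ 1`. The `2m` differences in the
directions `e₁`, `e₂` are controlled by products of `m` differences in each of two of the directions
`e₁`, `e₂`, `e₁ + e₂` (`pow_mul_pow_le`); dropping the factor `P` of the third direction as well
leaves a tensor product of two one-dimensional sequences, composed with a shear. This gives the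
inequality for the growth rates (`IsSymLowPass.rho_tensor_le`). For `a^I_{2(n+1)}` the cosines
contribute at most `4^{-(n+1)}` per step of a doubling orbit, and the sums in the squared sines at
most `3ⁿ` on average, because the factors `max 2 (4 sin²)` have geometric mean at most `3` along the
orbit (`prod_max_le`). With the determinant, the growth rate is at most `2 · 3ⁿ / 4^{n+1}`, and the exponents tend to
infinity.

**The generated functions.** For the same reason `φ̂(ω) = h(ω₁) h(ω₂) h(ω₁ + ω₂) h(ω₁ - ω₂)` with
`h(x) = ∏_{j ≥ 1} â(2^{-j} x)` (`refinableSymbol`), and `h` decays polynomially with an exponent of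
about `n / 3` (`exists_infProd_le`). So `φ` is continuous and lies in `L_2`, and the smoothness
exponents of `φ` and `ψ_ℓ` grow linearly in `n`. The partial products of `φ̂` are exponential sums with
bounded frequencies, so `φ` has compact support (`exists_refFun_eq_zero`). Symmetry of `ψ_ℓ` comes
from the fact that a quincunx matrix intertwines the four matrices in question with the diagonal sign
matrices, and vanishing moments pass from the filters to the functions by substitution.

**The tight framelet.** A tight filter bank preserves the energy of sequences
(`IsTightFilterBank.tsum_analysis`). Applied to the coefficients of `f` with respect to the dilates
and translates of `φ` at scale `J + 1`, this says that their energy `Q_{J+1}` is `Q_J` plus the energy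
of the framelet coefficients at scale `J`. It remains to see that `Q_J → ‖f‖²`. If `f` is
band-limited, then for large `J` there is no aliasing and Parseval's identity on a cube turns `Q_J`
into `∫ |φ̂((Mᵀ)^{-J} ξ)|² |f̂(ξ)|² dξ` (in units where `ξ` is the frequency divided by `2π`), which
converges by dominated convergence since `φ̂` is continuous at `0` with value `1`
(`tendsto_tsum_inner_atomL2`). The energies increase in `J`, so a density argument extends the limit
to all of `L_2` (`tendsto_tsum_inner_of_dense`).
-/

open MeasureTheory Filter Topology Asymptotics
open scoped ENNReal FourierTransform ComplexConjugate

noncomputable section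

namespace Framelet

/-! ### Operations on filters and their symbols -/

section Mask

variable {d : ℕ}

lemma dotR_add (k l : Fin d → ℤ) (ω : Fin d → ℝ) : dotR (k + l) ω = dotR k ω + dotR l ω := by
  simp [dotR, add_mul, Finset.sum_add_distrib]

lemma dotR_neg (k : Fin d → ℤ) (ω : Fin d → ℝ) : dotR (-k) ω = -dotR k ω := by
  simp [dotR]

lemma dotR_neg_right (k : Fin d → ℤ) (ω : Fin d → ℝ) : dotR k (-ω) = -dotR k ω := by
  simp [dotR]

lemma dotR_mulVec (M : Matrix (Fin d) (Fin d) ℤ) (k : Fin d → ℤ) (ω : Fin d → ℝ) :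
    dotR (M.mulVec k) ω = dotR k ((toReal M).transpose.mulVec ω) := by
  simp only [dotR, Matrix.mulVec, dotProduct, toReal, Matrix.transpose_apply, Matrix.map_apply]
  push_cast
  simp only [Finset.sum_mul, Finset.mul_sum]
  rw [Finset.sum_comm]
  refine Finset.sum_congr rfl fun i _ => Finset.sum_congr rfl fun j _ => ?_
  ring

lemma symbol_smul (c : ℂ) (u : Mask d) (ω : Fin d → ℝ) :
    symbol (c • u) ω = c * symbol u ω := by
  unfold symbol
  rw [Finsupp.sum_smul_index' (by simp), Finsupp.mul_sum]
  simp only [smul_eq_mul, mul_assoc]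

lemma symbol_sub (u v : Mask d) (ω : Fin d → ℝ) :
    symbol (u - v) ω = symbol u ω - symbol v ω := by
  have : u - v = u + (-1 : ℂ) • v := by simp [sub_eq_add_neg]
  rw [this, symbol_add, symbol_smul]; ring

lemma symbol_mapDomain (g : (Fin d → ℤ) → (Fin d → ℤ)) (u : Mask d) (ω : Fin d → ℝ) :
    symbol (u.mapDomain g) ω =
      u.sum fun k c => c * Complex.exp (-(Complex.I * (dotR (g k) ω : ℂ))) := by
  unfold symbol
  rw [Finsupp.sum_mapDomain_index (by simp) (by intros; ring)]

lemma symbol_translate (l : Fin d → ℤ) (u : Mask d) (ω : Fin d → ℝ) :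
    symbol (u.mapDomain (· + l)) ω =
      Complex.exp (-(Complex.I * (dotR l ω : ℂ))) * symbol u ω := by
  rw [symbol_mapDomain]
  unfold symbol
  rw [Finsupp.mul_sum]
  refine Finsupp.sum_congr fun k _ => ?_
  rw [dotR_add, mul_left_comm, ← Complex.exp_add]
  congr 2
  push_cast
  ring

lemma symbol_dilate (M : Matrix (Fin d) (Fin d) ℤ) (u : Mask d) (ω : Fin d → ℝ) :
    symbol (u.mapDomain M.mulVec) ω = symbol u ((toReal M).transpose.mulVec ω) := by
  rw [symbol_mapDomain]
  unfold symbol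
  simp only [dotR_mulVec]

/-- Convolution of two filters. -/
def convMask (u v : Mask d) : Mask d :=
  u.sum fun j α => v.sum fun k β => Finsupp.single (j + k) (α * β)

lemma symbol_convMask (u v : Mask d) (ω : Fin d → ℝ) :
    symbol (convMask u v) ω = symbol u ω * symbol v ω := by
  unfold convMask Finsupp.sum
  simp only [symbol_sum, symbol_single]
  unfold symbol Finsupp.sum
  rw [Finset.sum_mul_sum]
  refine Finset.sum_congr rfl fun j _ => Finset.sum_congr rfl fun k _ => ?_
  rw [dotR_add, mul_mul_mul_comm, ← Complex.exp_add]
  congr 2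
  push_cast
  ring

lemma convMask_apply (u v : Mask d) (n : Fin d → ℤ) :
    convMask u v n = u.sum fun j α => α * v (n - j) := by
  unfold convMask Finsupp.sum
  rw [Finsupp.finsetSum_apply]
  refine Finset.sum_congr rfl fun j _ => ?_
  rw [Finsupp.finsetSum_apply]
  simp only [Finsupp.single_apply]
  rw [Finset.sum_congr rfl (g := fun k => if k = n - j then u j * v k else 0)
    (fun k _ => by simp only [eq_sub_iff_add_eq, add_comm])]
  rw [Finset.sum_ite_eq']
  split_ifs with h
  · rfl
  · rw [Finsupp.notMem_support_iff.1 h, mul_zero]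

/-- The filter `k ↦ conj (u(-k))`, whose symbol is the conjugate of the symbol of `u`. -/
def conjMask (u : Mask d) : Mask d := u.sum fun k α => Finsupp.single (-k) (conj α)

lemma symbol_conjMask (u : Mask d) (ω : Fin d → ℝ) :
    symbol (conjMask u) ω = conj (symbol u ω) := by
  unfold conjMask Finsupp.sum
  simp only [symbol_sum, symbol_single]
  unfold symbol Finsupp.sum
  rw [map_sum]
  refine Finset.sum_congr rfl fun k _ => ?_
  rw [map_mul, ← Complex.exp_conj]
  congr 2
  simp [dotR_neg]

lemma continuous_symbol (u : Mask d) : Continuous (symbol u) := by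
  unfold symbol Finsupp.sum dotR
  fun_prop

/-- The symbol is `2π`-periodic in every variable. -/
lemma symbol_add_two_pi (u : Mask d) (ω : Fin d → ℝ) (l : Fin d → ℤ) :
    symbol u (fun i => ω i + 2 * Real.pi * l i) = symbol u ω := by
  unfold symbol
  refine Finsupp.sum_congr fun k _ => ?_
  congr 1
  have : -(Complex.I * (dotR k (fun i => ω i + 2 * Real.pi * l i) : ℂ)) =
      -(Complex.I * (dotR k ω : ℂ)) + ((-∑ i, k i * l i : ℤ) : ℂ) * (2 * Real.pi * Complex.I) := by
    simp only [dotR]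
    push_cast
    simp only [mul_add, Finset.sum_add_distrib, neg_mul, Finset.sum_mul, Finset.mul_sum, neg_add,
      ← Finset.sum_neg_distrib]
    congr 1
    refine Finset.sum_congr rfl fun i _ => ?_
    ring
  rw [this, Complex.exp_add, Complex.exp_int_mul_two_pi_mul_I, mul_one]

/-! ### Parseval's identity for filters -/

/-- The squared `l_2` norm of a filter. -/
def l2sq (u : Mask d) : ℝ := ∑ k ∈ u.support, ‖u k‖ ^ 2

/-- The cube of frequencies, in units of `2π`. -/
def cube (d : ℕ) : Set (Fin d → ℝ) := {x | ∀ i, x i ∈ Set.Ioc ((0 : Fin d → ℝ) i) ((0 : Fin d → ℝ) i + 1)}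

lemma l2sq_nonneg (u : Mask d) : 0 ≤ l2sq u := Finset.sum_nonneg fun _ _ => by positivity

/-- Parseval's identity, over the unit cube of frequencies divided by `2π`. -/
lemma parseval (u : Mask d) :
    l2sq u = ∫ x in cube d, ‖symbol u (fun i => 2 * Real.pi * x i)‖ ^ 2 := by
  let : MeasureSpace UnitAddCircle := ⟨AddCircle.haarAddCircle⟩
  have : IsProbabilityMeasure (volume : Measure UnitAddCircle) :=
    inferInstanceAs (IsProbabilityMeasure AddCircle.haarAddCircle)
  have hO := UnitAddTorus.orthonormal_mFourier (d := Fin d)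
  have hO' := hO.comp (fun k : Fin d → ℤ => -k) neg_injective
  have h1 := hO'.inner_sum (fun k => u k) (fun k => u k) u.support
  set F : C(UnitAddTorus (Fin d), ℂ) := ∑ k ∈ u.support, u k • UnitAddTorus.mFourier (-k) with hF
  have h2 : ∑ k ∈ u.support, u k • ((UnitAddTorus.mFourierLp 2 ∘ fun k : Fin d → ℤ => -k) k) =
      ContinuousMap.toLp (E := ℂ) 2 volume ℂ F := by
    rw [hF, map_sum]
    exact Finset.sum_congr rfl fun k _ => by rw [map_smul]; rfl
  rw [h2, ContinuousMap.inner_toLp] at h1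
  have h3 : ∀ x : Fin d → ℝ, F (fun i => (x i : UnitAddCircle)) =
      symbol u (fun i => 2 * Real.pi * x i) := by
    intro x
    rw [hF]
    simp only [ContinuousMap.coe_sum, Finset.sum_apply, ContinuousMap.coe_smul, Pi.smul_apply,
      smul_eq_mul]
    unfold symbol Finsupp.sum
    refine Finset.sum_congr rfl fun k _ => ?_
    congr 1
    simp only [UnitAddTorus.mFourier, ContinuousMap.coe_mk, fourier_coe_apply]
    rw [← Complex.exp_sum]
    congr 1
    simp only [dotR, Pi.neg_apply]
    push_cast
    rw [Finset.mul_sum, ← Finset.sum_neg_distrib]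
    refine Finset.sum_congr rfl fun i _ => ?_
    ring
  rw [UnitAddTorus.integral_preimage _ (0 : Fin d → ℝ)] at h1
  simp only [h3] at h1
  have h4 : ((l2sq u : ℝ) : ℂ) =
      ((∫ x in cube d, ‖symbol u (fun i => 2 * Real.pi * x i)‖ ^ 2 : ℝ) : ℂ) := by
    have e1 : ((l2sq u : ℝ) : ℂ) = ∑ i ∈ u.support, conj (u i) * u i := by
      unfold l2sq
      push_cast
      refine Finset.sum_congr rfl fun k _ => ?_
      rw [← Complex.normSq_eq_conj_mul_self, Complex.normSq_eq_norm_sq]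
      push_cast; rfl
    rw [e1, ← h1, ← integral_complex_ofReal]
    refine setIntegral_congr_fun ?_ fun x _ => ?_
    · exact MeasurableSet.univ_pi' (fun i => measurableSet_Ioc)
    · rw [Complex.mul_conj, Complex.normSq_eq_norm_sq]
  exact_mod_cast h4

lemma integrableOn_cube {F : (Fin d → ℝ) → ℝ} (hF : Continuous F) : IntegrableOn F (cube d) := by
  refine (hF.continuousOn.integrableOn_compact (isCompact_Icc (a := (0 : Fin d → ℝ))
    (b := fun _ => 1))).mono_set ?_
  intro x hx
  exact ⟨fun i => (hx i).1.le, fun i => by simpa using (hx i).2⟩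

lemma integrableOn_symbol (u : Mask d) :
    IntegrableOn (fun x => ‖symbol u (fun i => 2 * Real.pi * x i)‖ ^ 2) (cube d) := by
  refine integrableOn_cube ?_
  exact ((continuous_symbol u).comp (by fun_prop)).norm.pow 2

lemma l2sq_le_of_norm_le (u v w : Mask d) (C : ℝ)
    (h : ∀ ω, ‖symbol u ω‖ ^ 2 ≤ C * (‖symbol v ω‖ ^ 2 + ‖symbol w ω‖ ^ 2)) :
    l2sq u ≤ C * (l2sq v + l2sq w) := by
  rw [parseval, parseval, parseval, ← integral_add (integrableOn_symbol v) (integrableOn_symbol w),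
    ← integral_const_mul]
  exact setIntegral_mono (integrableOn_symbol u)
    (((integrableOn_symbol v).add (integrableOn_symbol w)).const_mul C) fun x => h _

lemma l2sq_le_const (u : Mask d) (C : ℝ) (h : ∀ ω, ‖symbol u ω‖ ^ 2 ≤ C) : l2sq u ≤ C := by
  have hv : l2sq (Finsupp.single (0 : Fin d → ℤ) (1 : ℂ)) = 1 := by
    simp [l2sq]
  have := l2sq_le_of_norm_le u (Finsupp.single 0 1) 0 C (fun ω => by
    simpa [symbol_single, symbol_zero, dotR] using h ω)
  simpa [hv, show l2sq (0 : Mask d) = 0 from by simp [l2sq]] using this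

lemma l2sq_congr (u v : Mask d) (h : ∀ ω, ‖symbol u ω‖ = ‖symbol v ω‖) : l2sq u = l2sq v := by
  rw [parseval, parseval]; simp only [h]

lemma l2sq_eq_zero {u : Mask d} (h : l2sq u = 0) : u = 0 := by
  ext k
  by_contra hk
  have := (Finset.sum_eq_zero_iff_of_nonneg (fun _ _ => by positivity)).1 h k
    (Finsupp.mem_support_iff.2 hk)
  simp at this
  exact hk this

/-- A filter is determined by its symbol. -/
lemma symbol_injective {u v : Mask d} (h : ∀ ω, symbol u ω = symbol v ω) : u = v := by
  rw [← sub_eq_zero]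
  apply l2sq_eq_zero
  rw [parseval]
  simp [symbol_sub, h]

lemma l2norm_mask (u : Mask d) : l2norm (u : (Fin d → ℤ) → ℂ) = ENNReal.ofReal (√(l2sq u)) := by
  unfold l2norm
  rw [tsum_eq_sum (s := u.support) (fun k hk => by simp [Finsupp.notMem_support_iff.1 hk])]
  have : ∑ k ∈ u.support, ‖u k‖ₑ ^ 2 = ENNReal.ofReal (l2sq u) := by
    unfold l2sq
    rw [ENNReal.ofReal_sum_of_nonneg (fun _ _ => by positivity)]
    refine Finset.sum_congr rfl fun k _ => ?_
    rw [ENNReal.ofReal_pow (norm_nonneg _), ofReal_norm]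
  rw [this, Real.sqrt_eq_rpow, ← ENNReal.ofReal_rpow_of_nonneg (l2sq_nonneg u) (by norm_num)]

/-! ### Subdivision and differences of filters -/

/-- `S_{a,M} v` for a finitely supported sequence `v`. -/
def subdivMask (a : Mask d) (M : Matrix (Fin d) (Fin d) ℤ) (v : Mask d) : Mask d :=
  ((|M.det| : ℤ) : ℂ) • convMask (v.mapDomain M.mulVec) a

lemma subdivision_coe (a : Mask d) (M : Matrix (Fin d) (Fin d) ℤ) (v : Mask d) :
    subdivision a M v = subdivMask a M v := by
  funext n
  unfold subdivision subdivMask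
  rw [Finsupp.smul_apply, convMask_apply, Finsupp.sum_mapDomain_index (by simp) (by intros; ring),
    smul_eq_mul]
  congr 1
  rw [finsum_eq_sum_of_support_subset (s := v.support)]
  · rfl
  · intro k hk
    simp only [Function.mem_support] at hk
    simp only [Finset.mem_coe, Finsupp.mem_support_iff]
    exact left_ne_zero_of_mul hk

lemma symbol_subdivMask (a : Mask d) (M : Matrix (Fin d) (Fin d) ℤ) (v : Mask d)
    (ω : Fin d → ℝ) :
    symbol (subdivMask a M v) ω =
      ((|M.det| : ℤ) : ℂ) * (symbol v ((toReal M).transpose.mulVec ω) * symbol a ω) := by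
  rw [subdivMask, symbol_smul, symbol_convMask, symbol_dilate]

/-- `S_{a,M}^n δ` as a filter. -/
def cascadeMask (a : Mask d) (M : Matrix (Fin d) (Fin d) ℤ) (n : ℕ) : Mask d :=
  (subdivMask a M)^[n] (Finsupp.single 0 1)

lemma subdivision_iterate (a : Mask d) (M : Matrix (Fin d) (Fin d) ℤ) (n : ℕ) :
    (subdivision a M)^[n] dirac = cascadeMask a M n := by
  unfold cascadeMask
  induction n with
  | zero =>
    funext k
    simp [dirac, Finsupp.single_eq_pi_single]
  | succ n ih => rw [Function.iterate_succ_apply', Function.iterate_succ_apply', ih,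
      subdivision_coe]

lemma symbol_cascadeMask (a : Mask d) (M : Matrix (Fin d) (Fin d) ℤ) (n : ℕ) (ω : Fin d → ℝ) :
    symbol (cascadeMask a M n) ω = ((|M.det| : ℤ) : ℂ) ^ n *
      ∏ j ∈ Finset.range n, symbol a (((toReal M).transpose ^ j).mulVec ω) := by
  unfold cascadeMask
  induction n generalizing ω with
  | zero => simp [symbol_single, dotR]
  | succ n ih =>
    rw [Function.iterate_succ_apply', symbol_subdivMask, ih, Finset.prod_range_succ']
    simp only [Matrix.mulVec_mulVec, ← pow_succ, pow_zero, Matrix.one_mulVec]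
    ring

/-- `∇_k u` as a filter. -/
def nablaMask (k : Fin d → ℤ) (u : Mask d) : Mask d := u - u.mapDomain (· + k)

lemma nabla_coe (k : Fin d → ℤ) (u : Mask d) : nabla k u = nablaMask k u := by
  funext n
  have : u.mapDomain (· + k) n = u (n - k) := by
    conv_lhs => rw [← sub_add_cancel n k]
    exact Finsupp.mapDomain_apply (add_left_injective k) u (n - k)
  simp [nabla, nablaMask, this]

lemma symbol_nablaMask (k : Fin d → ℤ) (u : Mask d) (ω : Fin d → ℝ) :
    symbol (nablaMask k u) ω =
      (1 - Complex.exp (-(Complex.I * (dotR k ω : ℂ)))) * symbol u ω := by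
  rw [nablaMask, symbol_sub, symbol_translate]; ring

/-- `∇^μ u` as a filter. -/
def nablaPowMask (μ : Fin d → ℕ) (u : Mask d) : Mask d :=
  (List.finRange d).foldr (fun j v => (nablaMask (Pi.single j 1))^[μ j] v) u

lemma nabla_iterate_coe (k : Fin d → ℤ) (u : Mask d) (n : ℕ) :
    (nabla k)^[n] u = ((nablaMask k)^[n] u : Mask d) := by
  induction n with
  | zero => rfl
  | succ n ih => rw [Function.iterate_succ_apply', Function.iterate_succ_apply', ih, nabla_coe]

lemma nablaPow_coe (μ : Fin d → ℕ) (u : Mask d) : nablaPow μ u = nablaPowMask μ u := by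
  unfold nablaPow nablaPowMask
  induction List.finRange d with
  | nil => rfl
  | cons j l ih => rw [List.foldr_cons, List.foldr_cons, ih, nabla_iterate_coe]

lemma symbol_nablaMask_iterate (k : Fin d → ℤ) (u : Mask d) (n : ℕ) (ω : Fin d → ℝ) :
    symbol ((nablaMask k)^[n] u) ω =
      (1 - Complex.exp (-(Complex.I * (dotR k ω : ℂ)))) ^ n * symbol u ω := by
  induction n with
  | zero => simp
  | succ n ih => rw [Function.iterate_succ_apply', symbol_nablaMask, ih]; ring

lemma symbol_nablaPowMask (μ : Fin d → ℕ) (u : Mask d) (ω : Fin d → ℝ) :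
    symbol (nablaPowMask μ u) ω =
      (∏ j, (1 - Complex.exp (-(Complex.I * (ω j : ℂ)))) ^ μ j) * symbol u ω := by
  have hd : ∀ j : Fin d, dotR (Pi.single j 1) ω = ω j := by
    intro j
    simp only [dotR]
    rw [Finset.sum_eq_single j] <;> simp +contextual
  have : ∀ l : List (Fin d), symbol (l.foldr (fun j v => (nablaMask (Pi.single j 1))^[μ j] v) u) ω =
      (l.map fun j => (1 - Complex.exp (-(Complex.I * (ω j : ℂ)))) ^ μ j).prod * symbol u ω := by
    intro l
    induction l with
    | nil => simp
    | cons j l ih =>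
      rw [List.foldr_cons, symbol_nablaMask_iterate, ih, List.map_cons, List.prod_cons, hd, mul_assoc]
  rw [nablaPowMask, this, Fin.prod_univ_def]

lemma l2norm_nablaPow_subdivision (a : Mask d) (M : Matrix (Fin d) (Fin d) ℤ) (μ : Fin d → ℕ)
    (n : ℕ) : l2norm (nablaPow μ ((subdivision a M)^[n] dirac)) =
      ENNReal.ofReal (√(l2sq (nablaPowMask μ (cascadeMask a M n)))) := by
  rw [subdivision_iterate, nablaPow_coe, l2norm_mask]

end Mask

/-! ### A spectral factorization of nonnegative cosine polynomials -/

section FejerRiesz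

open Polynomial

/-- `P(cos ω)` is the squared modulus of a real polynomial in `e^{-iω}`. -/
def IsSquaredModulus (P : ℝ[X]) : Prop :=
  ∃ q : ℝ[X], ∀ ω : ℝ, P.eval (Real.cos ω) =
    ‖(q.map (algebraMap ℝ ℂ)).eval (Complex.exp (-(Complex.I * (ω : ℂ))))‖ ^ 2

lemma IsSquaredModulus.mul {P Q : ℝ[X]} (hP : IsSquaredModulus P) (hQ : IsSquaredModulus Q) :
    IsSquaredModulus (P * Q) := by
  obtain ⟨p, hp⟩ := hP
  obtain ⟨q, hq⟩ := hQ
  refine ⟨p * q, fun ω => ?_⟩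
  rw [eval_mul, hp, hq, Polynomial.map_mul, eval_mul, norm_mul, mul_pow]

lemma IsSquaredModulus.const {c : ℝ} (hc : 0 ≤ c) : IsSquaredModulus (C c) :=
  ⟨C √c, fun ω => by simp [abs_of_nonneg (Real.sqrt_nonneg c), Real.sq_sqrt hc]⟩

/-- If `α` is a root of `α² - 2 z α + 1`, then
`cos ω - z = e^{iω} (e^{-iω} - α) (e^{-iω} - 1/α) / 2`, and the two factors have proportional moduli
after conjugating `α`. -/
lemma norm_cos_sub (z α : ℂ) (h : α ^ 2 - 2 * z * α + 1 = 0) (ω : ℝ) :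
    ‖(Real.cos ω : ℂ) - z‖ * (2 * ‖α‖) =
      ‖Complex.exp (-(Complex.I * (ω : ℂ))) - α‖ *
        ‖Complex.exp (-(Complex.I * (ω : ℂ))) - conj α‖ := by
  set w := Complex.exp (-(Complex.I * (ω : ℂ))) with hw
  have hw1 : ‖w‖ = 1 := by
    rw [hw, Complex.norm_exp]; simp
  have hcw : conj w * w = 1 := by
    rw [← Complex.normSq_eq_conj_mul_self, Complex.normSq_eq_norm_sq, hw1]; simp
  have hcos : (Real.cos ω : ℂ) = (w + conj w) / 2 := by
    rw [Complex.ofReal_cos, Complex.cos, hw, ← Complex.exp_conj]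
    have e1 : conj (-(Complex.I * (ω : ℂ))) = (ω : ℂ) * Complex.I := by simp; ring
    have e2 : -(Complex.I * (ω : ℂ)) = -(ω : ℂ) * Complex.I := by ring
    rw [e1, e2, add_comm]
  have key : ((Real.cos ω : ℂ) - z) * (2 * α) = -((w - α) * conj (w - conj α)) := by
    rw [hcos, map_sub, Complex.conj_conj]
    linear_combination h + hcw
  have := congrArg norm key
  rwa [norm_mul, norm_neg, norm_mul, norm_mul, Complex.norm_conj, Complex.norm_ofNat] at this

lemma isSquaredModulus_quadratic (z : ℂ) :
    IsSquaredModulus (X ^ 2 - C (2 * z.re) * X + C (‖z‖ ^ 2)) := by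
  obtain ⟨α, hα⟩ := IsAlgClosed.exists_root (X ^ 2 - C (2 * z) * X + 1 : ℂ[X]) (by
    have : (X ^ 2 - C (2 * z) * X + 1 : ℂ[X]).degree = 2 := by compute_degree!
    rw [this]; norm_num)
  have hα' : α ^ 2 - 2 * z * α + 1 = 0 := by simpa using hα
  have hα0 : α ≠ 0 := by rintro rfl; simp at hα'
  have hn : ‖α‖ ≠ 0 := norm_ne_zero_iff.2 hα0
  refine ⟨C (1 / (2 * ‖α‖)) * (X ^ 2 - C (2 * α.re) * X + C (‖α‖ ^ 2)), fun ω => ?_⟩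
  set w := Complex.exp (-(Complex.I * (ω : ℂ))) with hw
  have h1 := norm_cos_sub z α hα' ω
  rw [← hw] at h1
  have quad : ∀ y x : ℂ, x ^ 2 - (2 * y.re : ℝ) * x + ((‖y‖ ^ 2 : ℝ) : ℂ) =
      (x - y) * (x - conj y) := by
    intro y x
    have e1 : ((2 * y.re : ℝ) : ℂ) = y + conj y := by rw [Complex.add_conj]
    have e2 : ((‖y‖ ^ 2 : ℝ) : ℂ) = y * conj y := by
      rw [Complex.mul_conj, Complex.normSq_eq_norm_sq]
    rw [e1, e2]; ring
  have h2 : (eval (Real.cos ω) (X ^ 2 - C (2 * z.re) * X + C (‖z‖ ^ 2)) : ℝ) =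
      ‖(Real.cos ω : ℂ) - z‖ ^ 2 := by
    rw [← Complex.normSq_eq_norm_sq (_ - z), ← Complex.ofReal_inj, ← Complex.mul_conj, map_sub,
      Complex.conj_ofReal, ← quad]
    simp
  rw [h2]
  have h3 : (Polynomial.map (algebraMap ℝ ℂ)
      (C (1 / (2 * ‖α‖)) * (X ^ 2 - C (2 * α.re) * X + C (‖α‖ ^ 2)))).eval w =
      ((1 / (2 * ‖α‖) : ℝ) : ℂ) * ((w - α) * (w - conj α)) := by
    rw [← quad]; simp
  rw [h3, norm_mul, norm_mul, ← h1, Complex.norm_real, Real.norm_of_nonneg (by positivity)]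
  congr 1
  field_simp

lemma isSquaredModulus_linear (s r : ℝ) (hs : s = 1 ∨ s = -1) (hr : 1 ≤ |r|)
    (hpos : ∀ x ∈ Set.Icc (-1 : ℝ) 1, 0 ≤ s * (x - r)) :
    IsSquaredModulus (C s * (X - C r)) := by
  have hr2 : 0 ≤ r ^ 2 - 1 := by
    have := abs_mul_abs_self r; nlinarith
  set α : ℝ := r + √(r ^ 2 - 1) with hα
  have hα' : α ^ 2 - 2 * r * α + 1 = 0 := by
    have := Real.sq_sqrt hr2
    rw [hα]; linear_combination this
  have hα0 : α ≠ 0 := by intro h0; rw [h0] at hα'; norm_num at hα'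
  refine ⟨C (√(1 / (2 * |α|))) * (X - C α), fun ω => ?_⟩
  set w := Complex.exp (-(Complex.I * (ω : ℂ))) with hw
  have h1 := norm_cos_sub r α (by exact_mod_cast hα') ω
  rw [← hw, Complex.conj_ofReal] at h1
  have h2 : eval (Real.cos ω) (C s * (X - C r)) = ‖(Real.cos ω : ℂ) - r‖ := by
    have h0 := hpos (Real.cos ω) ⟨Real.neg_one_le_cos ω, Real.cos_le_one ω⟩
    have : eval (Real.cos ω) (C s * (X - C r)) = |s * (Real.cos ω - r)| := by
      rw [abs_of_nonneg h0]; simp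
    rw [this, abs_mul, ← Complex.ofReal_sub, Complex.norm_real, Real.norm_eq_abs]
    rcases hs with rfl | rfl <;> simp
  have h3 : (Polynomial.map (algebraMap ℝ ℂ) (C (√(1 / (2 * |α|))) * (X - C α))).eval w =
      ((√(1 / (2 * |α|)) : ℝ) : ℂ) * (w - α) := by simp
  rw [h2, h3, norm_mul, mul_pow, Complex.norm_real, Real.norm_of_nonneg (Real.sqrt_nonneg _),
    Real.sq_sqrt (by positivity), sq ‖w - α‖, ← h1, Complex.norm_real, Real.norm_eq_abs]
  field_simp

lemma nonneg_of_nonneg_off_point {R : ℝ[X]} {r : ℝ}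
    (h : ∀ x ∈ Set.Icc (-1 : ℝ) 1, x ≠ r → 0 ≤ R.eval x) :
    ∀ x ∈ Set.Icc (-1 : ℝ) 1, 0 ≤ R.eval x := by
  have hcl : IsClosed {x : ℝ | 0 ≤ R.eval x} := isClosed_le continuous_const R.continuous
  have h1 : Set.Ioo (-1 : ℝ) 1 ∩ {r}ᶜ ⊆ {x : ℝ | 0 ≤ R.eval x} := fun x hx =>
    h x ⟨hx.1.1.le, hx.1.2.le⟩ hx.2
  have h2 := (dense_compl_singleton r).open_subset_closure_inter (isOpen_Ioo (a := (-1 : ℝ)) (b := 1))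
  have h3 : Set.Ioo (-1 : ℝ) 1 ⊆ {x : ℝ | 0 ≤ R.eval x} := h2.trans (closure_minimal h1 hcl)
  have h4 := closure_minimal h3 hcl
  rw [closure_Ioo (by norm_num)] at h4
  exact fun x hx => h4 hx

/-- **Fejér–Riesz** for cosine polynomials: a real polynomial that is nonnegative on `[-1, 1]`
is a squared modulus. Its roots are split off one at a time: conjugate pairs of roots, real
roots outside `(-1, 1)`, and double roots inside `(-1, 1)`. -/
theorem isSquaredModulus_of_nonneg (P : ℝ[X])
    (hP : ∀ x ∈ Set.Icc (-1 : ℝ) 1, 0 ≤ P.eval x) : IsSquaredModulus P := by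
  induction hn : P.natDegree using Nat.strong_induction_on generalizing P with
  | _ n ih =>
  rcases Nat.eq_zero_or_pos n with h0 | hpos
  · rw [h0] at hn
    rw [eq_C_of_natDegree_eq_zero hn] at hP ⊢
    exact IsSquaredModulus.const (by simpa using hP 0 (by simp))
  have hP0 : P ≠ 0 := by rintro rfl; simp at hn; omega
  obtain ⟨z, hz⟩ := IsAlgClosed.exists_aeval_eq_zero ℂ P (by
    intro h; rw [natDegree_eq_of_degree_eq_some (n := 0) h] at hn; omega)
  by_cases him : z.im = 0
  · set r := z.re with hr
    have hzr : z = (r : ℂ) := Complex.ext rfl (by simp [him])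
    have hroot : P.IsRoot r := by
      rw [hzr] at hz
      have : ((P.eval r : ℝ) : ℂ) = 0 := by
        rw [← hz, aeval_def]
        exact (Polynomial.eval₂_at_apply (p := P) (algebraMap ℝ ℂ) r).symm
      exact_mod_cast this
    obtain ⟨R, hR⟩ := dvd_iff_isRoot.2 hroot
    have hR0 : R ≠ 0 := by rintro rfl; simp at hR; exact hP0 hR
    have hdeg : R.natDegree + 1 = n := by
      rw [← hn, hR, natDegree_mul (X_sub_C_ne_zero r) hR0, natDegree_X_sub_C, add_comm]
    have hev : ∀ x ∈ Set.Icc (-1 : ℝ) 1, 0 ≤ (x - r) * R.eval x := by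
      intro x hx; have := hP x hx; rw [hR] at this; simpa using this
    rcases le_or_gt 1 |r| with hr1 | hr1
    · -- the linear factor has a constant sign on `[-1, 1]`
      obtain ⟨s, hs, hss⟩ : ∃ s : ℝ, (s = 1 ∨ s = -1) ∧
          ∀ x ∈ Set.Icc (-1 : ℝ) 1, 0 ≤ s * (x - r) := by
        rcases le_abs.1 hr1 with h | h
        · exact ⟨-1, Or.inr rfl, fun x hx => by linarith [hx.2]⟩
        · exact ⟨1, Or.inl rfl, fun x hx => by linarith [hx.1]⟩
      have hs2 : s * s = 1 := by rcases hs with rfl | rfl <;> norm_num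
      have hPs : P = (C s * (X - C r)) * (C s * R) := by
        have : C s * C s = (1 : ℝ[X]) := by rw [← C_mul, hs2, C_1]
        rw [hR]; linear_combination (-(X - C r) * R) * this
      rw [hPs]
      have hsd : (C s * R).natDegree = R.natDegree :=
        natDegree_C_mul (by rintro rfl; norm_num at hs2)
      refine (isSquaredModulus_linear s r hs hr1 hss).mul
        (ih R.natDegree (by omega) (C s * R) (nonneg_of_nonneg_off_point (r := r) ?_) hsd)
      intro x hx hxr
      have h1 : 0 < s * (x - r) := lt_of_le_of_ne (hss x hx)
        (Ne.symm (mul_ne_zero (by rintro rfl; norm_num at hs2) (sub_ne_zero.2 hxr)))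
      have h2 : 0 ≤ (s * (x - r)) * (s * R.eval x) := by
        have := hev x hx
        calc (0 : ℝ) ≤ (x - r) * R.eval x := this
          _ = (s * s) * ((x - r) * R.eval x) := by rw [hs2, one_mul]
          _ = _ := by ring
      simpa using nonneg_of_mul_nonneg_right h2 h1
    · -- the sign of `R` changes at `r`, so `r` is a double root
      rw [abs_lt] at hr1
      have hRr : R.eval r = 0 := by
        apply le_antisymm
        · have hcl : IsClosed {x : ℝ | R.eval x ≤ 0} := isClosed_le R.continuous continuous_const
          have h3 := closure_minimal (s := Set.Ioo (-1 : ℝ) r) (fun x hx => by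
            have := hev x ⟨hx.1.le, by linarith [hx.2, hr1.2]⟩
            exact nonpos_of_mul_nonneg_right this (by linarith [hx.2])) hcl
          rw [closure_Ioo (by linarith)] at h3
          exact h3 ⟨by linarith, le_rfl⟩
        · have hcl : IsClosed {x : ℝ | 0 ≤ R.eval x} := isClosed_le continuous_const R.continuous
          have h3 := closure_minimal (s := Set.Ioo r (1 : ℝ)) (fun x hx => by
            have := hev x ⟨by linarith [hx.1, hr1.1], hx.2.le⟩
            exact nonneg_of_mul_nonneg_right this (by linarith [hx.1])) hcl
          rw [closure_Ioo (by linarith)] at h3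
          exact h3 ⟨le_rfl, by linarith⟩
      obtain ⟨R₂, hR₂⟩ := dvd_iff_isRoot.2 (show R.IsRoot r from hRr)
      have hR₂0 : R₂ ≠ 0 := by rintro rfl; simp at hR₂; exact hR0 hR₂
      have hdeg₂ : R₂.natDegree + 1 = R.natDegree := by
        rw [hR₂, natDegree_mul (X_sub_C_ne_zero r) hR₂0, natDegree_X_sub_C, add_comm]
      have hPs : P = (X ^ 2 - C (2 * (r : ℂ).re) * X + C (‖(r : ℂ)‖ ^ 2)) * R₂ := by
        rw [hR, hR₂, Complex.ofReal_re, Complex.norm_real, Real.norm_eq_abs, sq_abs, C_mul, C_pow]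
        simp only [C_ofNat]
        ring
      rw [hPs]
      refine (isSquaredModulus_quadratic r).mul
        (ih R₂.natDegree (by omega) R₂ (nonneg_of_nonneg_off_point (r := r) ?_) rfl)
      intro x hx hxr
      have h1 := hev x hx
      rw [hR₂, eval_mul, eval_sub, eval_X, eval_C, ← mul_assoc] at h1
      exact nonneg_of_mul_nonneg_right h1 (mul_self_pos.2 (sub_ne_zero.2 hxr))
  · obtain ⟨R, hR⟩ := P.quadratic_dvd_of_aeval_eq_zero_im_ne_zero hz him
    have hR0 : R ≠ 0 := by rintro rfl; simp at hR; exact hP0 hR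
    have hq : (X ^ 2 - C (2 * z.re) * X + C (‖z‖ ^ 2) : ℝ[X]).natDegree = 2 := by
      compute_degree!
    have hq0 : (X ^ 2 - C (2 * z.re) * X + C (‖z‖ ^ 2) : ℝ[X]) ≠ 0 := by
      intro h; rw [h] at hq; simp at hq
    have hdeg : 2 + R.natDegree = n := by rw [← hn, hR, natDegree_mul hq0 hR0, hq]
    have hR' : IsSquaredModulus R := by
      refine ih _ (by omega) R (fun x hx => ?_) rfl
      have h1 := hP x hx
      rw [hR, eval_mul] at h1
      have h2 : 0 < eval x (X ^ 2 - C (2 * z.re) * X + C (‖z‖ ^ 2)) := by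
        have e : eval x (X ^ 2 - C (2 * z.re) * X + C (‖z‖ ^ 2)) = (x - z.re) ^ 2 + z.im ^ 2 := by
          simp only [eval_add, eval_sub, eval_pow, eval_X, eval_mul, eval_C]
          rw [← Complex.normSq_eq_norm_sq, Complex.normSq_apply]; ring
        rw [e]; positivity
      exact nonneg_of_mul_nonneg_right h1 h2
    rw [hR]
    exact (isSquaredModulus_quadratic z).mul hR'

end FejerRiesz

/-! ### Realness and symmetry read off the symbol -/

section Symmetry

variable {d : ℕ}

lemma symbol_shiftPi_shiftPi (u : Mask d) (ω : Fin d → ℝ) :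
    symbol u (shiftPi (shiftPi ω)) = symbol u ω := by
  rw [← symbol_add_two_pi u ω (fun _ => 1)]
  congr 1
  funext i
  simp [shiftPi]; ring

lemma symbol_neg_of_isRealMask {u : Mask d} (hu : IsRealMask u) (ω : Fin d → ℝ) :
    symbol u (-ω) = conj (symbol u ω) := by
  unfold symbol Finsupp.sum
  rw [map_sum]
  refine Finset.sum_congr rfl fun k _ => ?_
  change u k * Complex.exp (-(Complex.I * (dotR k (-ω) : ℂ))) = _
  rw [map_mul, ← Complex.exp_conj, Complex.conj_eq_iff_im.2 (hu k), dotR_neg_right]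
  congr 2
  simp

lemma isRealMask_of_symbol {u : Mask d} (hu : ∀ ω, symbol u (-ω) = conj (symbol u ω)) :
    IsRealMask u := by
  have h : (u.mapRange conj (map_zero _) : Mask d) = u := by
    apply symbol_injective
    intro ω
    have h1 : symbol (u.mapRange conj (map_zero _) : Mask d) ω = conj (symbol u (-ω)) := by
      unfold symbol
      rw [Finsupp.sum_mapRange_index (by simp)]
      unfold Finsupp.sum
      rw [map_sum]
      refine Finset.sum_congr rfl fun k _ => ?_
      rw [map_mul, ← Complex.exp_conj, dotR_neg_right]
      simp
    rw [h1, hu, Complex.conj_conj]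
  intro k
  rw [← Complex.conj_eq_iff_im]
  conv_rhs => rw [← h]
  simp

lemma hasSymmetry_of_symbol {u : Mask 1} (c : ℤ) (ε : ℤˣ)
    (h : ∀ ω : Fin 1 → ℝ, Complex.exp (-(Complex.I * (c * ω 0 : ℂ))) * symbol u (-ω) =
      ((ε : ℤ) : ℂ) * symbol u ω) : HasSymmetry u := by
  have h1 : u.mapDomain (fun k => (fun _ => c) - k) = ((ε : ℤ) : ℂ) • u := by
    apply symbol_injective
    intro ω
    rw [symbol_smul, ← h, symbol_mapDomain]
    unfold symbol
    rw [Finsupp.mul_sum]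
    refine Finsupp.sum_congr fun k _ => ?_
    rw [mul_left_comm, ← Complex.exp_add]
    congr 2
    simp [dotR]
    ring
  refine ⟨fun _ => c, fun _ => ε, fun k i => ?_⟩
  have h2 : Function.update k i (c - k i) = (fun _ => c) - k := by
    funext j
    rw [Subsingleton.elim j i]
    simp
  have h3 := DFunLike.congr_fun h1 k
  have h4 : u.mapDomain (fun k => (fun _ => c) - k) k = u ((fun _ => c) - k) := by
    conv_lhs => rw [show k = (fun _ => c) - ((fun _ => c) - k) by abel]
    exact Finsupp.mapDomain_apply (fun a b hab => by simpa using hab) u _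
  rw [h2, ← h4, h3]
  simp

lemma HasSymmetry.exists_reflection {u : Mask 1} (h : HasSymmetry u) :
    ∃ (c : ℤ) (ε : ℤˣ), ∀ k : Fin 1 → ℤ, u ((fun _ => c) - k) = ((ε : ℤ) : ℂ) * u k := by
  obtain ⟨c, ε, h⟩ := h
  refine ⟨c 0, ε 0, fun k => ?_⟩
  rw [← h k 0]
  congr 1
  funext j
  rw [Subsingleton.elim j 0]
  simp

lemma hasSymmetry_of_reflection {u : Mask 1} {c : ℤ} {ε : ℤˣ}
    (h : ∀ k : Fin 1 → ℤ, u ((fun _ => c) - k) = ((ε : ℤ) : ℂ) * u k) : HasSymmetry u := by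
  refine ⟨fun _ => c, fun _ => ε, fun k i => ?_⟩
  rw [← h]
  congr 1
  funext j
  rw [Subsingleton.elim j i]
  simp

lemma conjMod_apply (u : Mask 1) (k : Fin 1 → ℤ) :
    conjMod u k = (-1 : ℂ) ^ (k 0) * conj (u (-k)) := by
  unfold conjMod Finsupp.sum
  rw [Finsupp.finsetSum_apply]
  simp only [Finsupp.single_apply]
  rw [Finset.sum_congr rfl (g := fun j => if j = -k then
    (-1 : ℂ) ^ (j 0) * conj (u j) else 0) (fun j _ => by simp only [neg_eq_iff_eq_neg])]
  rw [Finset.sum_ite_eq']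
  split_ifs with h
  · simp [zpow_neg, ← inv_zpow, inv_neg]
  · rw [Finsupp.notMem_support_iff.1 h]; simp

lemma IsRealMask.conjMod {u : Mask 1} (hu : IsRealMask u) : IsRealMask (conjMod u) := by
  intro k
  rw [conjMod_apply, ← Complex.conj_eq_iff_im, map_mul, Complex.conj_conj, map_zpow₀, map_neg,
    map_one, Complex.conj_eq_iff_im.2 (hu (-k))]

lemma HasSymmetry.conjMod {u : Mask 1} (hu : HasSymmetry u) : HasSymmetry (conjMod u) := by
  obtain ⟨c, ε, h⟩ := hu.exists_reflection
  refine hasSymmetry_of_reflection (c := -c) (ε := ε * (-1) ^ c) fun k => ?_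
  have h2 := h (-k)
  rw [conjMod_apply, conjMod_apply]
  have e2 : -((fun _ => -c) - k) = (fun _ => c) - -k := by funext i; simp [add_comm]
  rw [e2, h2, map_mul]
  have e3 : (-1 : ℂ) ^ (((fun _ => -c) - k : Fin 1 → ℤ) 0) = (-1) ^ c * (-1) ^ (k 0) := by
    simp only [Pi.sub_apply]
    rw [sub_eq_add_neg, zpow_add₀ (by norm_num), zpow_neg, zpow_neg, ← inv_zpow, ← inv_zpow]
    norm_num
  have e4 : ((((-1 : ℤˣ) ^ c : ℤˣ) : ℤ) : ℂ) = (-1) ^ c := by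
    rcases Int.even_or_odd c with hc | hc <;> simp [hc.neg_one_zpow]
  rw [e3, Units.val_mul, Int.cast_mul, e4, map_intCast]
  ring

lemma HasSymmetry.translate {u : Mask 1} (hu : HasSymmetry u) :
    HasSymmetry (u.mapDomain (· + fun _ => 1)) := by
  obtain ⟨c, ε, h⟩ := hu.exists_reflection
  refine hasSymmetry_of_reflection (c := c + 2) (ε := ε) fun k => ?_
  have key : ∀ m : Fin 1 → ℤ, u.mapDomain (· + fun _ => 1) m = u (m - fun _ => 1) := by
    intro m
    conv_lhs => rw [← sub_add_cancel m (fun _ => 1)]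
    exact Finsupp.mapDomain_apply (add_left_injective _) u _
  rw [key, key, ← h]
  congr 1
  funext i
  simp; ring

/-- The canonical partner of a filter. -/
def partner (u : Mask 1) : Mask 1 := (conjMod u).mapDomain (· + fun _ => 1)

lemma symbol_partner (u : Mask 1) (ω : Fin 1 → ℝ) :
    symbol (partner u) ω = Complex.exp (-(Complex.I * (ω 0 : ℂ))) * conj (symbol u (shiftPi ω)) := by
  rw [partner, symbol_translate, symbol_conjMod]
  simp [dotR]

lemma isRealMask_partner {u : Mask 1} (hu : IsRealMask u) : IsRealMask (partner u) := by
  intro k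
  have : partner u k = conjMod u (k - fun _ => 1) := by
    conv_lhs => rw [← sub_add_cancel k (fun _ => 1)]
    exact Finsupp.mapDomain_apply (add_left_injective _) _ _
  rw [this]
  exact hu.conjMod _

/-! ### Squared moduli of symbols as cosine polynomials -/

lemma normSq_symbol {a : Mask 1} (ha : IsRealMask a) (ω : Fin 1 → ℝ) :
    ‖symbol a ω‖ ^ 2 = ∑ j ∈ a.support, ∑ k ∈ a.support,
      (a j).re * (a k).re * Real.cos (((j 0 - k 0 : ℤ) : ℝ) * ω 0) := by
  have h : ((‖symbol a ω‖ ^ 2 : ℝ) : ℂ) = symbol a ω * conj (symbol a ω) := by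
    rw [Complex.mul_conj, Complex.normSq_eq_norm_sq]
  have h2 : (‖symbol a ω‖ ^ 2 : ℝ) = (symbol a ω * conj (symbol a ω)).re := by
    rw [← h, Complex.ofReal_re]
  rw [h2, ← symbol_neg_of_isRealMask ha]
  unfold symbol Finsupp.sum
  rw [Finset.sum_mul_sum, Complex.re_sum]
  refine Finset.sum_congr rfl fun j _ => ?_
  rw [Complex.re_sum]
  refine Finset.sum_congr rfl fun k _ => ?_
  rw [mul_mul_mul_comm, ← Complex.exp_add]
  have hj : a j = ((a j).re : ℂ) := Complex.ext rfl (by simp [ha j])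
  have hk : a k = ((a k).re : ℂ) := Complex.ext rfl (by simp [ha k])
  have e : -(Complex.I * (dotR j ω : ℂ)) + -(Complex.I * (dotR k (-ω) : ℂ)) =
      (((-(((j 0 - k 0 : ℤ) : ℝ) * ω 0)) : ℝ) : ℂ) * Complex.I := by
    simp [dotR]; ring
  rw [e, hj, hk, ← Complex.ofReal_mul, Complex.re_ofReal_mul, Complex.exp_ofReal_mul_I_re,
    Real.cos_neg]
  simp

open Polynomial in
/-- A polynomial in `cos ω` that is nonnegative for all `ω` is the squared modulus of the symbol of
a real filter. -/
lemma exists_spectral_factor {P : ℝ[X]} (hP : ∀ ω : ℝ, 0 ≤ P.eval (Real.cos ω)) :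
    ∃ q : Mask 1, IsRealMask q ∧ ∀ ω : Fin 1 → ℝ, ‖symbol q ω‖ ^ 2 = P.eval (Real.cos (ω 0)) := by
  obtain ⟨q, hq⟩ := isSquaredModulus_of_nonneg P (fun x hx => by
    have := hP (Real.arccos x)
    rwa [Real.cos_arccos hx.1 hx.2] at this)
  refine ⟨polyMask (q.map (algebraMap ℝ ℂ)) 0, ?_, fun ω => ?_⟩
  · apply isRealMask_of_symbol
    intro ω
    rw [symbol_polyMask, symbol_polyMask, pow_zero, pow_zero, one_mul, one_mul, eval_map,
      eval_map, eval₂_eq_sum, eval₂_eq_sum, Polynomial.sum, Polynomial.sum, map_sum]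
    refine Finset.sum_congr rfl fun k _ => ?_
    have e : -(Complex.I * (((-ω) 0 : ℝ) : ℂ)) = conj (-(Complex.I * ((ω 0 : ℝ) : ℂ))) := by simp
    rw [map_mul, map_pow, ← Complex.exp_conj, e]
    simp
  · rw [symbol_polyMask, hq]; simp

open Polynomial in
/-- `1 - |â|²` is a polynomial in `cos ω` because `a` is real, hence has a spectral factor. -/
lemma exists_spectral_factor_one_sub {a : Mask 1} (ha : IsSymLowPass a) :
    ∃ p : Mask 1, IsRealMask p ∧ ∀ ω, ‖symbol p ω‖ ^ 2 = 1 - ‖symbol a ω‖ ^ 2 := by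
  set P : ℝ[X] := 1 - ∑ j ∈ a.support, ∑ k ∈ a.support,
    C ((a j).re * (a k).re) * Chebyshev.T ℝ (j 0 - k 0) with hP
  have hev : ∀ ω : Fin 1 → ℝ, P.eval (Real.cos (ω 0)) = 1 - ‖symbol a ω‖ ^ 2 := by
    intro ω
    rw [hP, normSq_symbol ha.real]
    simp [eval_finsetSum, Chebyshev.T_real_cos]
  obtain ⟨p, hp, hp'⟩ := exists_spectral_factor (P := P) (fun t => by
    have := hev (fun _ => t)
    rw [show Real.cos t = Real.cos ((fun _ => t : Fin 1 → ℝ) 0) from rfl, this]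
    have h1 := ha.sub (fun _ => t)
    have : 0 ≤ ‖symbol a (shiftPi fun _ => t)‖ ^ 2 := by positivity
    linarith)
  exact ⟨p, hp, fun ω => by rw [hp', hev]⟩

open Polynomial in
/-- In `|â(ω)|² + |â(ω + π)|²` the harmonics of odd order cancel, so this is a polynomial in
`cos 2ω`, and the spectral factor is a function of `2ω`. -/
lemma exists_spectral_factor_low_pass {a : Mask 1} (ha : IsSymLowPass a) :
    ∃ q : Mask 1, IsRealMask q ∧ ∀ ω : Fin 1 → ℝ,
      ‖symbol q (fun _ => 2 * ω 0)‖ ^ 2 =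
        1 - ‖symbol a ω‖ ^ 2 - ‖symbol a (shiftPi ω)‖ ^ 2 := by
  set P : ℝ[X] := 1 - ∑ j ∈ a.support, ∑ k ∈ a.support,
    if Even (j 0 - k 0) then C (2 * ((a j).re * (a k).re)) * Chebyshev.T ℝ ((j 0 - k 0) / 2)
    else 0 with hP
  have hev : ∀ ω : Fin 1 → ℝ, P.eval (Real.cos (2 * ω 0)) =
      1 - ‖symbol a ω‖ ^ 2 - ‖symbol a (shiftPi ω)‖ ^ 2 := by
    intro ω
    rw [hP, normSq_symbol ha.real, normSq_symbol ha.real, sub_sub, ← Finset.sum_add_distrib]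
    simp only [← Finset.sum_add_distrib]
    simp only [eval_sub, eval_one, eval_finsetSum]
    congr 1
    refine Finset.sum_congr rfl fun j _ => Finset.sum_congr rfl fun k _ => ?_
    have hs : Real.cos (((j 0 - k 0 : ℤ) : ℝ) * shiftPi ω 0) =
        (-1) ^ (j 0 - k 0) * Real.cos (((j 0 - k 0 : ℤ) : ℝ) * ω 0) := by
      rw [← Real.cos_add_int_mul_pi]; congr 1; simp [shiftPi]; ring
    rw [hs]
    split_ifs with he
    · rw [he.neg_one_zpow, eval_mul, eval_C, Chebyshev.T_real_cos]
      obtain ⟨m, hm⟩ := he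
      have : (j 0 - k 0) / 2 = m := by omega
      have e : ((m : ℤ) : ℝ) * (2 * ω 0) = ((j 0 - k 0 : ℤ) : ℝ) * ω 0 := by
        rw [hm]; push_cast; ring
      rw [this, e]; ring
    · rw [(Int.not_even_iff_odd.1 he).neg_one_zpow]; simp
  obtain ⟨q, hq, hq'⟩ := exists_spectral_factor (P := P) (fun t => by
    have := hev (fun _ => t / 2)
    rw [show 2 * (t / 2) = t by ring] at this
    rw [this]
    exact ha.sub _)
  exact ⟨q, hq, fun ω => by rw [hq', hev]⟩

/-! ### Existence of the one-dimensional filters -/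

lemma omegaM_dil2 {ξ : Fin 1 → ℝ} (h : ξ ∈ OmegaM dil2) (h0 : ξ ≠ 0) : ξ = fun _ => 1 / 2 := by
  obtain ⟨⟨k, hk⟩, hb⟩ := h
  have h1 := congrFun hk 0
  have h2 : 2 * ξ 0 = k 0 := by
    simpa [Matrix.mulVec, dotProduct, toReal, dil2] using h1
  obtain ⟨h3, h4⟩ := hb 0
  have h5 : (k 0 : ℝ) < 2 := by linarith
  have h6 : (0 : ℝ) ≤ k 0 := by linarith
  have h5' : k 0 < 2 := by exact_mod_cast h5
  have h6' : 0 ≤ k 0 := by exact_mod_cast h6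
  have h7 : k 0 ≠ 0 := by
    intro h7
    apply h0
    funext i
    rw [Subsingleton.elim i 0]
    rw [h7] at h2
    simp at h2
    simpa using h2
  have h8 : k 0 = 1 := by omega
  funext i
  rw [Subsingleton.elim i 0]
  rw [h8] at h2
  push_cast at h2
  linarith

lemma half_mem_omegaM_dil2 : (fun _ => 1 / 2 : Fin 1 → ℝ) ∈ OmegaM dil2 := by
  refine ⟨⟨fun _ => 1, ?_⟩, fun i => by norm_num⟩
  funext i
  fin_cases i
  simp [Matrix.mulVec, dotProduct, toReal, dil2]

lemma shift2Pi_half (ω : Fin d → ℝ) : shift2Pi ω (fun _ => 1 / 2) = shiftPi ω := by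
  funext i; simp only [shift2Pi, shiftPi]; ring

/-- Existence of the one-dimensional filters: spectral factors of `1 - |â(ω)|²` and of
`1 - |â(ω)|² - |â(ω + π)|²`, made symmetric by means of the parallelogram identity. -/
lemma exists_isIngredients {a : Mask 1} (ha : IsSymLowPass a) : ∃ b u, IsIngredients a b u := by
  obtain ⟨p, hp, hp'⟩ := exists_spectral_factor_one_sub ha
  obtain ⟨q, hq, hq'⟩ := exists_spectral_factor_low_pass ha
  set Q : Mask 1 := q.mapDomain dil2.mulVec with hQ
  have hQs : ∀ ω, symbol Q ω = symbol q (fun _ => 2 * ω 0) := by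
    intro ω
    rw [hQ, symbol_dilate]
    congr 1
    funext i
    fin_cases i
    simp [Matrix.mulVec, dotProduct, toReal, dil2]
  have hQπ : ∀ ω, symbol Q (shiftPi ω) = symbol Q ω := by
    intro ω
    rw [hQs, hQs, ← symbol_add_two_pi q (fun _ => 2 * ω 0) (fun _ => 1)]
    congr 1
    funext i
    simp [shiftPi]; ring
  have hQneg : ∀ ω, symbol Q (-ω) = conj (symbol Q ω) := by
    intro ω
    rw [hQs, hQs, ← symbol_neg_of_isRealMask hq]
    congr 1
    funext i
    simp
  have hc2 : conj (2 : ℂ) = 2 := Complex.conj_eq_iff_im.2 (by simp)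
  -- `b̂₂ = (Q̂ + e^{-iω} conj Q̂) / 2` is symmetric about `1/2`
  set b₂ : Mask 1 := (1 / 2 : ℂ) • (Q + (conjMask Q).mapDomain (· + fun _ => 1)) with hb₂
  have hb₂s : ∀ ω, symbol b₂ ω = 1 / 2 * (symbol Q ω +
      Complex.exp (-(Complex.I * (ω 0 : ℂ))) * conj (symbol Q ω)) := by
    intro ω
    rw [hb₂, symbol_smul, symbol_add, symbol_translate, symbol_conjMask]
    simp [dotR]
  have hb₂real : IsRealMask b₂ := by
    apply isRealMask_of_symbol
    intro ω
    rw [hb₂s, hb₂s, hQneg]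
    simp only [map_mul, map_add, ← Complex.exp_conj, Complex.conj_conj]
    simp [hc2]
  have hb₂symm : HasSymmetry b₂ := by
    apply hasSymmetry_of_symbol 1 1
    intro ω
    rw [hb₂s, hb₂s, hQneg, Complex.conj_conj]
    have : Complex.exp (-(Complex.I * (ω 0 : ℂ))) *
        Complex.exp (-(Complex.I * (((-ω) 0 : ℝ) : ℂ))) = 1 := by
      rw [← Complex.exp_add]; simp
    simp only [Int.cast_one, one_mul, Units.val_one]
    linear_combination (1 / 2 * symbol Q ω) * this
  -- the even and the odd part of `p`
  set u₁ : Mask 1 := (1 / 2 : ℂ) • (p + conjMask p) with hu₁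
  set u₂ : Mask 1 := (1 / 2 : ℂ) • (p - conjMask p) with hu₂
  have hu₁s : ∀ ω, symbol u₁ ω = 1 / 2 * (symbol p ω + conj (symbol p ω)) := by
    intro ω; rw [hu₁, symbol_smul, symbol_add, symbol_conjMask]
  have hu₂s : ∀ ω, symbol u₂ ω = 1 / 2 * (symbol p ω - conj (symbol p ω)) := by
    intro ω; rw [hu₂, symbol_smul, symbol_sub, symbol_conjMask]
  have hpneg : ∀ ω, symbol p (-ω) = conj (symbol p ω) := fun ω => symbol_neg_of_isRealMask hp ω
  have hpar : ∀ z w : ℂ, ‖1 / 2 * (z + w)‖ ^ 2 + ‖1 / 2 * (z - w)‖ ^ 2 =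
      (‖z‖ ^ 2 + ‖w‖ ^ 2) / 2 := by
    intro z w
    simp only [← Complex.normSq_eq_norm_sq, Complex.normSq_apply, Complex.mul_re, Complex.mul_im,
      Complex.add_re, Complex.add_im, Complex.sub_re, Complex.sub_im]
    norm_num
    ring
  have hexp : ∀ t : ℝ, ‖Complex.exp (-(Complex.I * (t : ℂ)))‖ = 1 := by
    intro t; rw [Complex.norm_exp]; simp
  have hexpπ : ∀ ω : Fin 1 → ℝ, Complex.exp (-(Complex.I * ((shiftPi ω 0 : ℝ) : ℂ))) =
      -Complex.exp (-(Complex.I * (ω 0 : ℂ))) := by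
    intro ω
    have : -(Complex.I * ((shiftPi ω 0 : ℝ) : ℂ)) = -(Complex.I * (ω 0 : ℂ)) - Real.pi * Complex.I := by
      simp [shiftPi]; ring
    rw [this, Complex.exp_sub, Complex.exp_pi_mul_I, div_neg, div_one]
  -- a filter and its canonical partner cancel in the cross relation
  have hcanc : ∀ (v : Mask 1) ω, conj (symbol v ω) * symbol v (shiftPi ω) +
      conj (symbol (partner v) ω) * symbol (partner v) (shiftPi ω) = 0 := by
    intro v ω
    rw [symbol_partner, symbol_partner, symbol_shiftPi_shiftPi, hexpπ, map_mul, Complex.conj_conj]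
    have : conj (Complex.exp (-(Complex.I * (ω 0 : ℂ)))) * Complex.exp (-(Complex.I * (ω 0 : ℂ))) =
        1 := by
      rw [← Complex.normSq_eq_conj_mul_self, Complex.normSq_eq_norm_sq, hexp]; simp
    linear_combination (-(symbol v (shiftPi ω) * conj (symbol v ω))) * this
  refine ⟨![a, partner a, b₂, partner b₂], ![a, u₁, u₂], rfl, ?_, ?_, ⟨⟨?_, ?_⟩, ?_⟩, rfl, ?_, ?_, ?_⟩
  · intro l
    fin_cases l
    exacts [ha.real, isRealMask_partner ha.real, hb₂real, isRealMask_partner hb₂real]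
  · intro l
    fin_cases l
    exacts [ha.symm, ha.symm.conjMod.translate, hb₂symm, hb₂symm.conjMod.translate]
  · intro ω
    have e1 : ∑ l : Fin (2 * 2), ‖symbol (![a, partner a, b₂, partner b₂] l) ω‖ ^ 2 =
        ‖symbol a ω‖ ^ 2 + ‖symbol (partner a) ω‖ ^ 2 + ‖symbol b₂ ω‖ ^ 2 +
          ‖symbol (partner b₂) ω‖ ^ 2 := Fin.sum_univ_four _
    rw [e1, symbol_partner, symbol_partner, norm_mul, norm_mul, hexp, one_mul, one_mul,
      Complex.norm_conj, Complex.norm_conj, hb₂s, hb₂s, hQπ, hexpπ, neg_mul, ← sub_eq_add_neg,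
      add_assoc, hpar, norm_mul, hexp, Complex.norm_conj, hQs]
    linarith [hq' ω]
  · intro ξ hξ hξ0 ω
    rw [omegaM_dil2 hξ hξ0, shift2Pi_half]
    have e1 := Fin.sum_univ_four (fun l : Fin 4 =>
      conj (symbol (![a, partner a, b₂, partner b₂] l) ω) *
        symbol (![a, partner a, b₂, partner b₂] l) (shiftPi ω))
    refine e1.trans ?_
    change conj (symbol a ω) * symbol a (shiftPi ω) +
      conj (symbol (partner a) ω) * symbol (partner a) (shiftPi ω) +
      conj (symbol b₂ ω) * symbol b₂ (shiftPi ω) +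
      conj (symbol (partner b₂) ω) * symbol (partner b₂) (shiftPi ω) = 0
    rw [hcanc, zero_add, hcanc]
  · intro l
    fin_cases l
    · exact symbol_partner a
    · exact symbol_partner b₂
  · intro l
    fin_cases l
    · exact ha.real
    · apply isRealMask_of_symbol
      intro ω
      simp [hu₁s, hpneg, add_comm, hc2]
    · apply isRealMask_of_symbol
      intro ω
      simp [hu₂s, hpneg, hc2]
  · intro l
    fin_cases l
    · exact ha.symm
    · apply hasSymmetry_of_symbol 0 1
      intro ω
      simp [hu₁s, hpneg, add_comm]
    · apply hasSymmetry_of_symbol 0 (-1)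
      intro ω
      simp [hu₂s, hpneg]
      ring
  · intro ω
    change ‖symbol a ω‖ ^ 2 + ‖symbol u₁ ω‖ ^ 2 + ‖symbol u₂ ω‖ ^ 2 = 1
    rw [add_assoc, hu₁s, hu₂s, hpar, Complex.norm_conj, hp']
    ring

end Symmetry

/-! ### The two-dimensional filter bank -/

section Bank

lemma sum_bank_index {β : Type*} [AddCommMonoid β] (g : Fin 4 → Fin 3 → β) :
    ∑ p : Fin (2 * 6), g ⟨p % 4, by omega⟩ ⟨p / 4, by omega⟩ = ∑ k, ∑ l, g l k := by
  have e := (finProdFinEquiv (m := 3) (n := 4)).sum_comp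
    (fun p : Fin (3 * 4) => g ⟨p % 4, by omega⟩ ⟨p / 4, by omega⟩)
  rw [Fintype.sum_prod_type] at e
  refine Eq.trans e.symm (Finset.sum_congr rfl fun k _ => Finset.sum_congr rfl fun l _ => ?_)
  congr 1
  · ext; simp [finProdFinEquiv, Nat.mod_eq_of_lt l.2]
  · ext; simp [finProdFinEquiv]; omega

/-- The filter `b_{l,k}` of the two-dimensional bank. -/
def bankEntry (b : Fin 4 → Mask 1) (u : Fin 3 → Mask 1) (l : Fin 4) (k : Fin 3) : Mask 2 :=
  if (l : ℕ) % 2 = 0 then tensor (b l) (u k) else tensor (b l) (conjMod (u k))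

lemma bank2D_eq (b : Fin 4 → Mask 1) (u : Fin 3 → Mask 1) (p : Fin (2 * 6)) :
    bank2D b u p = bankEntry b u ⟨p % 4, by omega⟩ ⟨p / 4, by omega⟩ := rfl

lemma tensor_apply (u v : Mask 1) (n : Fin 2 → ℤ) :
    tensor u v n = u (fun _ => n 0) * v (fun _ => n 1) := by
  unfold tensor Finsupp.sum
  rw [Finsupp.finsetSum_apply]
  have h : ∀ j k : Fin 1 → ℤ, ![j 0, k 0] = n ↔ (j = fun _ => n 0) ∧ k = fun _ => n 1 := by
    intro j k
    constructor
    · rintro rfl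
      constructor <;> funext i <;> rw [Subsingleton.elim i 0] <;> simp
    · rintro ⟨rfl, rfl⟩
      funext i
      fin_cases i <;> simp
  simp only [Finsupp.finsetSum_apply, Finsupp.single_apply, h, ite_and]
  rw [Finset.sum_congr rfl (g := fun j => if j = (fun _ => n 0) then u j * v (fun _ => n 1) else 0)]
  · rw [Finset.sum_ite_eq']
    split_ifs with h0
    · rfl
    · rw [Finsupp.notMem_support_iff.1 h0, zero_mul]
  · intro j _
    split_ifs
    · rw [Finset.sum_ite_eq']
      split_ifs with h0
      · rfl
      · rw [Finsupp.notMem_support_iff.1 h0, mul_zero]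
    · simp

lemma IsRealMask.tensor {u v : Mask 1} (hu : IsRealMask u) (hv : IsRealMask v) :
    IsRealMask (tensor u v) := by
  intro k
  rw [tensor_apply, Complex.mul_im, hu, hv]; simp

lemma HasSymmetry.tensor {u v : Mask 1} (hu : HasSymmetry u) (hv : HasSymmetry v) :
    HasSymmetry (tensor u v) := by
  obtain ⟨c, ε, h⟩ := hu.exists_reflection
  obtain ⟨c', ε', h'⟩ := hv.exists_reflection
  refine ⟨![c, c'], ![ε, ε'], fun k i => ?_⟩
  fin_cases i
  · have := h (fun _ => k 0)
    have e : (fun _ => c) - (fun _ => k 0) = (fun _ => c - k 0 : Fin 1 → ℤ) := rfl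
    rw [e] at this
    simp [tensor_apply, Function.update, this, mul_assoc]
  · have := h' (fun _ => k 1)
    have e : (fun _ => c') - (fun _ => k 1) = (fun _ => c' - k 1 : Fin 1 → ℤ) := rfl
    rw [e] at this
    simp [tensor_apply, Function.update, this, mul_left_comm]

lemma vec_one_eq (t : ℝ) : (![t] : Fin 1 → ℝ) = fun _ => t := by
  funext i; simp

lemma symbol_bankEntry (b : Fin 4 → Mask 1) (u : Fin 3 → Mask 1) (l : Fin 4) (k : Fin 3)
    (ω : Fin 2 → ℝ) :
    symbol (bankEntry b u l k) ω = symbol (b l) ![ω 0] *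
      if (l : ℕ) % 2 = 0 then symbol (u k) ![ω 1] else conj (symbol (u k) (shiftPi ![ω 1])) := by
  unfold bankEntry
  split_ifs
  · rw [symbol_tensor]
  · rw [symbol_tensor, symbol_conjMod]

lemma shiftPi_vec (t : ℝ) : shiftPi (![t] : Fin 1 → ℝ) = ![t + Real.pi] := by
  funext i; simp [shiftPi]

lemma omegaM_quincunx {M : Matrix (Fin 2) (Fin 2) ℤ} (hM : M = quincunxM ∨ M = quincunxN)
    {ξ : Fin 2 → ℝ} (h : ξ ∈ OmegaM M) (h0 : ξ ≠ 0) : ξ = fun _ => 1 / 2 := by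
  obtain ⟨⟨k, hk⟩, hb⟩ := h
  have h0' := congrFun hk 0
  have h1' := congrFun hk 1
  obtain ⟨a0, a1⟩ := hb 0
  obtain ⟨b0, b1⟩ := hb 1
  obtain ⟨m, n, hm, hn⟩ : ∃ m n : ℤ, ξ 0 + ξ 1 = m ∧ ξ 0 - ξ 1 = n := by
    rcases hM with rfl | rfl
    · refine ⟨k 0, k 1, ?_, ?_⟩
      · rw [← h0']; simp [Matrix.mulVec, dotProduct, toReal, quincunxM]
      · rw [← h1']; simp [Matrix.mulVec, dotProduct, toReal, quincunxM]; ring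
    · refine ⟨k 0, -k 1, ?_, ?_⟩
      · rw [← h0']; simp [Matrix.mulVec, dotProduct, toReal, quincunxN]
      · push_cast; rw [← h1']; simp [Matrix.mulVec, dotProduct, toReal, quincunxN]; ring
  have n1 : n < 1 := by exact_mod_cast (by linarith : (n : ℝ) < 1)
  have n2 : -1 < n := by exact_mod_cast (by linarith : (-1 : ℝ) < n)
  have n0 : n = 0 := by omega
  have m1 : m < 2 := by exact_mod_cast (by linarith : (m : ℝ) < 2)
  have m2 : 0 ≤ m := by exact_mod_cast (by linarith : (0 : ℝ) ≤ m)
  rw [n0] at hn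
  push_cast at hn
  have m0 : m ≠ 0 := by
    rintro rfl
    push_cast at hm
    apply h0
    funext i
    fin_cases i <;> simp <;> linarith
  have m3 : m = 1 := by omega
  rw [m3] at hm
  push_cast at hm
  funext i
  fin_cases i <;> simp <;> linarith

lemma half_mem_omegaM_quincunx {M : Matrix (Fin 2) (Fin 2) ℤ}
    (hM : M = quincunxM ∨ M = quincunxN) : (fun _ => 1 / 2 : Fin 2 → ℝ) ∈ OmegaM M := by
  refine ⟨?_, fun i => by norm_num⟩
  rcases hM with rfl | rfl
  · refine ⟨![1, 0], ?_⟩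
    funext i
    fin_cases i <;> simp [Matrix.mulVec, dotProduct, toReal, quincunxM]; norm_num
  · refine ⟨![1, 0], ?_⟩
    funext i
    fin_cases i <;> simp [Matrix.mulVec, dotProduct, toReal, quincunxN]; norm_num

lemma half_ne_zero {d : ℕ} [NeZero d] : (fun _ => 1 / 2 : Fin d → ℝ) ≠ 0 := by
  intro h
  have := congrFun h 0
  norm_num at this

lemma norm_exp_neg_I_mul (t : ℝ) : ‖Complex.exp (-(Complex.I * (t : ℂ)))‖ = 1 := by
  rw [Complex.norm_exp]; simp

variable {a : Mask 1} {b : Fin 4 → Mask 1} {u : Fin 3 → Mask 1}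

lemma IsIngredients.b_norm (h : IsIngredients a b u) (ω : Fin 1 → ℝ) :
    ‖symbol (b 0) ω‖ ^ 2 + ‖symbol (b 1) ω‖ ^ 2 + ‖symbol (b 2) ω‖ ^ 2 + ‖symbol (b 3) ω‖ ^ 2 = 1 := by
  rw [← h.b_bank.1.1 ω]
  exact (Fin.sum_univ_four fun l : Fin 4 => ‖symbol (b l) ω‖ ^ 2).symm

lemma IsIngredients.b_cross (h : IsIngredients a b u) (ω : Fin 1 → ℝ) :
    conj (symbol (b 0) ω) * symbol (b 0) (shiftPi ω) +
    conj (symbol (b 1) ω) * symbol (b 1) (shiftPi ω) +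
    conj (symbol (b 2) ω) * symbol (b 2) (shiftPi ω) +
    conj (symbol (b 3) ω) * symbol (b 3) (shiftPi ω) = 0 := by
  rw [← h.b_bank.1.2 _ half_mem_omegaM_dil2 half_ne_zero ω, shift2Pi_half]
  exact (Fin.sum_univ_four fun l : Fin 4 => conj (symbol (b l) ω) * symbol (b l) (shiftPi ω)).symm

lemma IsIngredients.u_norm (h : IsIngredients a b u) (ω : Fin 1 → ℝ) :
    ‖symbol (u 0) ω‖ ^ 2 + ‖symbol (u 1) ω‖ ^ 2 + ‖symbol (u 2) ω‖ ^ 2 = 1 := by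
  rw [h.u_zero, h.u_sum]

lemma IsIngredients.partner_even (h : IsIngredients a b u) :
    IsCanonicalPartner (b 0) (b 1) ∧ IsCanonicalPartner (b 2) (b 3) :=
  ⟨h.b_bank.2 0, h.b_bank.2 1⟩

lemma IsIngredients.bank2D_zero (h : IsIngredients a b u) : bank2D b u 0 = tensor a a := by
  rw [bank2D_eq]
  change bankEntry b u 0 0 = _
  simp [bankEntry, h.b_zero, h.u_zero]

/-- Both quincunx matrices have the same dual coset `(1/2, 1/2)`, so the filter bank is tight for
either of them. -/
lemma IsIngredients.tight (h : IsIngredients a b u) {M : Matrix (Fin 2) (Fin 2) ℤ}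
    (hM : M = quincunxM ∨ M = quincunxN) : IsTightFilterBank M (bank2D b u) := by
  constructor
  · intro ω
    simp only [bank2D_eq]
    rw [sum_bank_index (fun l k => ‖symbol (bankEntry b u l k) ω‖ ^ 2)]
    simp only [symbol_bankEntry, Fin.sum_univ_four, Fin.sum_univ_three, norm_mul, mul_pow]
    simp only [Fin.val_zero, Fin.val_one, Fin.val_two, show ((3 : Fin 4) : ℕ) = 3 from rfl,
      Nat.zero_mod, Nat.mod_self, if_true, show ¬ (1 % 2 = 0) from by norm_num, if_false, Complex.norm_conj]
    have h1 := h.b_norm ![ω 0]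
    have h2 := h.u_norm ![ω 1]
    have h3 := h.u_norm (shiftPi ![ω 1])
    linear_combination h1 + (‖symbol (b 0) ![ω 0]‖ ^ 2 + ‖symbol (b 2) ![ω 0]‖ ^ 2) * h2 +
      (‖symbol (b 1) ![ω 0]‖ ^ 2 + ‖symbol (b 3) ![ω 0]‖ ^ 2) * h3
  · intro ξ hξ hξ0 ω
    rw [omegaM_quincunx hM hξ hξ0, shift2Pi_half]
    simp only [bank2D_eq]
    rw [sum_bank_index (fun l k => conj (symbol (bankEntry b u l k) ω) *
      symbol (bankEntry b u l k) (shiftPi ω))]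
    have e0 : (![shiftPi ω 0] : Fin 1 → ℝ) = shiftPi ![ω 0] := by simp [shiftPi_vec, shiftPi]
    have e1 : (![shiftPi ω 1] : Fin 1 → ℝ) = shiftPi ![ω 1] := by simp [shiftPi_vec, shiftPi]
    simp only [symbol_bankEntry, Fin.sum_univ_four, Fin.sum_univ_three, map_mul, e0, e1]
    simp only [Fin.val_zero, Fin.val_one, Fin.val_two, show ((3 : Fin 4) : ℕ) = 3 from rfl,
      Nat.zero_mod, Nat.mod_self, if_true, show ¬ (1 % 2 = 0) from by norm_num, if_false, Complex.conj_conj, symbol_shiftPi_shiftPi]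
    have h1 := h.b_cross ![ω 0]
    linear_combination (conj (symbol (u 0) ![ω 1]) * symbol (u 0) (shiftPi ![ω 1]) +
      conj (symbol (u 1) ![ω 1]) * symbol (u 1) (shiftPi ![ω 1]) +
      conj (symbol (u 2) ![ω 1]) * symbol (u 2) (shiftPi ![ω 1])) * h1

lemma isCanonicalPartner_bankEntry {l l' : Fin 4} (hl : (l : ℕ) % 2 = 0) (hl' : ¬ (l' : ℕ) % 2 = 0)
    (h : IsCanonicalPartner (b l) (b l')) (k : Fin 3) :
    IsCanonicalPartner (bankEntry b u l k) (bankEntry b u l' k) := by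
  intro ω
  have e0 : (![shiftPi ω 0] : Fin 1 → ℝ) = shiftPi ![ω 0] := by simp [shiftPi_vec, shiftPi]
  have e1 : (![shiftPi ω 1] : Fin 1 → ℝ) = shiftPi ![ω 1] := by simp [shiftPi_vec, shiftPi]
  rw [symbol_bankEntry, symbol_bankEntry, if_pos hl, if_neg hl', h, map_mul, e0, e1]
  simp [mul_assoc]

lemma IsIngredients.isMultipleCanonicalTightBank (h : IsIngredients a b u) :
    IsMultipleCanonicalTightBank quincunxM 6 (bank2D b u) := by
  refine ⟨h.tight (Or.inl rfl), fun s => ?_⟩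
  obtain ⟨h0, h2⟩ := h.partner_even
  rw [bank2D_eq, bank2D_eq]
  rcases Nat.even_or_odd' (s : ℕ) with ⟨m, hm | hm⟩
  · have e1 : (⟨(2 * (s : ℕ)) % 4, by omega⟩ : Fin 4) = 0 := by ext; simp; omega
    have e2 : (⟨(2 * (s : ℕ) + 1) % 4, by omega⟩ : Fin 4) = 1 := by ext; simp; omega
    have e3 : (⟨(2 * (s : ℕ) + 1) / 4, by omega⟩ : Fin 3) = ⟨2 * (s : ℕ) / 4, by omega⟩ := by
      ext; simp; omega
    simp only [e1, e2, e3]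
    exact isCanonicalPartner_bankEntry (by simp) (by simp) h0 _
  · have e1 : (⟨(2 * (s : ℕ)) % 4, by omega⟩ : Fin 4) = 2 := by ext; simp; omega
    have e2 : (⟨(2 * (s : ℕ) + 1) % 4, by omega⟩ : Fin 4) = 3 := by
      ext; simp only [show ((3 : Fin 4) : ℕ) = 3 from rfl]; omega
    have e3 : (⟨(2 * (s : ℕ) + 1) / 4, by omega⟩ : Fin 3) = ⟨2 * (s : ℕ) / 4, by omega⟩ := by
      ext; simp; omega
    simp only [e1, e2, e3]
    exact isCanonicalPartner_bankEntry (by simp) (by simp) h2 _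

lemma IsIngredients.isRealMask_bank2D (h : IsIngredients a b u) (p : Fin (2 * 6)) :
    IsRealMask (bank2D b u p) := by
  rw [bank2D_eq]
  unfold bankEntry
  split_ifs
  · exact (h.b_real _).tensor (h.u_real _)
  · exact (h.b_real _).tensor (h.u_real _).conjMod

lemma IsIngredients.hasSymmetry_bank2D (h : IsIngredients a b u) (p : Fin (2 * 6)) :
    HasSymmetry (bank2D b u p) := by
  rw [bank2D_eq]
  unfold bankEntry
  split_ifs
  · exact (h.b_symm _).tensor (h.u_symm _)
  · exact (h.b_symm _).tensor (h.u_symm _).conjMod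

/-- A low-pass filter with symmetry cannot be antisymmetric. -/
lemma IsSymLowPass.exists_reflection (ha : IsSymLowPass a) :
    ∃ c : ℤ, ∀ k : ℤ, a (fun _ => c - k) = a (fun _ => k) := by
  obtain ⟨c, ε, h⟩ := ha.symm.exists_reflection
  have hs : ∀ v : Mask 1, symbol v 0 = v.sum fun _ z => z := by intro v; simp [symbol, dotR]
  have h1 : a.mapDomain (fun k => (fun _ => c) - k) = ((ε : ℤ) : ℂ) • a := by
    ext k
    have : a.mapDomain (fun k => (fun _ => c) - k) k = a ((fun _ => c) - k) := by
      conv_lhs => rw [show k = (fun _ => c) - ((fun _ => c) - k) by abel]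
      exact Finsupp.mapDomain_apply (fun x y hxy => by simpa using hxy) a _
    rw [this, h]; simp
  have h2 := congrArg (fun v => symbol v 0) h1
  simp only [symbol_smul, ha.low] at h2
  rw [hs, Finsupp.sum_mapDomain_index (by simp) (by simp), ← hs, ha.low, mul_one] at h2
  refine ⟨c, fun k => ?_⟩
  have := h (fun _ => k)
  rw [← h2, one_mul] at this
  exact this

lemma IsSymLowPass.isGSymmetricAbout (ha : IsSymLowPass a) :
    ∃ c : Fin 2 → ℝ, IsGSymmetricAbout D4 c (tensor a a) := by
  obtain ⟨c, h⟩ := ha.exists_reflection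
  refine ⟨fun _ => c / 2, fun k A hA => ?_⟩
  have hv : ∀ (A : Matrix (Fin 2) (Fin 2) ℤ) (x : Fin 2 → ℝ) (i : Fin 2),
      (toReal A).mulVec x i = A i 0 * x 0 + A i 1 * x 1 := by
    intro A x i; simp [Matrix.mulVec, dotProduct, toReal]
  simp only [hv]
  simp only [D4, Set.mem_insert_iff, Set.mem_singleton_iff] at hA
  rcases hA with rfl | rfl | rfl | rfl | rfl | rfl | rfl | rfl
  · exact ⟨![k 0, k 1], fun i => by fin_cases i <;> simp, by simp [tensor_apply]⟩
  · exact ⟨![c - k 0, c - k 1], fun i => by fin_cases i <;> simp <;> ring,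
      by simp [tensor_apply, h]⟩
  · exact ⟨![k 0, c - k 1], fun i => by fin_cases i <;> simp; ring, by simp [tensor_apply, h]⟩
  · exact ⟨![c - k 0, k 1], fun i => by fin_cases i <;> simp; ring, by simp [tensor_apply, h]⟩
  · exact ⟨![k 1, k 0], fun i => by fin_cases i <;> simp, by simp [tensor_apply, mul_comm]⟩
  · exact ⟨![c - k 1, c - k 0], fun i => by fin_cases i <;> simp <;> ring,
      by simp [tensor_apply, h, mul_comm]⟩
  · exact ⟨![k 1, c - k 0], fun i => by fin_cases i <;> simp; ring,
      by simp [tensor_apply, h, mul_comm]⟩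
  · exact ⟨![c - k 1, k 0], fun i => by fin_cases i <;> simp; ring,
      by simp [tensor_apply, h, mul_comm]⟩

end Bank

/-! ### Sum rules and vanishing moments -/

section Orders

/-- An analytic function is `O(t^m)` at `0` exactly if it vanishes there to order at least `m`. -/
lemma isBigO_pow_iff_le_analyticOrderAt {f : ℝ → ℂ} (hf : AnalyticAt ℝ f 0) (m : ℕ) :
    (f =O[𝓝 0] fun t => t ^ m) ↔ (m : ℕ∞) ≤ analyticOrderAt f 0 := by
  constructor
  · intro h
    by_contra hlt
    rw [not_le] at hlt
    obtain ⟨n, hn⟩ := ENat.ne_top_iff_exists.1 (ne_top_of_lt hlt)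
    rw [← hn] at hlt
    have hnm : n < m := by exact_mod_cast hlt
    obtain ⟨g, hg, hg0, hfg⟩ := (hf.analyticOrderAt_eq_natCast).1 hn.symm
    have h1 : g =O[𝓝[≠] 0] fun t : ℝ => t ^ (m - n) := by
      obtain ⟨C, hC⟩ := h.bound
      refine IsBigO.of_bound C ?_
      filter_upwards [hC.filter_mono nhdsWithin_le_nhds, hfg.filter_mono nhdsWithin_le_nhds,
        self_mem_nhdsWithin] with t ht hft ht0
      rw [hft, sub_zero, norm_smul, norm_pow, norm_pow] at ht
      have hpos : 0 < ‖t‖ ^ n := pow_pos (norm_pos_iff.2 ht0) n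
      rw [norm_pow]
      refine le_of_mul_le_mul_left (ht.trans_eq ?_) hpos
      rw [mul_left_comm, ← pow_add, Nat.add_sub_cancel' hnm.le]
    have h2 : Tendsto g (𝓝[≠] 0) (𝓝 0) := by
      refine h1.trans_tendsto ?_
      have : Tendsto (fun t : ℝ => t ^ (m - n)) (𝓝 0) (𝓝 (0 ^ (m - n))) :=
        (continuous_pow _).tendsto 0
      rw [zero_pow (by omega)] at this
      exact this.mono_left nhdsWithin_le_nhds
    exact hg0 (tendsto_nhds_unique (hg.continuousAt.tendsto.mono_left nhdsWithin_le_nhds) h2)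
  · intro h
    obtain ⟨g, hg, hfg⟩ := (natCast_le_analyticOrderAt hf).1 h
    have h1 : (fun t : ℝ => t ^ m • g t) =O[𝓝 0] fun t : ℝ => t ^ m * (1 : ℝ) := by
      refine (isBigO_refl (fun t : ℝ => t ^ m) _).smul ?_
      exact hg.continuousAt.isBigO_one ℝ
    simp only [mul_one] at h1
    refine (IsBigO.congr' h1 ?_ (by rfl))
    filter_upwards [hfg] with t ht
    rw [ht, sub_zero]

lemma analyticOrderAt_sq_complex {f : ℝ → ℂ} (hf : AnalyticAt ℝ f 0) :
    analyticOrderAt (f ^ 2) 0 = 2 * analyticOrderAt f 0 := by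
  by_cases htop : analyticOrderAt f 0 = ⊤
  · rw [htop, ENat.mul_top (by norm_num), analyticOrderAt_eq_top]
    filter_upwards [analyticOrderAt_eq_top.1 htop] with t ht
    simp [ht]
  · obtain ⟨n, hn⟩ := ENat.ne_top_iff_exists.1 htop
    obtain ⟨g, hg, hg0, hfg⟩ := (hf.analyticOrderAt_eq_natCast).1 hn.symm
    rw [← hn]
    have := ((hf.pow 2).analyticOrderAt_eq_natCast (n := 2 * n)).2
      ⟨g ^ 2, hg.pow 2, pow_ne_zero 2 hg0, by
        filter_upwards [hfg] with t ht
        rw [Pi.pow_apply, ht, Pi.pow_apply, smul_pow, ← pow_mul, mul_comm n 2]⟩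
    rw [this]
    push_cast
    rfl

lemma analyticAt_symbol_line (u : Mask 1) (s t : ℝ) :
    AnalyticAt ℝ (fun t : ℝ => symbol u (fun _ => t + s)) t := by
  have h : (fun t : ℝ => symbol u (fun _ => t + s)) = fun t : ℝ => ∑ k ∈ u.support,
      u k * Complex.exp (-(Complex.I * ((k 0 : ℂ) * ((Complex.ofRealCLM t) + s)))) := by
    funext t
    unfold symbol Finsupp.sum dotR
    simp
  rw [h]
  have h1 : AnalyticAt ℝ (fun t : ℝ => Complex.ofRealCLM t) t := Complex.ofRealCLM.analyticAt t
  refine Finset.analyticAt_fun_sum _ fun k _ => ?_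
  refine analyticAt_const.mul ?_
  have h2 : AnalyticAt ℝ (fun t : ℝ => -(Complex.I * ((k 0 : ℂ) * ((Complex.ofRealCLM t) + s)))) t :=
    (analyticAt_const.mul (analyticAt_const.mul (h1.add analyticAt_const))).neg
  exact (AnalyticAt.restrictScalars (𝕜 := ℝ) analyticAt_cexp).fun_comp h2

/-- The order of vanishing of the symbol of `u` at the point `s`. -/
def lineOrder (u : Mask 1) (s : ℝ) : ℕ∞ := analyticOrderAt (fun t : ℝ => symbol u (fun _ => t + s)) 0

lemma isBigO_line_iff (u : Mask 1) (s : ℝ) (m : ℕ) :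
    ((fun t : ℝ => symbol u (fun _ => t + s)) =O[𝓝 0] fun t => t ^ m) ↔ (m : ℕ∞) ≤ lineOrder u s :=
  isBigO_pow_iff_le_analyticOrderAt (analyticAt_symbol_line u s 0) m

lemma lineOrder_ne_top {u : Mask 1} (hu : u ≠ 0) (s : ℝ) : lineOrder u s ≠ ⊤ := by
  intro h
  apply hu
  have h1 : AnalyticOnNhd ℝ (fun t : ℝ => symbol u (fun _ => t + s)) Set.univ :=
    fun t _ => analyticAt_symbol_line u s t
  have h2 := h1.eq_of_eventuallyEq (g := fun _ => 0) (fun t _ => analyticAt_const)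
    (analyticOrderAt_eq_top.1 h)
  apply symbol_injective
  intro ω
  have h3 := congrFun h2 (ω 0 - s)
  simp only [sub_add_cancel] at h3
  rw [symbol_zero, ← h3]
  congr 1
  funext i
  rw [Subsingleton.elim i 0]

/-- Passing between a function of one real variable and of a vector with one entry. -/
lemma isBigO_vec_one_iff {f : ℝ → ℂ} {m : ℕ} :
    ((fun ω : Fin 1 → ℝ => f (ω 0)) =O[𝓝 0] fun ω => ‖ω‖ ^ m) ↔ f =O[𝓝 0] fun t => t ^ m := by
  constructor
  · intro h
    have h1 : Tendsto (fun t : ℝ => (fun _ => t : Fin 1 → ℝ)) (𝓝 0) (𝓝 0) := by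
      have : Continuous (fun t : ℝ => (fun _ => t : Fin 1 → ℝ)) := by fun_prop
      exact this.tendsto' 0 0 rfl
    have h2 := h.comp_tendsto h1
    refine (h2.trans (IsBigO.of_bound 1 ?_))
    filter_upwards with t
    simp
  · intro h
    have h1 : Tendsto (fun ω : Fin 1 → ℝ => ω 0) (𝓝 0) (𝓝 0) :=
      (continuous_apply 0).tendsto' 0 0 rfl
    have h2 := h.comp_tendsto h1
    refine (h2.trans (IsBigO.of_bound 1 ?_))
    filter_upwards with ω
    simp only [Function.comp_apply, norm_pow, norm_norm, one_mul]
    gcongr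
    exact norm_le_pi_norm ω 0

lemma shiftPi_eq_line (ω : Fin 1 → ℝ) : shiftPi ω = fun _ => ω 0 + Real.pi := by
  funext i; rw [Subsingleton.elim i 0]; rfl

lemma iSup_natCast_le (s : ℕ∞) : ⨆ (m : ℕ) (_ : (m : ℕ∞) ≤ s), (m : ℕ∞) = s := by
  refine le_antisymm (iSup₂_le fun _ h => h) ?_
  refine ENat.forall_natCast_le_iff_le.1 fun m hm => ?_
  exact le_iSup₂_of_le m hm le_rfl

lemma hasSumRules_dil2_iff {a : Mask 1} (ha : symbol a 0 = 1) (m : ℕ) :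
    HasSumRules a dil2 m ↔ (m : ℕ∞) ≤ lineOrder a Real.pi := by
  rw [← isBigO_line_iff, ← isBigO_vec_one_iff]
  have e : ∀ ω : Fin 1 → ℝ, symbol a (shift2Pi ω fun _ => 1 / 2) =
      symbol a (fun _ => ω 0 + Real.pi) := by
    intro ω; rw [shift2Pi_half, shiftPi_eq_line]
  constructor
  · intro h
    have := h.2 _ half_mem_omegaM_dil2 half_ne_zero
    simpa only [e] using this
  · intro h
    refine ⟨ha, fun ξ hξ hξ0 => ?_⟩
    rw [omegaM_dil2 hξ hξ0]
    simpa only [e] using h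

lemma sr_dil2 {a : Mask 1} (ha : symbol a 0 = 1) : sr a dil2 = lineOrder a Real.pi := by
  unfold sr
  simp only [hasSumRules_dil2_iff ha]
  exact iSup_natCast_le _

lemma ne_zero_of_symbol_zero {a : Mask 1} (ha : symbol a 0 = 1) : a ≠ 0 := by
  rintro rfl; simp [symbol_zero] at ha

lemma symbol_tensor_shiftPi (u v : Mask 1) (ω : Fin 2 → ℝ) :
    symbol (tensor u v) (shiftPi ω) =
      symbol u (fun _ => ω 0 + Real.pi) * symbol v (fun _ => ω 1 + Real.pi) := by
  rw [symbol_tensor, vec_one_eq, vec_one_eq]; rfl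

lemma isBigO_coord {f : ℝ → ℂ} {m : ℕ} (h : f =O[𝓝 0] fun t => t ^ m) (i : Fin 2) :
    (fun ω : Fin 2 → ℝ => f (ω i)) =O[𝓝 0] fun ω => ‖ω‖ ^ m := by
  have h1 : Tendsto (fun ω : Fin 2 → ℝ => ω i) (𝓝 0) (𝓝 0) :=
    (continuous_apply i).tendsto' 0 0 rfl
  refine ((h.comp_tendsto h1).trans (IsBigO.of_bound 1 ?_))
  filter_upwards with ω
  simp only [Function.comp_apply, norm_pow, norm_norm, one_mul]
  gcongr
  exact norm_le_pi_norm ω i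

/-- The function `â(ω₁ + π) â(ω₂ + π)` vanishes at `0` to twice the order of `â` at `π`. -/
lemma hasSumRules_tensor_iff {a : Mask 1} (ha : symbol a 0 = 1) {M : Matrix (Fin 2) (Fin 2) ℤ}
    (hM : M = quincunxM ∨ M = quincunxN) (m : ℕ) :
    HasSumRules (tensor a a) M m ↔ (m : ℕ∞) ≤ 2 * lineOrder a Real.pi := by
  obtain ⟨s, hs⟩ := ENat.ne_top_iff_exists.1 (lineOrder_ne_top (ne_zero_of_symbol_zero ha) Real.pi)
  have h0 : symbol (tensor a a) 0 = 1 := by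
    have : (![0] : Fin 1 → ℝ) = 0 := by simp
    rw [symbol_tensor, Pi.zero_apply, Pi.zero_apply, this, ha, one_mul]
  constructor
  · -- restrict to the diagonal
    intro h
    have h1 := h.2 _ (half_mem_omegaM_quincunx hM) half_ne_zero
    have hd : Tendsto (fun t : ℝ => (fun _ => t : Fin 2 → ℝ)) (𝓝 0) (𝓝 0) := by
      have : Continuous (fun t : ℝ => (fun _ => t : Fin 2 → ℝ)) := by fun_prop
      exact this.tendsto' 0 0 rfl
    have h2 := h1.comp_tendsto hd
    have han := analyticAt_symbol_line a Real.pi 0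
    have h3 : ((fun t : ℝ => symbol a (fun _ => t + Real.pi)) ^ 2) =O[𝓝 0] fun t : ℝ => t ^ m := by
      refine IsBigO.congr' (h2.trans (IsBigO.of_bound 1 (g := fun t : ℝ => t ^ m) ?_)) ?_ (by rfl)
      · filter_upwards with t
        simp
      · filter_upwards with t
        simp only [Function.comp_apply, Pi.pow_apply]
        rw [shift2Pi_half, symbol_tensor_shiftPi, sq]
    rw [isBigO_pow_iff_le_analyticOrderAt (han.pow 2), analyticOrderAt_sq_complex han] at h3
    exact_mod_cast h3
  · intro h
    refine ⟨h0, fun ξ hξ hξ0 => ?_⟩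
    rw [omegaM_quincunx hM hξ hξ0]
    have hO : (fun t : ℝ => symbol a (fun _ => t + Real.pi)) =O[𝓝 0] fun t => t ^ s :=
      (isBigO_line_iff a Real.pi s).2 hs.le
    have h1 := (isBigO_coord hO 0).mul (isBigO_coord hO 1)
    rw [← hs] at h
    have hms : m ≤ 2 * s := by exact_mod_cast h
    refine IsBigO.congr' (h1.trans (IsBigO.of_bound 1 ?_)) ?_ (by rfl)
    · have hball : ∀ᶠ ω : Fin 2 → ℝ in 𝓝 0, ‖ω‖ ≤ 1 := by
        filter_upwards [Metric.closedBall_mem_nhds (0 : Fin 2 → ℝ) one_pos] with ω hω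
        simpa using hω
      filter_upwards [hball] with ω hω
      rw [← pow_add, norm_pow, norm_pow, norm_norm, one_mul, ← two_mul]
      exact pow_le_pow_of_le_one (norm_nonneg _) hω hms
    · filter_upwards with ω
      rw [shift2Pi_half, symbol_tensor_shiftPi]

/-- The sum rule order of `a ⊗ a` is exactly twice that of `a`. -/
lemma sr_tensor {a : Mask 1} (ha : symbol a 0 = 1) {M : Matrix (Fin 2) (Fin 2) ℤ}
    (hM : M = quincunxM ∨ M = quincunxN) : sr (tensor a a) M = 2 * sr a dil2 := by
  rw [sr_dil2 ha]
  unfold sr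
  simp only [hasSumRules_tensor_iff ha hM]
  exact iSup_natCast_le _

lemma sr_dil2_ne_top {a : Mask 1} (ha : symbol a 0 = 1) : sr a dil2 ≠ ⊤ := by
  rw [sr_dil2 ha]
  exact lineOrder_ne_top (ne_zero_of_symbol_zero ha) _

/-! ### Vanishing moments of the high-pass filters -/

lemma le_vm_of_isBigO {d : ℕ} {v : Mask d} {n : ℕ} (h : symbol v =O[𝓝 0] fun ω => ‖ω‖ ^ n) :
    (n : ℕ∞) ≤ vm v :=
  le_iSup₂_of_le n h le_rfl

variable {a : Mask 1} {b : Fin 4 → Mask 1} {u : Fin 3 → Mask 1}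

lemma IsIngredients.norm_b_le_one (h : IsIngredients a b u) (l : Fin 4) (ω : Fin 1 → ℝ) :
    ‖symbol (b l) ω‖ ≤ 1 := by
  rw [← sq_le_one_iff₀ (norm_nonneg _), ← h.b_bank.1.1 ω]
  exact Finset.single_le_sum (f := fun l => ‖symbol (b l) ω‖ ^ 2) (fun _ _ => by positivity)
    (Finset.mem_univ l)

lemma IsIngredients.norm_u_le_one (h : IsIngredients a b u) (k : Fin 3) (ω : Fin 1 → ℝ) :
    ‖symbol (u k) ω‖ ≤ 1 := by
  rw [← sq_le_one_iff₀ (norm_nonneg _)]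
  have h1 := h.u_norm ω
  have : ∀ k, 0 ≤ ‖symbol (u k) ω‖ ^ 2 := fun k => by positivity
  fin_cases k <;> simp only [Fin.zero_eta, Fin.mk_one, Fin.reduceFinMk] <;>
    linarith [this 0, this 1, this 2]

lemma isBigO_tensor_left {f g : ℝ → ℂ} {m : ℕ} (hf : f =O[𝓝 0] fun t => t ^ m)
    (hg : ∀ t, ‖g t‖ ≤ 1) :
    (fun ω : Fin 2 → ℝ => f (ω 0) * g (ω 1)) =O[𝓝 0] fun ω => ‖ω‖ ^ m := by
  have h1 := (isBigO_coord hf 0).mul (g₁ := fun ω => ‖ω‖ ^ m) (f₂ := fun ω : Fin 2 → ℝ => g (ω 1))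
    (g₂ := fun _ => (1 : ℝ)) (IsBigO.of_bound 1 (by filter_upwards with ω; simpa using hg _))
  simpa using h1

lemma isBigO_tensor_right {f g : ℝ → ℂ} {m : ℕ} (hf : ∀ t, ‖f t‖ ≤ 1)
    (hg : g =O[𝓝 0] fun t => t ^ m) :
    (fun ω : Fin 2 → ℝ => f (ω 0) * g (ω 1)) =O[𝓝 0] fun ω => ‖ω‖ ^ m := by
  have h1 := (IsBigO.of_bound (f := fun ω : Fin 2 → ℝ => f (ω 0)) (g := fun _ => (1 : ℝ))
    (l := 𝓝 0) 1 (by filter_upwards with ω; simpa using hf _)).mul (isBigO_coord hg 1)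
  simpa using h1

lemma IsIngredients.lineOrder_b_le_vm (h : IsIngredients a b u) (l : Fin 4) (k : Fin 3) :
    lineOrder (b l) 0 ≤ vm (bankEntry b u l k) := by
  refine ENat.forall_natCast_le_iff_le.1 fun m hm => le_vm_of_isBigO ?_
  have h1 := isBigO_tensor_left ((isBigO_line_iff (b l) 0 m).2 hm)
    (g := fun t => if (l : ℕ) % 2 = 0 then symbol (u k) ![t] else
      conj (symbol (u k) (shiftPi ![t]))) (fun t => by
        split_ifs
        · exact h.norm_u_le_one _ _
        · rw [Complex.norm_conj]; exact h.norm_u_le_one _ _)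
  refine h1.congr_left fun ω => ?_
  rw [symbol_bankEntry]
  simp [vec_one_eq]

lemma IsIngredients.lineOrder_u_le_vm (h : IsIngredients a b u) (k : Fin 3) :
    lineOrder (u k) 0 ≤ vm (bankEntry b u 0 k) := by
  refine ENat.forall_natCast_le_iff_le.1 fun m hm => le_vm_of_isBigO ?_
  have h1 := isBigO_tensor_right (f := fun t => symbol (b 0) ![t])
    (fun t => h.norm_b_le_one _ _) ((isBigO_line_iff (u k) 0 m).2 hm)
  refine h1.congr_left fun ω => ?_
  rw [symbol_bankEntry]
  simp [vec_one_eq]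

/-- If `|v̂|² ≤ 1 - |â|²`, then linear-phase moments of `a` give vanishing moments of `v`. -/
lemma le_two_mul_lineOrder {v : Mask 1} {c : Fin 1 → ℝ} {N : ℕ}
    (hc : HasLinearPhaseMoments a c N) (hv : ∀ ω, ‖symbol v ω‖ ^ 2 + ‖symbol a ω‖ ^ 2 ≤ 1) :
    (N : ℕ∞) ≤ 2 * lineOrder v 0 := by
  have h1 : ((fun t : ℝ => symbol v (fun _ => t + 0)) ^ 2) =O[𝓝 0] fun t : ℝ => t ^ N := by
    have hd : Tendsto (fun t : ℝ => (fun _ => t + 0 : Fin 1 → ℝ)) (𝓝 0) (𝓝 0) := by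
      have : Continuous (fun t : ℝ => (fun _ => t + 0 : Fin 1 → ℝ)) := by fun_prop
      exact this.tendsto' 0 0 (by funext; simp)
    have h2 := IsBigO.comp_tendsto hc hd
    refine IsBigO.trans (IsBigO.of_bound 2 ?_) (h2.trans (IsBigO.of_bound 1 ?_))
    · filter_upwards with t
      set ω : Fin 1 → ℝ := fun _ => t + 0
      set e := Complex.exp (-(Complex.I * ((∑ i, c i * ω i : ℝ) : ℂ))) with he
      have he1 : ‖e‖ = 1 := norm_exp_neg_I_mul _
      have h3 : ‖e‖ - ‖symbol a ω‖ ≤ ‖symbol a ω - e‖ := by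
        rw [← norm_neg (symbol a ω - e), neg_sub]; exact norm_sub_norm_le _ _
      have h4 := hv ω
      have h5 : ‖symbol a ω‖ ≤ 1 := by
        rw [← sq_le_one_iff₀ (norm_nonneg _)]; nlinarith [sq_nonneg ‖symbol v ω‖]
      simp only [Pi.pow_apply, norm_pow, Function.comp_apply]
      rw [he1] at h3
      have h6 := norm_nonneg (symbol a ω)
      change ‖symbol v ω‖ ^ 2 ≤ 2 * ‖symbol a ω - e‖
      nlinarith
    · filter_upwards with t
      simp
  have han := analyticAt_symbol_line v 0 0
  rw [isBigO_pow_iff_le_analyticOrderAt (han.pow 2), analyticOrderAt_sq_complex han] at h1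
  exact_mod_cast h1

lemma IsIngredients.lpm_le_b (h : IsIngredients a b u) {l : Fin 4} (hl : l ≠ 0) :
    lpm a ≤ 2 * lineOrder (b l) 0 := by
  refine iSup₂_le fun N hN => ?_
  obtain ⟨c, hc⟩ := hN
  refine le_two_mul_lineOrder hc fun ω => ?_
  have h1 := h.b_norm ω
  rw [h.b_zero] at h1
  have : ∀ k, 0 ≤ ‖symbol (b k) ω‖ ^ 2 := fun k => by positivity
  fin_cases l
  · exact absurd rfl hl
  all_goals
    simp only [Fin.mk_one, Fin.reduceFinMk]
    linarith [this 1, this 2, this 3]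

lemma IsIngredients.lpm_le_u (h : IsIngredients a b u) {k : Fin 3} (hk : k ≠ 0) :
    lpm a ≤ 2 * lineOrder (u k) 0 := by
  refine iSup₂_le fun N hN => ?_
  obtain ⟨c, hc⟩ := hN
  refine le_two_mul_lineOrder hc fun ω => ?_
  have h1 := h.u_sum ω
  have : ∀ k, 0 ≤ ‖symbol (u k) ω‖ ^ 2 := fun k => by positivity
  fin_cases k
  · exact absurd rfl hk
  all_goals
    simp only [Fin.mk_one, Fin.reduceFinMk]
    linarith [this 1, this 2]

/-- Each of the eleven filters has a factor `b̂_ℓ(ω₁)` with `ℓ ≠ 0` or `û_k(ω₂)` with `k ≠ 0`; the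
squared modulus of this factor is at most `1 - |â|²`, and the other factor is bounded. -/
lemma IsIngredients.min_le_two_vm (h : IsIngredients a b u) {p : Fin (2 * 6)} (hp : p ≠ 0) :
    min (4 * sr a dil2) (lpm a) ≤ 2 * vm (bank2D b u p) := by
  rw [bank2D_eq]
  by_cases hl : (⟨p % 4, by omega⟩ : Fin 4) = 0
  · have hk : (⟨p / 4, by omega⟩ : Fin 3) ≠ 0 := by
      intro hk
      apply hp
      have h1 := congrArg Fin.val hl
      have h2 := congrArg Fin.val hk
      ext
      simp at h1 h2 ⊢
      omega
    rw [hl]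
    refine (min_le_right _ _).trans ((h.lpm_le_u hk).trans ?_)
    gcongr
    exact h.lineOrder_u_le_vm _
  · refine (min_le_right _ _).trans ((h.lpm_le_b hl).trans ?_)
    gcongr
    exact h.lineOrder_b_le_vm _ _

end Orders

/-! ### The smoothness exponents of `a` and of `a ⊗ a` -/

section Smoothness

/-- The vectors `v` and `w` have the same coordinates up to order and signs. -/
def SameAbs (v w : Fin 2 → ℝ) : Prop :=
  (|v 0| = |w 0| ∧ |v 1| = |w 1|) ∨ (|v 0| = |w 1| ∧ |v 1| = |w 0|)

lemma SameAbs.refl (v : Fin 2 → ℝ) : SameAbs v v := Or.inl ⟨rfl, rfl⟩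

lemma norm_symbol_abs {a : Mask 1} (ha : IsRealMask a) {s t : ℝ} (h : |s| = |t|) :
    ‖symbol a ![s]‖ = ‖symbol a ![t]‖ := by
  rcases abs_eq_abs.1 h with rfl | rfl
  · rfl
  · have : (![-t] : Fin 1 → ℝ) = -![t] := by simp
    rw [this, symbol_neg_of_isRealMask ha, Complex.norm_conj]

lemma norm_symbol_tensor_sameAbs {a : Mask 1} (ha : IsRealMask a) {v w : Fin 2 → ℝ}
    (h : SameAbs v w) : ‖symbol (tensor a a) v‖ = ‖symbol (tensor a a) w‖ := by
  rw [symbol_tensor, symbol_tensor, norm_mul, norm_mul]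
  rcases h with ⟨h0, h1⟩ | ⟨h0, h1⟩
  · rw [norm_symbol_abs ha h0, norm_symbol_abs ha h1]
  · rw [norm_symbol_abs ha h0, norm_symbol_abs ha h1, mul_comm]

lemma SameAbs.add_sub {v w : Fin 2 → ℝ} (h : SameAbs v w) :
    SameAbs ![v 0 + v 1, v 0 - v 1] ![w 0 + w 1, w 0 - w 1] := by
  unfold SameAbs at *
  simp only [Matrix.cons_val_zero, Matrix.cons_val_one]
  simp only [abs_eq_abs] at *
  grind

lemma SameAbs.neg_left {w : Fin 2 → ℝ} {x y : ℝ} (h : SameAbs ![x, y] w) :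
    SameAbs ![x, -y] w := by
  unfold SameAbs at *
  simpa using h

lemma quincunxM_mulVec (ω : Fin 2 → ℝ) :
    (toReal quincunxM).transpose.mulVec ω = ![ω 0 + ω 1, ω 0 - ω 1] := by
  funext i
  fin_cases i <;> simp [Matrix.mulVec, dotProduct, toReal, quincunxM, sub_eq_add_neg]

lemma quincunxN_mulVec (ω : Fin 2 → ℝ) :
    (toReal quincunxN).transpose.mulVec ω = ![ω 0 + ω 1, -(ω 0 - ω 1)] := by
  funext i
  fin_cases i <;> simp [Matrix.mulVec, dotProduct, toReal, quincunxN]; ring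

lemma dil2_pow_mulVec (j : ℕ) (ω : Fin 1 → ℝ) :
    ((toReal dil2).transpose ^ j).mulVec ω = ![2 ^ j * ω 0] := by
  induction j with
  | zero => funext i; simp [Subsingleton.elim i 0]
  | succ j ih =>
    rw [pow_succ', ← Matrix.mulVec_mulVec, ih]
    funext i
    fin_cases i
    simp [Matrix.mulVec, dotProduct, toReal, dil2, pow_succ']; ring

lemma quincunxM_pow_even (i : ℕ) (ω : Fin 2 → ℝ) :
    ((toReal quincunxM).transpose ^ (2 * i)).mulVec ω = ![2 ^ i * ω 0, 2 ^ i * ω 1] := by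
  induction i with
  | zero => funext i; fin_cases i <;> simp
  | succ i ih =>
    rw [show 2 * (i + 1) = 2 * i + 1 + 1 by ring, pow_succ', pow_succ', ← Matrix.mulVec_mulVec,
      ← Matrix.mulVec_mulVec, ih, quincunxM_mulVec, quincunxM_mulVec]
    funext i
    fin_cases i <;> simp <;> ring

lemma quincunxM_pow_odd (i : ℕ) (ω : Fin 2 → ℝ) :
    ((toReal quincunxM).transpose ^ (2 * i + 1)).mulVec ω =
      ![2 ^ i * (ω 0 + ω 1), 2 ^ i * (ω 0 - ω 1)] := by
  rw [pow_succ, ← Matrix.mulVec_mulVec, quincunxM_mulVec, quincunxM_pow_even]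
  simp

lemma sameAbs_pow (j : ℕ) (ω : Fin 2 → ℝ) :
    SameAbs (((toReal quincunxN).transpose ^ j).mulVec ω)
      (((toReal quincunxM).transpose ^ j).mulVec ω) := by
  induction j with
  | zero => simpa using SameAbs.refl ω
  | succ j ih =>
    rw [pow_succ', pow_succ', ← Matrix.mulVec_mulVec, ← Matrix.mulVec_mulVec, quincunxN_mulVec,
      quincunxM_mulVec]
    exact ih.add_sub.neg_left

lemma quincunxM_det : |quincunxM.det| = 2 := by simp [quincunxM]
lemma quincunxN_det : |quincunxN.det| = 2 := by simp [quincunxN]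
lemma dil2_det : |dil2.det| = 2 := by simp [dil2]

/-- The two quincunx matrices give subdivision sequences with the same symbol moduli, hence the
same smoothness exponents. -/
lemma sm_quincunx_eq {a : Mask 1} (ha : IsRealMask a) (h0 : symbol a 0 = 1) :
    sm (tensor a a) quincunxM = sm (tensor a a) quincunxN := by
  have hr : ∀ m, rho (tensor a a) quincunxM m = rho (tensor a a) quincunxN m := by
    intro m
    have h : ∀ μ n, l2sq (nablaPowMask μ (cascadeMask (tensor a a) quincunxM n)) =
        l2sq (nablaPowMask μ (cascadeMask (tensor a a) quincunxN n)) := by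
      intro μ n
      apply l2sq_congr
      intro ω
      rw [symbol_nablaPowMask, symbol_nablaPowMask, symbol_cascadeMask, symbol_cascadeMask,
        quincunxM_det, quincunxN_det, norm_mul, norm_mul, norm_mul, norm_mul, norm_prod _ (fun j =>
          symbol (tensor a a) (((toReal quincunxM).transpose ^ j).mulVec ω)), norm_prod _ (fun j =>
          symbol (tensor a a) (((toReal quincunxN).transpose ^ j).mulVec ω))]
      congr 2
      exact Finset.prod_congr rfl fun j _ => (norm_symbol_tensor_sameAbs ha (sameAbs_pow j ω)).symm
    unfold rho
    refine iSup_congr fun μ => iSup_congr fun _ => ?_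
    simp only [l2norm_nablaPow_subdivision, h]
  unfold sm
  rw [hr, sr_tensor h0 (Or.inl rfl), sr_tensor h0 (Or.inr rfl), quincunxM_det, quincunxN_det]

/-! ### Growth rates -/

/-- A geometric bound `K r^N` bounds the growth rate by `r`, the constant being irrelevant. -/
lemma limsup_rpow_inv_le {y : ℕ → ℝ≥0∞} {K r : ℝ≥0∞} (hK : K ≠ ⊤)
    (h : ∀ᶠ N in atTop, y N ≤ K * r ^ N) :
    limsup (fun N : ℕ => y N ^ (1 / (N : ℝ))) atTop ≤ r := by
  have hK' : K ≤ ENNReal.ofReal (K.toReal + 1) := by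
    rw [← ENNReal.ofReal_toReal hK, ENNReal.toReal_ofReal ENNReal.toReal_nonneg]
    exact ENNReal.ofReal_le_ofReal (by linarith)
  have hpos : 0 < K.toReal + 1 := by have := ENNReal.toReal_nonneg (a := K); linarith
  have hb : ∀ᶠ N : ℕ in atTop, y N ^ (1 / (N : ℝ)) ≤
      ENNReal.ofReal ((K.toReal + 1) ^ (1 / (N : ℝ))) * r := by
    filter_upwards [h, eventually_gt_atTop 0] with N hN hN0
    have hN1 : (N : ℝ) ≠ 0 := by exact_mod_cast hN0.ne'
    have h0 : (0 : ℝ) ≤ 1 / (N : ℝ) := by positivity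
    calc y N ^ (1 / (N : ℝ)) ≤ (ENNReal.ofReal (K.toReal + 1) * r ^ N) ^ (1 / (N : ℝ)) :=
          ENNReal.rpow_le_rpow (hN.trans (by gcongr)) h0
      _ = _ := by
          rw [ENNReal.mul_rpow_of_nonneg _ _ h0, ENNReal.ofReal_rpow_of_pos hpos,
            ← ENNReal.rpow_natCast, ← ENNReal.rpow_mul, mul_one_div_cancel hN1, ENNReal.rpow_one]
  have ht : Tendsto (fun N : ℕ => (K.toReal + 1) ^ (1 / (N : ℝ))) atTop (𝓝 1) := by
    have h1 : Tendsto (fun N : ℕ => 1 / (N : ℝ)) atTop (𝓝 0) := tendsto_one_div_atTop_nhds_zero_nat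
    have h2 := (Real.continuous_const_rpow hpos.ne').tendsto 0
    rw [Real.rpow_zero] at h2
    exact h2.comp h1
  have ht2 : Tendsto (fun N : ℕ => ENNReal.ofReal ((K.toReal + 1) ^ (1 / (N : ℝ))) * r) atTop
      (𝓝 r) := by
    have h1 := ENNReal.tendsto_ofReal ht
    rw [ENNReal.ofReal_one] at h1
    have h2 := ENNReal.Tendsto.mul_const (b := r) h1 (Or.inl one_ne_zero)
    rwa [one_mul] at h2
  exact (limsup_le_limsup hb).trans ht2.limsup_eq.le

/-- The growth rate of a sequence dominated by `x_{⌊N/2⌋}²` is at most that of `x`. -/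
lemma limsup_rpow_inv_le_of_half {x y : ℕ → ℝ≥0∞} {K : ℝ≥0∞} (hK : K ≠ ⊤)
    (h : ∀ N, y N ≤ K * x (N / 2) ^ 2) :
    limsup (fun N : ℕ => y N ^ (1 / (N : ℝ))) atTop ≤
      limsup (fun N : ℕ => x N ^ (1 / (N : ℝ))) atTop := by
  refine le_of_forall_gt_imp_ge_of_dense fun r hr => ?_
  rcases eq_or_ne r ⊤ with rfl | hrt
  · exact le_top
  have hr0 : r ≠ 0 := (bot_lt_of_lt hr).ne'
  have h1 : ∀ᶠ n : ℕ in atTop, x n ≤ r ^ n := by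
    filter_upwards [eventually_lt_of_limsup_lt hr, eventually_gt_atTop 0] with n hn hn0
    have hn1 : (n : ℝ) ≠ 0 := by exact_mod_cast hn0.ne'
    have := ENNReal.rpow_le_rpow hn.le (Nat.cast_nonneg n : (0 : ℝ) ≤ n)
    rwa [← ENNReal.rpow_mul, one_div_mul_cancel hn1, ENNReal.rpow_one, ENNReal.rpow_natCast] at this
  have h2 : Tendsto (fun N : ℕ => N / 2) atTop atTop := Nat.tendsto_div_const_atTop (by norm_num)
  refine limsup_rpow_inv_le (K := K * (1 + r⁻¹)) (ENNReal.mul_ne_top hK (by simp [hr0])) ?_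
  filter_upwards [h2.eventually h1] with N hN
  calc y N ≤ K * x (N / 2) ^ 2 := h N
    _ ≤ K * (r ^ (N / 2)) ^ 2 := by gcongr
    _ ≤ K * (1 + r⁻¹) * r ^ N := by
        rw [mul_assoc, ← pow_mul]
        gcongr
        rcases Nat.even_or_odd' N with ⟨m, hm | hm⟩
        · rw [show N / 2 * 2 = N by omega, add_mul, one_mul]
          exact le_add_right le_rfl
        · rw [show N = N / 2 * 2 + 1 by omega, show (N / 2 * 2 + 1) / 2 * 2 = N / 2 * 2 by omega,
            add_mul, pow_succ' r, ← mul_assoc r⁻¹, ENNReal.inv_mul_cancel hr0 hrt, one_mul, one_mul]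
          exact le_add_left le_rfl

/-! ### The estimate of the two-dimensional differences -/

lemma l2sq_eq_sum_of_subset {d : ℕ} (u : Mask d) (s : Finset (Fin d → ℤ)) (h : u.support ⊆ s) :
    l2sq u = ∑ k ∈ s, ‖u k‖ ^ 2 := by
  unfold l2sq
  exact Finset.sum_subset h fun k _ hk => by simp [Finsupp.notMem_support_iff.1 hk]

lemma l2sq_tensor (u v : Mask 1) : l2sq (tensor u v) = l2sq u * l2sq v := by
  obtain ⟨e, he⟩ : ∃ e : (Fin 1 → ℤ) × (Fin 1 → ℤ) ↪ (Fin 2 → ℤ),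
      ∀ p, e p = ![p.1 0, p.2 0] := ⟨⟨fun p => ![p.1 0, p.2 0], by
    rintro ⟨p, q⟩ ⟨p', q'⟩ h
    have h0 := congrFun h 0
    have h1 := congrFun h 1
    simp at h0 h1
    ext i <;> rw [Subsingleton.elim i 0] <;> assumption⟩, fun _ => rfl⟩
  rw [l2sq_eq_sum_of_subset (tensor u v) ((u.support ×ˢ v.support).map e)]
  · rw [Finset.sum_map, Finset.sum_product]
    unfold l2sq
    rw [Finset.sum_mul_sum]
    refine Finset.sum_congr rfl fun j _ => Finset.sum_congr rfl fun k _ => ?_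
    have h1 : (fun _ => j 0 : Fin 1 → ℤ) = j := by funext i; rw [Subsingleton.elim i 0]
    have h2 : (fun _ => k 0 : Fin 1 → ℤ) = k := by funext i; rw [Subsingleton.elim i 0]
    rw [tensor_apply, norm_mul, mul_pow]
    simp [he, h1, h2]
  · intro n hn
    rw [Finsupp.mem_support_iff, tensor_apply] at hn
    refine Finset.mem_map.2 ⟨(fun _ => n 0, fun _ => n 1), ?_, ?_⟩
    · exact Finset.mem_product.2 ⟨Finsupp.mem_support_iff.2 (left_ne_zero_of_mul hn),
        Finsupp.mem_support_iff.2 (right_ne_zero_of_mul hn)⟩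
    · funext i
      fin_cases i <;> simp [he]

/-- The shear `(ω₁, ω₂) ↦ (ω₁, ω₁ + ω₂)`, transposed. -/
def shear : Matrix (Fin 2) (Fin 2) ℤ := !![1, 1; 0, 1]

/-- The shear `(ω₁, ω₂) ↦ (ω₂, ω₁ + ω₂)`, transposed. -/
def shearSwap : Matrix (Fin 2) (Fin 2) ℤ := !![0, 1; 1, 1]

lemma l2sq_mapDomain {d : ℕ} (u : Mask d) {g : (Fin d → ℤ) → (Fin d → ℤ)}
    (hg : Function.Injective g) : l2sq (u.mapDomain g) = l2sq u := by
  have h : ∀ v : Mask d, l2sq v = v.sum fun _ c => ‖c‖ ^ 2 := fun v => rfl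
  rw [h, h, Finsupp.sum_mapDomain_index_inj hg]

lemma shear_injective : Function.Injective shear.mulVec := by
  intro v w h
  have h0 := congrFun h 0
  have h1 := congrFun h 1
  simp [shear, Matrix.mulVec, dotProduct] at h0 h1
  funext i
  fin_cases i
  · change v 0 = w 0
    omega
  · exact h1

lemma shearSwap_injective : Function.Injective shearSwap.mulVec := by
  intro v w h
  have h0 := congrFun h 0
  have h1 := congrFun h 1
  simp [shearSwap, Matrix.mulVec, dotProduct] at h0 h1
  funext i
  fin_cases i
  · change v 0 = w 0
    omega
  · exact h0

lemma symbol_shear (u v : Mask 1) (ω : Fin 2 → ℝ) :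
    symbol ((tensor u v).mapDomain shear.mulVec) ω = symbol u ![ω 0] * symbol v ![ω 0 + ω 1] := by
  rw [symbol_dilate, symbol_tensor]
  congr 3 <;> simp [shear, Matrix.mulVec, dotProduct, toReal]

lemma symbol_shearSwap (u v : Mask 1) (ω : Fin 2 → ℝ) :
    symbol ((tensor u v).mapDomain shearSwap.mulVec) ω =
      symbol u ![ω 1] * symbol v ![ω 0 + ω 1] := by
  rw [symbol_dilate, symbol_tensor]
  congr 3 <;> simp [shearSwap, Matrix.mulVec, dotProduct, toReal]

/-- Distributing `2m` differences in the directions `e_1`, `e_2` onto two of the three directions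
`e_1`, `e_2`, `e_1 + e_2`, with `m` differences in each. -/
lemma pow_mul_pow_le {x y z : ℝ} (hx : 0 ≤ x) (hy : 0 ≤ y) (hz : 0 ≤ z) (h : x ≤ z + y) {m p q : ℕ}
    (hpq : p + q = 2 * m) (hm : m ≤ p) : x ^ p * y ^ q ≤ 2 ^ m * (x ^ m * y ^ m + x ^ m * z ^ m) := by
  obtain ⟨r, rfl⟩ := Nat.exists_eq_add_of_le hm
  have hq : r + q = m := by omega
  calc x ^ (m + r) * y ^ q = x ^ m * (x ^ r * y ^ q) := by rw [pow_add]; ring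
    _ ≤ x ^ m * ((z + y) ^ r * (z + y) ^ q) := by gcongr; linarith
    _ = x ^ m * (z + y) ^ m := by rw [← pow_add, hq]
    _ ≤ x ^ m * (2 ^ m * (z ^ m + y ^ m)) := by
        gcongr
        have h1 : z + y ≤ 2 * max z y := by
          rcases le_total z y with h | h <;> simp [h] <;> linarith
        calc (z + y) ^ m ≤ (2 * max z y) ^ m := by gcongr
          _ = 2 ^ m * (max z y) ^ m := mul_pow _ _ _
          _ ≤ 2 ^ m * (z ^ m + y ^ m) := by
              gcongr
              rcases le_total z y with h | h <;> simp [h] <;> positivity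
    _ = 2 ^ m * (x ^ m * y ^ m + x ^ m * z ^ m) := by ring

/-- The modulus of the symbol of the difference operator. -/
def diffAbs (t : ℝ) : ℝ := ‖1 - Complex.exp (-(Complex.I * (t : ℂ)))‖

lemma diffAbs_nonneg (t : ℝ) : 0 ≤ diffAbs t := norm_nonneg _

lemma diffAbs_le (s t : ℝ) : diffAbs s ≤ diffAbs (s + t) + diffAbs t := by
  unfold diffAbs
  have h : 1 - Complex.exp (-(Complex.I * (s : ℂ))) =
      (1 - Complex.exp (-(Complex.I * ((s + t : ℝ) : ℂ)))) -
        Complex.exp (-(Complex.I * (s : ℂ))) * (1 - Complex.exp (-(Complex.I * (t : ℂ)))) := by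
    have : Complex.exp (-(Complex.I * ((s + t : ℝ) : ℂ))) =
        Complex.exp (-(Complex.I * (s : ℂ))) * Complex.exp (-(Complex.I * (t : ℂ))) := by
      rw [← Complex.exp_add]; congr 1; push_cast; ring
    rw [this]; ring
  rw [h]
  refine (norm_sub_le _ _).trans_eq ?_
  rw [norm_mul, norm_exp_neg_I_mul, one_mul]

variable {a : Mask 1}

lemma IsSymLowPass.norm_symbol_le_one (ha : IsSymLowPass a) (ω : Fin 1 → ℝ) : ‖symbol a ω‖ ≤ 1 := by
  rw [← sq_le_one_iff₀ (norm_nonneg _)]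
  have := ha.sub ω
  nlinarith [sq_nonneg ‖symbol a (shiftPi ω)‖]

lemma IsSymLowPass.norm_symbol_tensor_le_one (ha : IsSymLowPass a) (ω : Fin 2 → ℝ) :
    ‖symbol (tensor a a) ω‖ ≤ 1 := by
  rw [symbol_tensor, norm_mul]
  exact mul_le_one₀ (ha.norm_symbol_le_one _) (norm_nonneg _) (ha.norm_symbol_le_one _)

/-- `∏_{i < n} |â(2^i t)|`. -/
def dyadicProd (a : Mask 1) (n : ℕ) (t : ℝ) : ℝ := ∏ i ∈ Finset.range n, ‖symbol a ![2 ^ i * t]‖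

lemma dyadicProd_nonneg (a : Mask 1) (n : ℕ) (t : ℝ) : 0 ≤ dyadicProd a n t :=
  Finset.prod_nonneg fun _ _ => norm_nonneg _

lemma IsSymLowPass.dyadicProd_le_one (ha : IsSymLowPass a) (n : ℕ) (t : ℝ) :
    dyadicProd a n t ≤ 1 :=
  Finset.prod_le_one (fun _ _ => norm_nonneg _) fun _ _ => ha.norm_symbol_le_one _

lemma norm_symbol_cascade_dil2 (a : Mask 1) (n m : ℕ) (t : ℝ) :
    ‖symbol (nablaPowMask (fun _ => m) (cascadeMask a dil2 n)) ![t]‖ =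
      diffAbs t ^ m * (2 ^ n * dyadicProd a n t) := by
  rw [symbol_nablaPowMask, symbol_cascadeMask, dil2_det, norm_mul, norm_mul, norm_prod, norm_prod]
  simp only [dil2_pow_mulVec]
  simp [dyadicProd, diffAbs]

/-- Two quincunx steps amount to one dyadic step in each of the directions `ω₁`, `ω₂`, `ω₁ ± ω₂`. -/
lemma prod_cascade_even (a : Mask 1) (n : ℕ) (ω : Fin 2 → ℝ) :
    ∏ j ∈ Finset.range (2 * n),
      ‖symbol (tensor a a) (((toReal quincunxM).transpose ^ j).mulVec ω)‖ =
    dyadicProd a n (ω 0) * dyadicProd a n (ω 1) *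
      (dyadicProd a n (ω 0 + ω 1) * dyadicProd a n (ω 0 - ω 1)) := by
  induction n with
  | zero => simp [dyadicProd]
  | succ n ih =>
    rw [show 2 * (n + 1) = 2 * n + 1 + 1 by ring, Finset.prod_range_succ, Finset.prod_range_succ,
      ih, quincunxM_pow_odd, quincunxM_pow_even, symbol_tensor, symbol_tensor]
    unfold dyadicProd
    simp only [Finset.prod_range_succ, norm_mul, Matrix.cons_val_zero, Matrix.cons_val_one]
    ring

/-- The factor of the direction `ω₁ - ω₂` is dropped: two of the three others suffice to dominate by
a tensor product, and the third is what makes the choice of the two free. -/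
lemma IsSymLowPass.prod_cascade_le (ha : IsSymLowPass a) (N : ℕ) (ω : Fin 2 → ℝ) :
    ‖symbol (cascadeMask (tensor a a) quincunxM N) ω‖ ≤
      2 * ((2 ^ (N / 2)) * (2 ^ (N / 2))) * (dyadicProd a (N / 2) (ω 0) * dyadicProd a (N / 2) (ω 1) *
        dyadicProd a (N / 2) (ω 0 + ω 1)) := by
  rw [symbol_cascadeMask, quincunxM_det, norm_mul, norm_prod]
  have h2 : ‖(((2 : ℤ) : ℂ)) ^ N‖ = 2 ^ N := by simp
  rw [h2]
  have hP : ∏ j ∈ Finset.range N,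
      ‖symbol (tensor a a) (((toReal quincunxM).transpose ^ j).mulVec ω)‖ ≤
      dyadicProd a (N / 2) (ω 0) * dyadicProd a (N / 2) (ω 1) *
        dyadicProd a (N / 2) (ω 0 + ω 1) := by
    have h1 : ∏ j ∈ Finset.range N,
        ‖symbol (tensor a a) (((toReal quincunxM).transpose ^ j).mulVec ω)‖ ≤
        ∏ j ∈ Finset.range (2 * (N / 2)),
        ‖symbol (tensor a a) (((toReal quincunxM).transpose ^ j).mulVec ω)‖ := by
      refine Finset.prod_le_prod_of_subset_of_le_one (Finset.range_mono (by omega))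
        (fun _ _ => norm_nonneg _) fun _ _ _ => ha.norm_symbol_tensor_le_one _
    refine h1.trans ?_
    rw [prod_cascade_even, ← mul_assoc]
    exact mul_le_of_le_one_right (mul_nonneg (mul_nonneg (dyadicProd_nonneg _ _ _)
      (dyadicProd_nonneg _ _ _)) (dyadicProd_nonneg _ _ _)) (ha.dyadicProd_le_one _ _)
  have h3 : (2 : ℝ) ^ N ≤ 2 * (2 ^ (N / 2) * 2 ^ (N / 2)) := by
    rw [← pow_add, ← pow_succ']
    exact pow_le_pow_right₀ (by norm_num) (by omega)
  exact mul_le_mul h3 hP (Finset.prod_nonneg fun _ _ => norm_nonneg _) (by positivity)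

/-- The differences of order `2m` of the two-dimensional subdivision sequence after `N` steps are
bounded by the square of the differences of order `m` of the one-dimensional one after `N / 2` steps. -/
lemma IsSymLowPass.l2sq_nabla_tensor_le (ha : IsSymLowPass a) {μ : Fin 2 → ℕ} {m : ℕ}
    (hμ : ∑ i, μ i = 2 * m) (N : ℕ) :
    l2sq (nablaPowMask μ (cascadeMask (tensor a a) quincunxM N)) ≤
      (2 * (2 * 2 ^ m) ^ 2) * (2 *
        l2sq (nablaPowMask (fun _ => m) (cascadeMask a dil2 (N / 2))) ^ 2) := by
  set n := N / 2 with hn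
  set v := nablaPowMask (fun _ => m) (cascadeMask a dil2 n) with hv
  have hvn := norm_symbol_cascade_dil2 a n m
  rw [← hv] at hvn
  rw [Fin.sum_univ_two] at hμ
  have hP := fun t => dyadicProd_nonneg a n t
  have hP1 := fun t => ha.dyadicProd_le_one n t
  have hD := diffAbs_nonneg
  have hnorm : ∀ ω : Fin 2 → ℝ,
      ‖symbol (nablaPowMask μ (cascadeMask (tensor a a) quincunxM N)) ω‖ ≤
      (diffAbs (ω 0) ^ μ 0 * diffAbs (ω 1) ^ μ 1) * (2 * (2 ^ n * 2 ^ n) *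
        (dyadicProd a n (ω 0) * dyadicProd a n (ω 1) * dyadicProd a n (ω 0 + ω 1))) := by
    intro ω
    rw [symbol_nablaPowMask, norm_mul, norm_prod, Fin.prod_univ_two, norm_pow, norm_pow]
    exact mul_le_mul_of_nonneg_left (ha.prod_cascade_le N ω) (by positivity)
  have hsq : ∀ s p q : ℝ, 0 ≤ s → s ≤ 2 * 2 ^ m * (p + q) →
      s ^ 2 ≤ 2 * (2 * 2 ^ m) ^ 2 * (p ^ 2 + q ^ 2) := by
    intro s p q hs h
    calc s ^ 2 ≤ (2 * 2 ^ m * (p + q)) ^ 2 := by gcongr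
      _ = (2 * 2 ^ m) ^ 2 * (p + q) ^ 2 := by ring
      _ ≤ (2 * 2 ^ m) ^ 2 * (2 * (p ^ 2 + q ^ 2)) := by gcongr; exact add_sq_le
      _ = _ := by ring
  -- the direction with at least `m` differences keeps `m` of them; the others are distributed
  rcases le_total m (μ 0) with hm | hm
  · have h := l2sq_le_of_norm_le (nablaPowMask μ (cascadeMask (tensor a a) quincunxM N))
      (tensor v v) ((tensor v v).mapDomain shear.mulVec) (2 * (2 * 2 ^ m) ^ 2) (fun ω => by
        rw [symbol_tensor, symbol_shear, norm_mul, norm_mul, hvn, hvn, hvn]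
        refine hsq _ _ _ (norm_nonneg _) ((hnorm ω).trans ?_)
        have h1 := pow_mul_pow_le (hD (ω 0)) (hD (ω 1)) (hD (ω 0 + ω 1)) (diffAbs_le _ _) hμ hm
        set x := diffAbs (ω 0) ^ m
        set y := diffAbs (ω 1) ^ m
        set z := diffAbs (ω 0 + ω 1) ^ m
        set c : ℝ := 2 ^ n
        set p := dyadicProd a n (ω 0)
        set q := dyadicProd a n (ω 1)
        set r := dyadicProd a n (ω 0 + ω 1)
        have hx : 0 ≤ x := pow_nonneg (hD _) _
        have hy : 0 ≤ y := pow_nonneg (hD _) _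
        have hz : 0 ≤ z := pow_nonneg (hD _) _
        have hp : 0 ≤ p := hP _
        have hq : 0 ≤ q := hP _
        have hr : 0 ≤ r := hP _
        calc _ ≤ (2 ^ m * (x * y + x * z)) * (2 * (c * c) * (p * q * r)) := by gcongr
          _ = 2 * 2 ^ m * (x * (c * p) * (y * (c * q)) * r + x * (c * p) * (z * (c * r)) * q) := by
              ring
          _ ≤ 2 * 2 ^ m * (x * (c * p) * (y * (c * q)) * 1 + x * (c * p) * (z * (c * r)) * 1) := by
              gcongr
              · exact hP1 _
              · exact hP1 _
          _ = _ := by ring)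
    rwa [l2sq_mapDomain _ shear_injective, l2sq_tensor, ← sq, ← two_mul] at h
  · have hm' : m ≤ μ 1 := by omega
    have h := l2sq_le_of_norm_le (nablaPowMask μ (cascadeMask (tensor a a) quincunxM N))
      (tensor v v) ((tensor v v).mapDomain shearSwap.mulVec) (2 * (2 * 2 ^ m) ^ 2) (fun ω => by
        rw [symbol_tensor, symbol_shearSwap, norm_mul, norm_mul, hvn, hvn, hvn]
        refine hsq _ _ _ (norm_nonneg _) ((hnorm ω).trans ?_)
        have h1 := pow_mul_pow_le (hD (ω 1)) (hD (ω 0)) (hD (ω 1 + ω 0)) (diffAbs_le _ _)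
          (by omega : μ 1 + μ 0 = 2 * m) hm'
        rw [add_comm (ω 1)] at h1
        set x := diffAbs (ω 0) ^ m
        set y := diffAbs (ω 1) ^ m
        set z := diffAbs (ω 0 + ω 1) ^ m
        set c : ℝ := 2 ^ n
        set p := dyadicProd a n (ω 0)
        set q := dyadicProd a n (ω 1)
        set r := dyadicProd a n (ω 0 + ω 1)
        have hx : 0 ≤ x := pow_nonneg (hD _) _
        have hy : 0 ≤ y := pow_nonneg (hD _) _
        have hz : 0 ≤ z := pow_nonneg (hD _) _
        have hp : 0 ≤ p := hP _
        have hq : 0 ≤ q := hP _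
        have hr : 0 ≤ r := hP _
        rw [mul_comm (diffAbs (ω 0) ^ μ 0)]
        calc _ ≤ (2 ^ m * (y * x + y * z)) * (2 * (c * c) * (p * q * r)) := by gcongr
          _ = 2 * 2 ^ m * (x * (c * p) * (y * (c * q)) * r + y * (c * q) * (z * (c * r)) * p) := by
              ring
          _ ≤ 2 * 2 ^ m * (x * (c * p) * (y * (c * q)) * 1 + y * (c * q) * (z * (c * r)) * 1) := by
              gcongr
              · exact hP1 _
              · exact hP1 _
          _ = _ := by ring)
    rwa [l2sq_mapDomain _ shearSwap_injective, l2sq_tensor, ← sq, ← two_mul] at h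

/-- Two quincunx steps and two factors compensate each other, so the growth rate of `a ⊗ a` is at most
that of `a`. -/
lemma IsSymLowPass.rho_tensor_le (ha : IsSymLowPass a) (m : ℕ) :
    rho (tensor a a) quincunxM (2 * m) ≤ rho a dil2 m := by
  refine iSup₂_le fun μ hμ => ?_
  refine le_trans ?_ (le_iSup₂_of_le (fun _ => m) (by simp) le_rfl)
  simp only [l2norm_nablaPow_subdivision]
  refine limsup_rpow_inv_le_of_half (K := ENNReal.ofReal √(2 * (2 * 2 ^ m) ^ 2 * 2))
    ENNReal.ofReal_ne_top fun N => ?_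
  rw [← ENNReal.ofReal_pow (Real.sqrt_nonneg _), ← ENNReal.ofReal_mul (Real.sqrt_nonneg _),
    Real.sq_sqrt (l2sq_nonneg _)]
  apply ENNReal.ofReal_le_ofReal
  rw [Real.sqrt_le_left (mul_nonneg (Real.sqrt_nonneg _) (l2sq_nonneg _)), mul_pow,
    Real.sq_sqrt (by positivity), mul_assoc]
  exact ha.l2sq_nabla_tensor_le hμ N

lemma two_mul_ereal_sub_le {c : ℝ} (hc : 0 < c) {x y : EReal} (h : x ≤ y) :
    2 * (((1 / 2 : ℝ) : EReal) - ((c : ℝ) : EReal) * y) ≤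
      ((1 : ℝ) : EReal) - ((2 * c : ℝ) : EReal) * x := by
  induction y with
  | top =>
    rw [EReal.coe_mul_top_of_pos hc, EReal.sub_top, show (2 : EReal) = ((2 : ℝ) : EReal) from rfl,
      EReal.coe_mul_bot_of_pos (by norm_num)]
    exact bot_le
  | bot =>
    rw [le_bot_iff] at h
    subst h
    rw [EReal.coe_mul_bot_of_pos (by positivity), EReal.coe_sub_bot,
      EReal.coe_mul_bot_of_pos (by positivity), EReal.coe_sub_bot]
    exact le_top
  | coe y =>
    induction x with
    | top => simp at h
    | bot => rw [EReal.coe_mul_bot_of_pos (by positivity), EReal.coe_sub_bot]; exact OrderTop.le_top _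
    | coe x =>
      have h' : x ≤ y := by exact_mod_cast h
      rw [show (2 : EReal) = ((2 : ℝ) : EReal) from rfl, ← EReal.coe_mul, ← EReal.coe_mul,
        ← EReal.coe_sub, ← EReal.coe_sub, ← EReal.coe_mul, EReal.coe_le_coe_iff]
      nlinarith

lemma IsSymLowPass.two_mul_sm_le (ha : IsSymLowPass a) :
    2 * sm a dil2 ≤ sm (tensor a a) quincunxM := by
  unfold sm
  rw [sr_tensor ha.low (Or.inl rfl), quincunxM_det, dil2_det]
  obtain ⟨s, hs⟩ := ENat.ne_top_iff_exists.1 (sr_dil2_ne_top ha.low)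
  rw [← hs]
  -- the sum rule order is finite, so `toNat` loses nothing
  have e : (2 * (s : ℕ∞)).toNat = 2 * s := by
    rw [show (2 * (s : ℕ∞)) = ((2 * s : ℕ) : ℕ∞) by push_cast; rfl]; exact ENat.toNat_natCast _
  rw [e, ENat.toNat_natCast]
  have h := two_mul_ereal_sub_le (c := 1 / Real.log 2) (by positivity)
    (ENNReal.log_monotone (ha.rho_tensor_le s))
  have e2 : (2 * (1 / Real.log 2)) = ((2 : ℕ) : ℝ) / Real.log 2 := by push_cast; ring
  have e3 : (1 : ℝ) = ((2 : ℕ) : ℝ) / 2 := by norm_num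
  have e4 : (1 : ℝ) / 2 = ((1 : ℕ) : ℝ) / 2 := by norm_num
  have e5 : (1 : ℝ) / Real.log 2 = ((1 : ℕ) : ℝ) / Real.log ((2 : ℤ) : ℝ) := by norm_num
  have e6 : Real.log ((2 : ℤ) : ℝ) = Real.log 2 := by norm_num
  rw [e2, e4, e5, e6] at h
  rw [e6]
  refine h.trans_eq ?_
  norm_num

end Smoothness

/-! ### The interpolatory filters -/

section Interpolatory

/-- The polynomial `∑_{j < n} C(n-1+j, j) y^j`. -/
def interpPoly (n : ℕ) (y : ℝ) : ℝ := ∑ j ∈ Finset.range n, ((n - 1 + j).choose j : ℝ) * y ^ j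

/-- The symbol of `a^I_{2n}` as a real function. -/
def interpSymbol (n : ℕ) (x : ℝ) : ℝ :=
  Real.cos (x / 2) ^ (2 * n) * interpPoly n (Real.sin (x / 2) ^ 2)

lemma symbol_interpMask_eq (n : ℕ) (ω : Fin 1 → ℝ) :
    symbol (interpMask n) ω = (interpSymbol n (ω 0) : ℂ) := by
  rw [symbol_interpMask]
  simp only [interpSymbol, interpPoly, pow_mul]

lemma one_sub_mul_sum_choose (N m : ℕ) (x : ℝ) :
    (1 - x) * ∑ j ∈ Finset.range (m + 1), ((N + 1 + j).choose j : ℝ) * x ^ j =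
      ∑ j ∈ Finset.range (m + 1), ((N + j).choose j : ℝ) * x ^ j -
        ((N + 1 + m).choose m : ℝ) * x ^ (m + 1) := by
  induction m with
  | zero => simp
  | succ m ih =>
    rw [Finset.sum_range_succ, mul_add, ih, Finset.sum_range_succ _ (m + 1)]
    have h : ((N + 1 + (m + 1)).choose (m + 1) : ℝ) =
        (N + 1 + m).choose m + (N + (m + 1)).choose (m + 1) := by
      have e1 : N + 1 + (m + 1) = (N + 1 + m) + 1 := by ring
      have e2 : N + (m + 1) = N + 1 + m := by ring
      rw [e1, e2, Nat.choose_succ_succ]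
      push_cast
      ring
    rw [h]
    ring

lemma one_sub_mul_interpPoly (n : ℕ) (x : ℝ) :
    (1 - x) * interpPoly (n + 2) x = interpPoly (n + 1) x +
      ((2 * n + 1).choose (n + 1) : ℝ) * x ^ (n + 1) * (1 - 2 * x) := by
  unfold interpPoly
  have h := one_sub_mul_sum_choose n (n + 1) x
  rw [Finset.sum_range_succ (fun j => ((n + j).choose j : ℝ) * x ^ j)] at h
  have e : ((n + 1 + (n + 1)).choose (n + 1) : ℝ) = 2 * ((2 * n + 1).choose (n + 1) : ℝ) := by
    have h2 : (2 * n + 1).choose n = (2 * n + 1).choose (n + 1) :=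
      Nat.choose_symm_of_eq_add (by ring)
    rw [show n + 1 + (n + 1) = (2 * n + 1) + 1 by ring, Nat.choose_succ_succ, h2]
    push_cast
    ring
  rw [e, show n + (n + 1) = 2 * n + 1 by ring] at h
  simp only [show n + 2 - 1 = n + 1 from rfl, show n + 1 - 1 = n from rfl]
  rw [show n + 2 = n + 1 + 1 from rfl, h]
  ring

/-- The Bezout identity behind the interpolation property. -/
lemma interpPoly_bezout (n : ℕ) (hn : 1 ≤ n) (x : ℝ) :
    (1 - x) ^ n * interpPoly n x + x ^ n * interpPoly n (1 - x) = 1 := by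
  induction n, hn using Nat.le_induction with
  | base => simp [interpPoly]
  | succ n hn ih =>
    obtain ⟨k, rfl⟩ := Nat.exists_eq_add_of_le' hn
    have h1 := one_sub_mul_interpPoly k x
    have h2 := one_sub_mul_interpPoly k (1 - x)
    rw [sub_sub_cancel] at h2
    rw [show k + 1 + 1 = k + 2 from rfl]
    calc (1 - x) ^ (k + 2) * interpPoly (k + 2) x + x ^ (k + 2) * interpPoly (k + 2) (1 - x)
        = (1 - x) ^ (k + 1) * ((1 - x) * interpPoly (k + 2) x) +
          x ^ (k + 1) * (x * interpPoly (k + 2) (1 - x)) := by ring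
      _ = (1 - x) ^ (k + 1) * interpPoly (k + 1) x + x ^ (k + 1) * interpPoly (k + 1) (1 - x) := by
          rw [h1, h2]; ring
      _ = 1 := ih

lemma interpPoly_nonneg (n : ℕ) {y : ℝ} (hy : 0 ≤ y) : 0 ≤ interpPoly n y :=
  Finset.sum_nonneg fun _ _ => by positivity

lemma interpPoly_mono (n : ℕ) {x y : ℝ} (hx : 0 ≤ x) (hxy : x ≤ y) :
    interpPoly n x ≤ interpPoly n y :=
  Finset.sum_le_sum fun _ _ => by gcongr

/-- At `1/2` the two terms of the Bezout identity coincide. -/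
lemma interpPoly_half (n : ℕ) : interpPoly (n + 1) (1 / 2) = 2 ^ n := by
  have h := interpPoly_bezout (n + 1) (by omega) (1 / 2)
  norm_num at h
  have h2 : (1 / 2 : ℝ) ^ n * interpPoly (n + 1) (1 / 2) = 1 := by
    rw [pow_succ] at h; linarith
  have h3 : (2 : ℝ) ^ n * (1 / 2) ^ n = 1 := by rw [← mul_pow]; norm_num
  calc interpPoly (n + 1) (1 / 2) = (2 ^ n * (1 / 2) ^ n) * interpPoly (n + 1) (1 / 2) := by
        rw [h3, one_mul]
    _ = 2 ^ n * ((1 / 2) ^ n * interpPoly (n + 1) (1 / 2)) := by ring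
    _ = 2 ^ n := by rw [h2, mul_one]

/-- On `[0, 1/2]` compare with the value at `1/2`; beyond `1/2` all powers are dominated by the
highest one. -/
lemma interpPoly_le (n : ℕ) {y : ℝ} (hy : 0 ≤ y) : interpPoly (n + 1) y ≤ max 2 (4 * y) ^ n := by
  rcases le_total y (1 / 2) with h | h
  · calc interpPoly (n + 1) y ≤ interpPoly (n + 1) (1 / 2) := interpPoly_mono _ hy h
      _ = 2 ^ n := interpPoly_half n
      _ ≤ _ := by gcongr; exact le_max_left _ _
  · have h1 : interpPoly (n + 1) y ≤ (2 * y) ^ n * interpPoly (n + 1) (1 / 2) := by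
      unfold interpPoly
      rw [Finset.mul_sum]
      refine Finset.sum_le_sum fun j hj => ?_
      have hjn : j ≤ n := by have := Finset.mem_range.1 hj; omega
      obtain ⟨i, rfl⟩ := Nat.exists_eq_add_of_le hjn
      rw [mul_left_comm]
      gcongr
      calc y ^ j = (2 * y * (1 / 2)) ^ j := by ring
        _ = (2 * y) ^ j * 1 * (1 / 2) ^ j := by rw [mul_pow, mul_one]
        _ ≤ (2 * y) ^ j * (2 * y) ^ i * (1 / 2) ^ j := by
            gcongr; exact one_le_pow₀ (by linarith)
        _ = _ := by rw [pow_add]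
    calc interpPoly (n + 1) y ≤ (2 * y) ^ n * 2 ^ n := by rw [← interpPoly_half]; exact h1
      _ = (4 * y) ^ n := by rw [← mul_pow]; ring
      _ ≤ _ := by gcongr; exact le_max_right _ _

lemma sin_sq_two_mul (t : ℝ) :
    Real.sin (2 * t) ^ 2 = 4 * Real.sin t ^ 2 * (1 - Real.sin t ^ 2) := by
  rw [Real.sin_two_mul, mul_pow, mul_pow, Real.cos_sq']; ring

/-- Along a doubling orbit the factors `max 2 (4 sin²)` have geometric mean at most `3`: a factor
above `3` is followed by one which brings the product of the two below `9`. -/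
lemma prod_max_le (k : ℕ) (t : ℝ) :
    ∏ i ∈ Finset.range k, max 2 (4 * Real.sin (2 ^ i * t) ^ 2) ≤ 2 * 3 ^ k := by
  induction k using Nat.strong_induction_on generalizing t with
  | _ k ih =>
  have hs : ∀ (m : ℕ) (s : ℝ), 0 ≤ ∏ i ∈ Finset.range m, max 2 (4 * Real.sin (2 ^ i * s) ^ 2) :=
    fun m s => Finset.prod_nonneg fun _ _ => le_trans zero_le_two (le_max_left _ _)
  have hstep : ∀ (m : ℕ) (s : ℝ), ∏ i ∈ Finset.range (m + 1), max 2 (4 * Real.sin (2 ^ i * s) ^ 2) =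
      max 2 (4 * Real.sin s ^ 2) * ∏ i ∈ Finset.range m, max 2 (4 * Real.sin (2 ^ i * (2 * s)) ^ 2) := by
    intro m s
    rw [Finset.prod_range_succ', mul_comm]
    simp only [pow_zero, one_mul, pow_succ, mul_assoc]
  have hy1 := Real.sin_sq_le_one t
  have hy0 := sq_nonneg (Real.sin t)
  rcases k with _ | _ | k
  · simp
  · simp only [zero_add, Finset.prod_range_one, pow_zero, one_mul, pow_one]
    refine max_le (by norm_num) (by linarith)
  · rw [hstep]
    rcases le_total (Real.sin t ^ 2) (3 / 4) with h | h
    · have h3 : max 2 (4 * Real.sin t ^ 2) ≤ 3 := max_le (by norm_num) (by linarith)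
      refine (mul_le_mul h3 (ih (k + 1) (by omega) _) (hs _ _) (by norm_num)).trans_eq (by ring)
    · rw [hstep, ← mul_assoc]
      have h9 : max 2 (4 * Real.sin t ^ 2) * max 2 (4 * Real.sin (2 * t) ^ 2) ≤ 9 := by
        rw [sin_sq_two_mul, max_eq_right (by linarith : (2 : ℝ) ≤ 4 * Real.sin t ^ 2),
          mul_max_of_nonneg _ _ (by linarith)]
        set y := Real.sin t ^ 2
        refine max_le (by linarith) ?_
        nlinarith [mul_nonneg (sub_nonneg.2 h) (sub_nonneg.2 hy1),
          mul_nonneg (mul_nonneg (sub_nonneg.2 h) (sub_nonneg.2 hy1)) hy0]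
      refine (mul_le_mul h9 (ih k (by omega) _) (hs _ _) (by norm_num)).trans_eq (by ring)

/-- Viète's product formula. -/
lemma sin_mul_prod_cos (k : ℕ) (t : ℝ) :
    2 ^ k * (Real.sin t * ∏ i ∈ Finset.range k, Real.cos (2 ^ i * t)) = Real.sin (2 ^ k * t) := by
  induction k with
  | zero => simp
  | succ k ih =>
    rw [Finset.prod_range_succ, pow_succ', mul_assoc 2 (2 ^ k) t, Real.sin_two_mul, ← ih]
    ring

lemma interpSymbol_nonneg (n : ℕ) (x : ℝ) : 0 ≤ interpSymbol n x :=
  mul_nonneg (by rw [pow_mul]; positivity) (interpPoly_nonneg n (sq_nonneg _))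

/-- The basic decay estimate for the products of dilates of the symbol of `a^I_{2(n+1)}`. -/
lemma sin_pow_mul_prod_interpSymbol_le (n k : ℕ) (x : ℝ) :
    Real.sin (x / 2) ^ (2 * (n + 1)) * ∏ i ∈ Finset.range k, interpSymbol (n + 1) (2 ^ i * x) ≤
      (2 * 3 ^ k) ^ n / 4 ^ (k * (n + 1)) := by
  have h1 : ∀ i : ℕ, 2 ^ i * x / 2 = 2 ^ i * (x / 2) := fun i => by ring
  simp only [interpSymbol, h1]
  set t := x / 2
  rw [Finset.prod_mul_distrib, ← mul_assoc]
  have h2 : Real.sin t ^ (2 * (n + 1)) *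
      ∏ i ∈ Finset.range k, Real.cos (2 ^ i * t) ^ (2 * (n + 1)) ≤ 1 / 4 ^ (k * (n + 1)) := by
    rw [Finset.prod_pow, ← mul_pow, le_div_iff₀ (by positivity)]
    have : (4 : ℝ) ^ (k * (n + 1)) = (2 ^ k) ^ (2 * (n + 1)) := by
      rw [← pow_mul, show (4 : ℝ) = 2 ^ 2 by norm_num, ← pow_mul]; congr 1; ring
    rw [this, ← mul_pow, mul_comm _ ((2 : ℝ) ^ k), sin_mul_prod_cos, pow_mul]
    exact pow_le_one₀ (sq_nonneg _) (Real.sin_sq_le_one _)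
  have h3 : ∏ i ∈ Finset.range k, interpPoly (n + 1) (Real.sin (2 ^ i * t) ^ 2) ≤ (2 * 3 ^ k) ^ n := by
    calc _ ≤ ∏ i ∈ Finset.range k, max 2 (4 * Real.sin (2 ^ i * t) ^ 2) ^ n :=
          Finset.prod_le_prod (fun _ _ => interpPoly_nonneg _ (sq_nonneg _))
            fun _ _ => interpPoly_le _ (sq_nonneg _)
      _ = (∏ i ∈ Finset.range k, max 2 (4 * Real.sin (2 ^ i * t) ^ 2)) ^ n := Finset.prod_pow _ _ _
      _ ≤ _ := pow_le_pow_left₀ (Finset.prod_nonneg fun _ _ =>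
          le_trans zero_le_two (le_max_left _ _)) (prod_max_le _ _) _
  calc _ ≤ 1 / 4 ^ (k * (n + 1)) * (2 * 3 ^ k) ^ n :=
        mul_le_mul h2 h3 (Finset.prod_nonneg fun _ _ => interpPoly_nonneg _ (sq_nonneg _))
          (by positivity)
    _ = _ := by ring

lemma interpSymbol_add_pi (n : ℕ) (x : ℝ) : interpSymbol n (x + Real.pi) =
    Real.sin (x / 2) ^ (2 * n) * interpPoly n (Real.cos (x / 2) ^ 2) := by
  unfold interpSymbol
  have h : (x + Real.pi) / 2 = x / 2 + Real.pi / 2 := by ring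
  rw [h, Real.cos_add_pi_div_two, Real.sin_add_pi_div_two, pow_mul, neg_sq, ← pow_mul]

lemma interpSymbol_add (n : ℕ) (hn : 1 ≤ n) (x : ℝ) :
    interpSymbol n x + interpSymbol n (x + Real.pi) = 1 := by
  rw [interpSymbol_add_pi]
  unfold interpSymbol
  have h := interpPoly_bezout n hn (Real.sin (x / 2) ^ 2)
  rw [← Real.cos_sq', ← pow_mul, ← pow_mul] at h
  exact h

lemma interpSymbol_le_one {n : ℕ} (hn : 1 ≤ n) (x : ℝ) : interpSymbol n x ≤ 1 := by
  have := interpSymbol_add n hn x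
  have := interpSymbol_nonneg n (x + Real.pi)
  linarith

lemma interpSymbol_neg (n : ℕ) (x : ℝ) : interpSymbol n (-x) = interpSymbol n x := by
  simp [interpSymbol, neg_div]

lemma isSymLowPass_interpMask {n : ℕ} (hn : 1 ≤ n) : IsSymLowPass (interpMask n) where
  real := by
    apply isRealMask_of_symbol
    intro ω
    rw [symbol_interpMask_eq, symbol_interpMask_eq, Complex.conj_ofReal, Pi.neg_apply,
      interpSymbol_neg]
  symm := by
    apply hasSymmetry_of_symbol 0 1
    intro ω
    rw [symbol_interpMask_eq, symbol_interpMask_eq, Pi.neg_apply, interpSymbol_neg]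
    simp
  low := by
    have h := interpSymbol_add n hn 0
    rw [interpSymbol_add_pi] at h
    rw [symbol_interpMask_eq]
    have : interpSymbol n 0 = 1 := by
      simpa [show 2 * n ≠ 0 by omega] using h
    simp [this]
  sub := by
    intro ω
    rw [symbol_interpMask_eq, symbol_interpMask_eq, Complex.norm_real, Complex.norm_real,
      Real.norm_of_nonneg (interpSymbol_nonneg _ _), Real.norm_of_nonneg (interpSymbol_nonneg _ _)]
    have h1 := interpSymbol_add n hn (ω 0)
    have h2 := interpSymbol_nonneg n (ω 0)
    have h3 := interpSymbol_nonneg n (ω 0 + Real.pi)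
    have : shiftPi ω 0 = ω 0 + Real.pi := rfl
    rw [this]
    nlinarith [mul_nonneg h2 h3]

lemma interpSymbol_add_pi_isBigO (n : ℕ) :
    (fun t : ℝ => interpSymbol n (t + Real.pi)) =O[𝓝 0] fun t => t ^ (2 * n) := by
  refine IsBigO.of_bound (interpPoly n 1) ?_
  filter_upwards with t
  have h1 := Real.abs_sin_le_abs (x := t / 2)
  rw [abs_div, abs_two] at h1
  rw [interpSymbol_add_pi, norm_mul, norm_pow, norm_pow, Real.norm_eq_abs, Real.norm_eq_abs,
    Real.norm_eq_abs, abs_of_nonneg (interpPoly_nonneg n (sq_nonneg _)), mul_comm]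
  refine mul_le_mul (interpPoly_mono n (sq_nonneg _) (Real.cos_sq_le_one _))
    (pow_le_pow_left₀ (abs_nonneg _) ?_ _) (by positivity) (interpPoly_nonneg n zero_le_one)
  linarith [abs_nonneg t]

lemma two_mul_le_sr_interpMask {n : ℕ} (hn : 1 ≤ n) :
    ((2 * n : ℕ) : ℕ∞) ≤ sr (interpMask n) dil2 := by
  rw [sr_dil2 (isSymLowPass_interpMask hn).low, ← isBigO_line_iff]
  simp only [symbol_interpMask_eq]
  refine IsBigO.congr_left (f₁ := fun t : ℝ => interpSymbol n (t + Real.pi))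
    (IsBigO.of_norm_left ?_) (fun _ => rfl) |> fun h => IsBigO.of_norm_left (h.norm_left.congr_left
      fun t => by simp)
  exact (interpSymbol_add_pi_isBigO n).norm_left

lemma two_mul_le_lpm_interpMask {n : ℕ} (hn : 1 ≤ n) :
    ((2 * n : ℕ) : ℕ∞) ≤ lpm (interpMask n) := by
  refine le_iSup₂_of_le (2 * n) ⟨0, ?_⟩ le_rfl
  unfold HasLinearPhaseMoments
  have h : (fun t : ℝ => ((interpSymbol n t : ℝ) : ℂ) - 1) =O[𝓝 0] fun t => t ^ (2 * n) := by
    refine IsBigO.of_norm_left ((interpSymbol_add_pi_isBigO n).norm_left.congr_left fun t => ?_)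
    have := interpSymbol_add n hn t
    rw [← Complex.ofReal_one, ← Complex.ofReal_sub, Complex.norm_real, ← norm_neg]
    congr 1
    linarith
  refine (isBigO_vec_one_iff.2 h).congr_left fun ω => ?_
  rw [symbol_interpMask_eq]
  simp

lemma le_sr_tensor_interpMask {n : ℕ} (hn : 1 ≤ n) :
    ((4 * n : ℕ) : ℕ∞) ≤ sr (tensor (interpMask n) (interpMask n)) quincunxM := by
  rw [sr_tensor (isSymLowPass_interpMask hn).low (Or.inl rfl)]
  calc ((4 * n : ℕ) : ℕ∞) = 2 * ((2 * n : ℕ) : ℕ∞) := by push_cast; ring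
    _ ≤ _ := by gcongr; exact two_mul_le_sr_interpMask hn

lemma le_vm_bank2D_interpMask {n : ℕ} (hn : 1 ≤ n) {b : Fin 4 → Mask 1} {u : Fin 3 → Mask 1}
    (h : IsIngredients (interpMask n) b u) {p : Fin (2 * 6)} (hp : p ≠ 0) :
    (n : ℕ∞) ≤ vm (bank2D b u p) := by
  have h1 := h.min_le_two_vm hp
  have h2 : ((2 * n : ℕ) : ℕ∞) ≤ 2 * vm (bank2D b u p) := by
    refine le_trans (le_min ?_ (two_mul_le_lpm_interpMask hn)) h1
    calc ((2 * n : ℕ) : ℕ∞) ≤ ((4 * (2 * n) : ℕ) : ℕ∞) := by exact_mod_cast (by omega)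
      _ = 4 * ((2 * n : ℕ) : ℕ∞) := by push_cast; rfl
      _ ≤ _ := by gcongr; exact two_mul_le_sr_interpMask hn
  generalize vm (bank2D b u p) = v at h2
  induction v with
  | top => exact le_top
  | coe v =>
    have h3 : 2 * n ≤ 2 * v := by exact_mod_cast h2
    exact_mod_cast (by omega : n ≤ v)

/-! ### Growth of the smoothness exponents -/

lemma diffAbs_eq (t : ℝ) : diffAbs t = 2 * |Real.sin (t / 2)| := by
  have h : diffAbs t ^ 2 = (2 * |Real.sin (t / 2)|) ^ 2 := by
    unfold diffAbs
    have e : -(Complex.I * (t : ℂ)) = ((-t : ℝ) : ℂ) * Complex.I := by push_cast; ring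
    rw [e, ← Complex.normSq_eq_norm_sq, Complex.normSq_apply, Complex.sub_re, Complex.sub_im,
      Complex.exp_ofReal_mul_I_re, Complex.exp_ofReal_mul_I_im, mul_pow, sq_abs,
      Real.sin_sq_eq_half_sub, show 2 * (t / 2) = t by ring, Real.cos_neg, Real.sin_neg]
    simp only [Complex.one_re, Complex.one_im]
    nlinarith [Real.sin_sq_add_cos_sq t]
  exact (pow_left_inj₀ (diffAbs_nonneg t) (by positivity) two_ne_zero).1 h

lemma dyadicProd_interpMask (n k : ℕ) (t : ℝ) :
    dyadicProd (interpMask n) k t = ∏ i ∈ Finset.range k, interpSymbol n (2 ^ i * t) := by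
  unfold dyadicProd
  refine Finset.prod_congr rfl fun i _ => ?_
  rw [symbol_interpMask_eq, Complex.norm_real, Real.norm_of_nonneg (interpSymbol_nonneg _ _)]
  simp

/-- The `ℓ_2` norms are bounded by the suprema of the symbols. The differences supply the factor
`sin(t / 2)` that turns the product of cosines into a sine. -/
lemma rho_interpMask_le (n : ℕ) {s : ℕ} (hs : 2 * (n + 1) ≤ s) :
    rho (interpMask (n + 1)) dil2 s ≤ ENNReal.ofReal (2 * 3 ^ n / 4 ^ (n + 1)) := by
  refine iSup₂_le fun μ hμ => ?_
  have hμ' : μ = fun _ => s := by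
    funext i
    rw [Subsingleton.elim i 0]
    simpa using hμ
  subst hμ'
  simp only [l2norm_nablaPow_subdivision]
  refine limsup_rpow_inv_le (K := ENNReal.ofReal (2 ^ s * 2 ^ n)) ENNReal.ofReal_ne_top ?_
  filter_upwards with k
  rw [← ENNReal.ofReal_pow (by positivity), ← ENNReal.ofReal_mul (by positivity)]
  apply ENNReal.ofReal_le_ofReal
  rw [Real.sqrt_le_left (by positivity)]
  refine l2sq_le_const _ _ fun ω => ?_
  have e : ω = ![ω 0] := by funext i; simp [Subsingleton.elim i 0]
  rw [e, norm_symbol_cascade_dil2, dyadicProd_interpMask, diffAbs_eq]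
  set t := ω 0
  have h0 : 0 ≤ ∏ i ∈ Finset.range k, interpSymbol (n + 1) (2 ^ i * t) :=
    Finset.prod_nonneg fun _ _ => interpSymbol_nonneg _ _
  have h1 := sin_pow_mul_prod_interpSymbol_le n k t
  have h2 : |Real.sin (t / 2)| ^ s ≤ Real.sin (t / 2) ^ (2 * (n + 1)) := by
    rw [pow_mul (Real.sin (t / 2)), ← sq_abs, ← pow_mul]
    exact pow_le_pow_of_le_one (abs_nonneg _) (Real.abs_sin_le_one _) hs
  refine pow_le_pow_left₀ (by positivity) ?_ 2
  calc (2 * |Real.sin (t / 2)|) ^ s *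
        (2 ^ k * ∏ i ∈ Finset.range k, interpSymbol (n + 1) (2 ^ i * t))
      = 2 ^ s * 2 ^ k * (|Real.sin (t / 2)| ^ s *
        ∏ i ∈ Finset.range k, interpSymbol (n + 1) (2 ^ i * t)) := by rw [mul_pow]; ring
    _ ≤ 2 ^ s * 2 ^ k * (Real.sin (t / 2) ^ (2 * (n + 1)) *
        ∏ i ∈ Finset.range k, interpSymbol (n + 1) (2 ^ i * t)) := by gcongr
    _ ≤ 2 ^ s * 2 ^ k * ((2 * 3 ^ k) ^ n / 4 ^ (k * (n + 1))) := by gcongr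
    _ = 2 ^ s * 2 ^ n * (2 * 3 ^ n / 4 ^ (n + 1)) ^ k := by
        rw [div_pow, mul_pow, mul_pow, ← pow_mul, ← pow_mul, ← pow_mul, mul_comm k n,
          mul_comm k (n + 1)]
        ring

lemma ereal_sub_mul_le {c z : ℝ} (hc : 0 < c) {x : EReal} {y : ℝ} (h : x ≤ y) :
    ((z - c * y : ℝ) : EReal) ≤ ((z : ℝ) : EReal) - ((c : ℝ) : EReal) * x := by
  induction x with
  | top => simp at h
  | bot => rw [EReal.coe_mul_bot_of_pos hc, EReal.coe_sub_bot]; exact OrderTop.le_top _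
  | coe x =>
    have h' : x ≤ y := by exact_mod_cast h
    rw [← EReal.coe_mul, ← EReal.coe_sub, EReal.coe_le_coe_iff]
    nlinarith

lemma le_sm_interpMask (n : ℕ) :
    ((1 / 2 - 1 / Real.log 2 * Real.log (2 * 3 ^ n / 4 ^ (n + 1)) : ℝ) : EReal) ≤
      sm (interpMask (n + 1)) dil2 := by
  have hn : 1 ≤ n + 1 := by omega
  obtain ⟨s, hs⟩ := ENat.ne_top_iff_exists.1 (sr_dil2_ne_top (isSymLowPass_interpMask hn).low)
  have h2 := two_mul_le_sr_interpMask hn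
  rw [← hs] at h2
  have h3 := rho_interpMask_le n (s := s) (by exact_mod_cast h2)
  have h4 := ENNReal.log_monotone h3
  rw [ENNReal.log_ofReal_of_pos (by positivity)] at h4
  unfold sm
  rw [← hs, ENat.toNat_natCast, dil2_det]
  have h5 := ereal_sub_mul_le (z := 1 / 2) (c := 1 / Real.log 2) (by positivity) h4
  convert h5 using 3 <;> norm_num

lemma tendsto_sm_tensor_interpMask :
    Tendsto (fun n => sm (tensor (interpMask n) (interpMask n)) quincunxM) atTop (𝓝 ⊤) := by
  rw [← tendsto_add_atTop_iff_nat 1, EReal.tendsto_nhds_top_iff_real]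
  intro R
  have hlog : 0 < Real.log (4 / 3) := Real.log_pos (by norm_num)
  have hlog2 : 0 < Real.log 2 := Real.log_pos (by norm_num)
  have hlim : Tendsto (fun n : ℕ => (n : ℝ) * Real.log (4 / 3)) atTop atTop :=
    tendsto_natCast_atTop_atTop.atTop_mul_const hlog
  filter_upwards [hlim.eventually_gt_atTop (R * Real.log 2)] with n hn
  have h1 := (isSymLowPass_interpMask (n := n + 1) (by omega)).two_mul_sm_le
  refine lt_of_lt_of_le ?_ h1
  have h2 : (2 : EReal) * ((1 / 2 - 1 / Real.log 2 * Real.log (2 * 3 ^ n / 4 ^ (n + 1)) : ℝ) : EReal) ≤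
      2 * sm (interpMask (n + 1)) dil2 := by
    gcongr
    exact le_sm_interpMask n
  refine lt_of_lt_of_le ?_ h2
  rw [show (2 : EReal) = ((2 : ℝ) : EReal) from rfl, ← EReal.coe_mul, EReal.coe_lt_coe_iff]
  have e : Real.log (2 * 3 ^ n / 4 ^ (n + 1)) = -(n * Real.log (4 / 3)) - Real.log 2 := by
    have : (2 * 3 ^ n / 4 ^ (n + 1) : ℝ) = ((4 / 3) ^ n * 2)⁻¹ := by
      rw [div_pow, pow_succ]; field_simp; norm_num
    rw [this, Real.log_inv, Real.log_mul (by positivity) (by norm_num), Real.log_pow]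
    ring
  rw [e]
  have h3 : R < (n * Real.log (4 / 3)) / Real.log 2 := by rwa [lt_div_iff₀ hlog2]
  have h4 : 1 / Real.log 2 * (-(n * Real.log (4 / 3)) - Real.log 2) =
      -((n * Real.log (4 / 3)) / Real.log 2) - 1 := by field_simp
  rw [h4]
  have h5 : 0 ≤ (n * Real.log (4 / 3)) / Real.log 2 := by positivity
  linarith

end Interpolatory

/-! ### The refinable function in the frequency domain -/

/-- The partial products `∏_{1 ≤ i ≤ J} â(2^{-i} x)` for `a = a^I_{2n}`. -/
def partialProd (n J : ℕ) (x : ℝ) : ℝ := ∏ i ∈ Finset.range J, interpSymbol n (x / 2 ^ (i + 1))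

/-- The infinite product `∏_{i ≥ 1} â(2^{-i} x)` for `a = a^I_{2n}`. All factors lie in `[0, 1]`,
so it is the infimum of the partial products. -/
def infProd (n : ℕ) (x : ℝ) : ℝ := ⨅ J, partialProd n J x

lemma partialProd_nonneg (n J : ℕ) (x : ℝ) : 0 ≤ partialProd n J x :=
  Finset.prod_nonneg fun _ _ => interpSymbol_nonneg _ _

lemma partialProd_succ (n J : ℕ) (x : ℝ) :
    partialProd n (J + 1) x = partialProd n J x * interpSymbol n (x / 2 ^ (J + 1)) :=
  Finset.prod_range_succ _ _

lemma partialProd_succ' (n J : ℕ) (x : ℝ) :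
    partialProd n (J + 1) x = interpSymbol n (x / 2) * partialProd n J (x / 2) := by
  unfold partialProd
  rw [Finset.prod_range_succ', mul_comm]
  simp only [zero_add, pow_one, div_div, ← pow_succ']

lemma partialProd_antitone {n : ℕ} (hn : 1 ≤ n) (x : ℝ) : Antitone fun J => partialProd n J x :=
  antitone_nat_of_succ_le fun J => by
    rw [partialProd_succ]
    exact mul_le_of_le_one_right (partialProd_nonneg _ _ _) (interpSymbol_le_one hn _)

lemma bddBelow_partialProd (n : ℕ) (x : ℝ) : BddBelow (Set.range fun J => partialProd n J x) :=
  ⟨0, by rintro _ ⟨J, rfl⟩; exact partialProd_nonneg _ _ _⟩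

lemma tendsto_partialProd {n : ℕ} (hn : 1 ≤ n) (x : ℝ) :
    Tendsto (fun J => partialProd n J x) atTop (𝓝 (infProd n x)) :=
  tendsto_atTop_ciInf (partialProd_antitone hn x) (bddBelow_partialProd n x)

lemma infProd_le (n J : ℕ) (x : ℝ) : infProd n x ≤ partialProd n J x :=
  ciInf_le (bddBelow_partialProd n x) J

lemma infProd_nonneg (n : ℕ) (x : ℝ) : 0 ≤ infProd n x :=
  le_ciInf fun _ => partialProd_nonneg _ _ _

lemma infProd_le_one (n : ℕ) (x : ℝ) : infProd n x ≤ 1 := by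
  simpa [partialProd] using infProd_le n 0 x

lemma partialProd_le_one {n : ℕ} (hn : 1 ≤ n) (J : ℕ) (x : ℝ) : partialProd n J x ≤ 1 := by
  simpa [partialProd] using partialProd_antitone hn x (Nat.zero_le J)

lemma partialProd_neg (n J : ℕ) (x : ℝ) : partialProd n J (-x) = partialProd n J x := by
  simp only [partialProd, neg_div, interpSymbol_neg]

lemma infProd_neg (n : ℕ) (x : ℝ) : infProd n (-x) = infProd n x := by
  simp only [infProd, partialProd_neg]

lemma infProd_eq {n : ℕ} (hn : 1 ≤ n) (x : ℝ) :
    infProd n x = interpSymbol n (x / 2) * infProd n (x / 2) := by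
  refine tendsto_nhds_unique ((tendsto_partialProd hn x).comp (tendsto_add_atTop_nat 1)) ?_
  have := (tendsto_partialProd hn (x / 2)).const_mul (interpSymbol n (x / 2))
  refine this.congr fun J => ?_
  simp only [Function.comp, partialProd_succ']

lemma one_sub_le_interpSymbol {n : ℕ} (hn : 1 ≤ n) (x : ℝ) :
    1 - interpPoly n 1 * x ^ 2 / 4 ≤ interpSymbol n x := by
  have h := interpSymbol_add n hn x
  have h2 : interpSymbol n (x + Real.pi) ≤ interpPoly n 1 * x ^ 2 / 4 := by
    rw [interpSymbol_add_pi, mul_comm, mul_div_assoc]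
    refine mul_le_mul (interpPoly_mono n (sq_nonneg _) (Real.cos_sq_le_one _)) ?_
      (by rw [pow_mul]; positivity) (interpPoly_nonneg n zero_le_one)
    rw [pow_mul]
    calc (Real.sin (x / 2) ^ 2) ^ n ≤ (Real.sin (x / 2) ^ 2) ^ 1 :=
          pow_le_pow_of_le_one (sq_nonneg _) (Real.sin_sq_le_one _) hn
      _ = |Real.sin (x / 2)| ^ 2 := by rw [pow_one, sq_abs]
      _ ≤ |x / 2| ^ 2 := pow_le_pow_left₀ (abs_nonneg _) Real.abs_sin_le_abs 2
      _ = x ^ 2 / 4 := by rw [sq_abs]; ring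
  linarith

/-- The infinite product is `1 + O(x²)` at the origin. -/
lemma one_sub_le_infProd {n : ℕ} (hn : 1 ≤ n) (x : ℝ) :
    1 - interpPoly n 1 * x ^ 2 ≤ infProd n x := by
  have hK := interpPoly_nonneg n zero_le_one
  have key : ∀ J, 1 - interpPoly n 1 * x ^ 2 * (1 - 1 / 4 ^ J) ≤ partialProd n J x := by
    intro J
    induction J with
    | zero => simp [partialProd]
    | succ J ih =>
      rw [partialProd_succ]
      have h1 := one_sub_le_interpSymbol hn (x / 2 ^ (J + 1))
      have h2 := interpSymbol_le_one hn (x / 2 ^ (J + 1))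
      have h3 := partialProd_le_one hn J x
      have h4 := partialProd_nonneg n J x
      have h5 : interpPoly n 1 * (x / 2 ^ (J + 1)) ^ 2 / 4 =
          interpPoly n 1 * x ^ 2 * (1 / 4 ^ J) / 16 := by
        have : (2 ^ (J + 1) : ℝ) ^ 2 = 4 * 4 ^ J := by
          rw [← pow_mul, mul_comm, pow_mul, pow_succ]; norm_num; ring
        rw [div_pow, this]; field_simp; ring
      have h6 : (1 : ℝ) / 4 ^ (J + 1) = 1 / 4 ^ J / 4 := by rw [pow_succ]; field_simp
      rw [h5] at h1
      rw [h6]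
      have h7 : 0 ≤ interpPoly n 1 * x ^ 2 * (1 / 4 ^ J) := by positivity
      nlinarith
  refine le_ciInf fun J => (sub_le_sub_left ?_ 1).trans (key J)
  refine mul_le_of_le_one_right (by positivity) ?_
  have : (0 : ℝ) ≤ 1 / 4 ^ J := by positivity
  linarith

/-- The rate `3ⁿ / 4^{n+1}` per dyadic step is a decay of order `2 + n / 3`, since `3³ · 2 ≤ 4³`. -/
lemma three_pow_mul_two_pow_le (n : ℕ) : 3 ^ n * 2 ^ (2 + n / 3) ≤ 4 ^ (n + 1) := by
  have h : ∀ q r : ℕ, r < 3 → 3 ^ (3 * q + r) * 2 ^ (2 + q) ≤ 4 ^ (3 * q + r + 1) := by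
    intro q r hr
    have h1 : 54 ^ q ≤ 64 ^ q := Nat.pow_le_pow_left (by norm_num) q
    have h2 : 3 ^ r ≤ 4 ^ r := Nat.pow_le_pow_left (by norm_num) r
    calc 3 ^ (3 * q + r) * 2 ^ (2 + q) = 4 * (54 ^ q * 3 ^ r) := by
          rw [pow_add, pow_mul, pow_add, show 54 = 3 ^ 3 * 2 by norm_num, mul_pow]; ring
      _ ≤ 4 * (64 ^ q * 4 ^ r) := by gcongr
      _ = 4 ^ (3 * q + r + 1) := by
          rw [pow_add, pow_add, pow_mul]; norm_num; ring
  have := h (n / 3) (n % 3) (Nat.mod_lt _ (by norm_num))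
  rwa [Nat.div_add_mod] at this

/-- Polynomial decay of the infinite product, with an exponent growing linearly in `n`. -/
lemma exists_infProd_le (n : ℕ) :
    ∃ C : ℝ, 0 ≤ C ∧ ∀ x, infProd (n + 1) x ≤ C / (1 + |x|) ^ (2 + n / 3) := by
  have hs3 := three_pow_mul_two_pow_le n
  generalize 2 + n / 3 = s at hs3 ⊢
  refine ⟨4 ^ (2 * (n + 1)) * 2 ^ n * 4 ^ s, by positivity, fun x => ?_⟩
  rw [le_div_iff₀ (by positivity)]
  have h1 := infProd_le_one (n + 1) x
  have h0 := infProd_nonneg (n + 1) x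
  rcases lt_or_ge |x| 1 with hx | hx
  · calc infProd (n + 1) x * (1 + |x|) ^ s ≤ 1 * 2 ^ s := by
          gcongr
          linarith
      _ ≤ 1 * 4 ^ s := by gcongr; norm_num
      _ ≤ 4 ^ (2 * (n + 1)) * 2 ^ n * 4 ^ s := by
          gcongr
          exact one_le_mul_of_one_le_of_one_le (one_le_pow₀ (by norm_num))
            (one_le_pow₀ (by norm_num))
  · -- with `2^k ≤ |x| < 2^(k+1)` the sine at `x / 2^(k+1)` is bounded below
    obtain ⟨k, hk1, hk2⟩ := exists_nat_pow_near hx (one_lt_two)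
    have hp : (0 : ℝ) < 2 ^ k := by positivity
    have hxk : |x / 2 ^ k / 2| = |x| / 2 ^ k / 2 := by
      rw [abs_div, abs_div, abs_of_pos hp, abs_two]
    have hy1 : 1 / 2 ≤ |x / 2 ^ k / 2| := by
      rw [hxk]; gcongr; rwa [le_div_iff₀ hp, one_mul]
    have hy2 : |x / 2 ^ k / 2| ≤ 1 := by
      rw [hxk, div_div, div_le_one (by positivity), ← pow_succ]; exact hk2.le
    have hsin : 1 / 4 ≤ |Real.sin (x / 2 ^ k / 2)| := by
      have h3 : |Real.sin (x / 2 ^ k / 2)| = abs (Real.sin (abs (x / 2 ^ k / 2))) := by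
        rcases abs_cases (x / 2 ^ k / 2) with h | h <;> rw [h.1]
        rw [Real.sin_neg, abs_neg]
      rw [h3]
      have h4 := Real.mul_le_sin (abs_nonneg (x / 2 ^ k / 2))
        (hy2.trans (by linarith [Real.pi_gt_three]))
      have h5 : 1 / 2 ≤ 2 / Real.pi := by
        rw [div_le_div_iff₀ (by norm_num) Real.pi_pos]; linarith [Real.pi_le_four]
      have h6 : 1 / 2 * (1 / 2) ≤ 2 / Real.pi * |x / 2 ^ k / 2| := by gcongr
      refine le_trans ?_ (le_abs_self _)
      linarith
    have key := sin_pow_mul_prod_interpSymbol_le n k (x / 2 ^ k)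
    have hprod : ∏ i ∈ Finset.range k, interpSymbol (n + 1) (2 ^ i * (x / 2 ^ k)) =
        partialProd (n + 1) k x := by
      unfold partialProd
      rw [← Finset.prod_range_reflect]
      refine Finset.prod_congr rfl fun i hi => ?_
      have hi := Finset.mem_range.1 hi
      congr 1
      have : (2 : ℝ) ^ k = 2 ^ (k - 1 - i) * 2 ^ (i + 1) := by
        rw [← pow_add]; congr 1; omega
      rw [this]
      field_simp
    rw [hprod] at key
    have hs : (1 / 4 : ℝ) ^ (2 * (n + 1)) ≤ Real.sin (x / 2 ^ k / 2) ^ (2 * (n + 1)) := by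
      rw [pow_mul (Real.sin _), ← sq_abs, ← pow_mul]
      exact pow_le_pow_left₀ (by norm_num) hsin _
    have hb : (2 * 3 ^ k : ℝ) ^ n / 4 ^ (k * (n + 1)) ≤ 2 ^ n / (2 ^ k) ^ s := by
      have h3 : ((3 : ℝ) ^ n * 2 ^ s) ^ k ≤ (4 ^ (n + 1)) ^ k := by
        refine pow_le_pow_left₀ (by positivity) ?_ k
        exact_mod_cast hs3
      rw [div_le_div_iff₀ (by positivity) (by positivity)]
      calc (2 * 3 ^ k : ℝ) ^ n * (2 ^ k) ^ s = 2 ^ n * ((3 : ℝ) ^ n * 2 ^ s) ^ k := by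
            rw [mul_pow, mul_pow, ← pow_mul, ← pow_mul, ← pow_mul, ← pow_mul, mul_comm k n,
              mul_comm k s]; ring
        _ ≤ 2 ^ n * (4 ^ (n + 1)) ^ k := by gcongr
        _ = 2 ^ n * 4 ^ (k * (n + 1)) := by rw [← pow_mul, mul_comm k]
    have hfin : (1 / 4 : ℝ) ^ (2 * (n + 1)) * infProd (n + 1) x ≤ 2 ^ n / (2 ^ k) ^ s :=
      calc (1 / 4 : ℝ) ^ (2 * (n + 1)) * infProd (n + 1) x
          ≤ Real.sin (x / 2 ^ k / 2) ^ (2 * (n + 1)) * partialProd (n + 1) k x :=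
            mul_le_mul hs (infProd_le _ _ _) h0 (by rw [pow_mul]; positivity)
        _ ≤ _ := key.trans hb
    rw [one_div, inv_pow, inv_mul_le_iff₀ (by positivity)] at hfin
    have hx4 : 1 + |x| ≤ 4 * 2 ^ k := by rw [pow_succ] at hk2; linarith
    calc infProd (n + 1) x * (1 + |x|) ^ s
        ≤ 4 ^ (2 * (n + 1)) * (2 ^ n / (2 ^ k) ^ s) * (4 * 2 ^ k) ^ s := by gcongr
      _ = 4 ^ (2 * (n + 1)) * 2 ^ n * 4 ^ s := by rw [mul_pow]; field_simp

/-- The Fourier transform of the refinable function of `a^I_{2n} ⊗ a^I_{2n}`. Every second power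
of a quincunx matrix is a dyadic dilation up to signs and exchange of the coordinates, so that the
infinite product splits into four one-dimensional ones. -/
def refinableSymbol (n : ℕ) (ω : Fin 2 → ℝ) : ℝ :=
  infProd n (ω 0) * infProd n (ω 1) * (infProd n (ω 0 + ω 1) * infProd n (ω 0 - ω 1))

lemma refinableSymbol_nonneg (n : ℕ) (ω : Fin 2 → ℝ) : 0 ≤ refinableSymbol n ω := by
  have := infProd_nonneg n
  unfold refinableSymbol
  have h1 := mul_nonneg (this (ω 0)) (this (ω 1))
  have h2 := mul_nonneg (this (ω 0 + ω 1)) (this (ω 0 - ω 1))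
  exact mul_nonneg h1 h2

lemma refinableSymbol_le_one (n : ℕ) (ω : Fin 2 → ℝ) : refinableSymbol n ω ≤ 1 := by
  have h0 := infProd_nonneg n
  have h1 := infProd_le_one n
  unfold refinableSymbol
  exact mul_le_one₀ (mul_le_one₀ (h1 _) (h0 _) (h1 _)) (mul_nonneg (h0 _) (h0 _))
    (mul_le_one₀ (h1 _) (h0 _) (h1 _))

lemma one_sub_le_refinableSymbol {n : ℕ} (hn : 1 ≤ n) (ω : Fin 2 → ℝ) :
    1 - 3 * interpPoly n 1 * (ω 0 ^ 2 + ω 1 ^ 2) ≤ refinableSymbol n ω := by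
  have h0 := infProd_nonneg n
  have h1 := infProd_le_one n
  have h2 := one_sub_le_infProd hn
  have key : ∀ p q : ℝ, 0 ≤ p → p ≤ 1 → 0 ≤ q → q ≤ 1 → p + q - 1 ≤ p * q := fun p q _ _ _ _ => by
    nlinarith
  have e1 := key _ _ (h0 (ω 0)) (h1 _) (h0 (ω 1)) (h1 _)
  have e2 := key _ _ (h0 (ω 0 + ω 1)) (h1 _) (h0 (ω 0 - ω 1)) (h1 _)
  have e3 := key _ _ (mul_nonneg (h0 (ω 0)) (h0 (ω 1))) (mul_le_one₀ (h1 _) (h0 _) (h1 _))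
    (mul_nonneg (h0 (ω 0 + ω 1)) (h0 (ω 0 - ω 1))) (mul_le_one₀ (h1 _) (h0 _) (h1 _))
  have := h2 (ω 0)
  have := h2 (ω 1)
  have := h2 (ω 0 + ω 1)
  have := h2 (ω 0 - ω 1)
  unfold refinableSymbol
  nlinarith

lemma exists_refinableSymbol_le (n : ℕ) : ∃ C : ℝ, 0 ≤ C ∧ ∀ ω,
    refinableSymbol (n + 1) ω ≤ C / (1 + (|ω 0| + |ω 1|)) ^ (2 * (2 + n / 3)) := by
  obtain ⟨C, hC, h⟩ := exists_infProd_le n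
  generalize 2 + n / 3 = s at h ⊢
  have h0 := infProd_nonneg (n + 1)
  have key : ∀ p q : ℝ, infProd (n + 1) p * infProd (n + 1) q ≤ C ^ 2 / (1 + (|p| + |q|)) ^ s := by
    intro p q
    calc infProd (n + 1) p * infProd (n + 1) q
        ≤ C / (1 + |p|) ^ s * (C / (1 + |q|) ^ s) :=
          mul_le_mul (h p) (h q) (h0 q) (by positivity)
      _ = C ^ 2 / ((1 + |p|) * (1 + |q|)) ^ s := by rw [mul_pow]; field_simp
      _ ≤ C ^ 2 / (1 + (|p| + |q|)) ^ s := by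
          gcongr
          nlinarith [mul_nonneg (abs_nonneg p) (abs_nonneg q)]
  refine ⟨C ^ 2 * C ^ 2, by positivity, fun ω => ?_⟩
  calc refinableSymbol (n + 1) ω
      ≤ C ^ 2 / (1 + (|ω 0| + |ω 1|)) ^ s * (C ^ 2 / (1 + (|ω 0 + ω 1| + |ω 0 - ω 1|)) ^ s) :=
        mul_le_mul (key _ _) (key _ _) (mul_nonneg (h0 _) (h0 _)) (by positivity)
    _ ≤ C ^ 2 / (1 + (|ω 0| + |ω 1|)) ^ s * (C ^ 2 / (1 + (|ω 0| + |ω 1|)) ^ s) := by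
        have e0 : |ω 0| ≤ (|ω 0 + ω 1| + |ω 0 - ω 1|) / 2 := by
          have := abs_add_le (ω 0 + ω 1) (ω 0 - ω 1)
          rw [show ω 0 + ω 1 + (ω 0 - ω 1) = 2 * ω 0 by ring, abs_mul, abs_two] at this
          linarith
        have e1 : |ω 1| ≤ (|ω 0 + ω 1| + |ω 0 - ω 1|) / 2 := by
          have := abs_sub (ω 0 + ω 1) (ω 0 - ω 1)
          rw [show ω 0 + ω 1 - (ω 0 - ω 1) = 2 * ω 1 by ring, abs_mul, abs_two] at this
          linarith
        have e2 : |ω 0| + |ω 1| ≤ |ω 0 + ω 1| + |ω 0 - ω 1| := by linarith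
        gcongr
    _ = _ := by rw [two_mul s, pow_add]; field_simp

lemma infProd_congr (n : ℕ) {x y : ℝ} (h : |x| = |y|) : infProd n x = infProd n y := by
  rcases abs_eq_abs.1 h with rfl | rfl
  · rfl
  · exact infProd_neg n y

lemma refinableSymbol_congr (n : ℕ) {v w : Fin 2 → ℝ} (h : SameAbs v w) :
    refinableSymbol n v = refinableSymbol n w := by
  have h' := h.add_sub
  have key : ∀ {v w : Fin 2 → ℝ}, SameAbs v w →
      infProd n (v 0) * infProd n (v 1) = infProd n (w 0) * infProd n (w 1) := by
    rintro v w (⟨h0, h1⟩ | ⟨h0, h1⟩)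
    · rw [infProd_congr n h0, infProd_congr n h1]
    · rw [infProd_congr n h0, infProd_congr n h1, mul_comm]
  have h2 := key h'
  simp only [Matrix.cons_val_zero, Matrix.cons_val_one] at h2
  unfold refinableSymbol
  rw [key h, h2]

section Quincunx

variable {M : Matrix (Fin 2) (Fin 2) ℤ}

lemma transpose_mul_quincunx (hM : M = quincunxM ∨ M = quincunxN) :
    (toReal M).transpose * toReal M = (2 : ℝ) • 1 := by
  rcases hM with rfl | rfl <;>
  · ext i j
    fin_cases i <;> fin_cases j <;>
      simp [toReal, quincunxM, quincunxN, Matrix.mul_apply, one_add_one_eq_two]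

/-- A quincunx matrix is `√2` times an orthogonal matrix. -/
lemma transpose_inv_quincunx (hM : M = quincunxM ∨ M = quincunxN) :
    (toReal M).transpose⁻¹ = (1 / 2 : ℝ) • toReal M := by
  refine Matrix.inv_eq_right_inv ?_
  rw [Matrix.mul_smul, transpose_mul_quincunx hM, smul_smul]
  norm_num

lemma sameAbs_transpose_inv_mulVec (hM : M = quincunxM ∨ M = quincunxN) (ω : Fin 2 → ℝ) :
    SameAbs ((toReal M).transpose⁻¹.mulVec ω) ![(ω 0 + ω 1) / 2, (ω 0 - ω 1) / 2] := by
  rw [transpose_inv_quincunx hM]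
  rcases hM with rfl | rfl
  · refine Or.inl ⟨?_, ?_⟩ <;> congr 1 <;>
      simp [Matrix.mulVec, dotProduct, toReal, quincunxM] <;> ring
  · refine Or.inr ⟨?_, ?_⟩ <;> congr 1 <;>
      simp [Matrix.mulVec, dotProduct, toReal, quincunxN] <;> ring

lemma symbol_tensor_interpMask (n : ℕ) (ω : Fin 2 → ℝ) :
    symbol (tensor (interpMask n) (interpMask n)) ω =
      ((interpSymbol n (ω 0) * interpSymbol n (ω 1) : ℝ) : ℂ) := by
  rw [symbol_tensor, symbol_interpMask_eq, symbol_interpMask_eq]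
  simp

/-- The refinement equation in the frequency domain. -/
lemma symbol_mul_refinableSymbol {n : ℕ} (hn : 1 ≤ n) (hM : M = quincunxM ∨ M = quincunxN)
    (ω : Fin 2 → ℝ) :
    symbol (tensor (interpMask n) (interpMask n)) ((toReal M).transpose⁻¹.mulVec ω) *
      (refinableSymbol n ((toReal M).transpose⁻¹.mulVec ω) : ℂ) = (refinableSymbol n ω : ℂ) := by
  have h := sameAbs_transpose_inv_mulVec hM ω
  have hI : ∀ {x y : ℝ}, |x| = |y| → interpSymbol n x = interpSymbol n y := by
    intro x y hxy
    rcases abs_eq_abs.1 hxy with rfl | rfl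
    · rfl
    · exact interpSymbol_neg n y
  have h1 : symbol (tensor (interpMask n) (interpMask n)) ((toReal M).transpose⁻¹.mulVec ω) =
      ((interpSymbol n ((ω 0 + ω 1) / 2) * interpSymbol n ((ω 0 - ω 1) / 2) : ℝ) : ℂ) := by
    rw [symbol_tensor_interpMask]
    rcases h with ⟨h0, h1⟩ | ⟨h0, h1⟩ <;> rw [hI h0, hI h1]
    · rfl
    · rw [mul_comm]; rfl
  rw [h1, refinableSymbol_congr n h, ← Complex.ofReal_mul]
  congr 1
  have e0 : (ω 0 + ω 1) / 2 + (ω 0 - ω 1) / 2 = ω 0 := by ring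
  have e1 : (ω 0 + ω 1) / 2 - (ω 0 - ω 1) / 2 = ω 1 := by ring
  simp only [refinableSymbol, Matrix.cons_val_zero, Matrix.cons_val_one, e0, e1]
  rw [infProd_eq hn (ω 0 + ω 1), infProd_eq hn (ω 0 - ω 1)]
  ring

lemma transpose_inv_pow_sq_sum (hM : M = quincunxM ∨ M = quincunxN) (j : ℕ) (ω : Fin 2 → ℝ) :
    ((toReal M).transpose⁻¹ ^ j).mulVec ω 0 ^ 2 + ((toReal M).transpose⁻¹ ^ j).mulVec ω 1 ^ 2 =
      (ω 0 ^ 2 + ω 1 ^ 2) / 2 ^ j := by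
  induction j with
  | zero => simp
  | succ j ih =>
    rw [pow_succ' (toReal M).transpose⁻¹, ← Matrix.mulVec_mulVec]
    set v := ((toReal M).transpose⁻¹ ^ j).mulVec ω
    have h := sameAbs_transpose_inv_mulVec hM v
    have e : (ω 0 ^ 2 + ω 1 ^ 2) / 2 ^ (j + 1) = (v 0 ^ 2 + v 1 ^ 2) / 2 := by
      rw [ih, pow_succ (2 : ℝ), div_div]
    rw [e]
    simp only [SameAbs, Matrix.cons_val_zero, Matrix.cons_val_one, ← sq_eq_sq_iff_abs_eq_abs] at h
    rcases h with ⟨h0, h1⟩ | ⟨h0, h1⟩ <;> rw [h0, h1] <;> ring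

lemma tendsto_refinableSymbol_pow {n : ℕ} (hn : 1 ≤ n) (hM : M = quincunxM ∨ M = quincunxN)
    (ω : Fin 2 → ℝ) :
    Tendsto (fun J : ℕ => refinableSymbol n (((toReal M).transpose⁻¹ ^ J).mulVec ω)) atTop
      (𝓝 1) := by
  refine tendsto_of_tendsto_of_tendsto_of_le_of_le ?_ tendsto_const_nhds
    (fun J => one_sub_le_refinableSymbol hn _) (fun J => refinableSymbol_le_one n _)
  simp only [transpose_inv_pow_sq_sum hM]
  have h : Tendsto (fun J : ℕ => (ω 0 ^ 2 + ω 1 ^ 2) / 2 ^ J) atTop (𝓝 0) :=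
    tendsto_const_nhds.div_atTop (tendsto_pow_atTop_atTop_of_one_lt one_lt_two)
  simpa using (h.const_mul (3 * interpPoly n 1)).const_sub 1

/-- The partial products are `φ̂(ω) / φ̂((Mᵀ)^{-J} ω)` by the refinement equation, and the denominator
tends to `1`. -/
lemma isRefinableProduct_refinableSymbol {n : ℕ} (hn : 1 ≤ n)
    (hM : M = quincunxM ∨ M = quincunxN) :
    IsRefinableProduct M (tensor (interpMask n) (interpMask n))
      fun ω => (refinableSymbol n ω : ℂ) := by
  intro ω
  have h := (Complex.continuous_ofReal.tendsto _).comp (tendsto_refinableSymbol_pow hn hM ω)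
  have h2 := (tendsto_const_nhds (x := (refinableSymbol n ω : ℂ))).div h (by simp)
  rw [Complex.ofReal_one, div_one] at h2
  have h3 := (tendsto_refinableSymbol_pow hn hM ω).eventually_ne one_ne_zero
  refine h2.congr' ?_
  filter_upwards [h3] with J hJ
  have key : ∀ J : ℕ, (∏ j ∈ Finset.range J, symbol (tensor (interpMask n) (interpMask n))
      (((toReal M).transpose⁻¹ ^ (j + 1)).mulVec ω)) *
        (refinableSymbol n (((toReal M).transpose⁻¹ ^ J).mulVec ω) : ℂ) = refinableSymbol n ω := by
    intro J
    induction J with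
    | zero => simp
    | succ J ih =>
      rw [Finset.prod_range_succ, mul_assoc, pow_succ', ← Matrix.mulVec_mulVec,
        symbol_mul_refinableSymbol hn hM, ih]
  rw [Pi.div_apply, div_eq_iff (by simpa using hJ), ← key J]
  rfl

end Quincunx

/-! ### The Fourier transform on `L_1 ∩ L_2` -/

lemma continuous_neg_innerₗ (d : ℕ) :
    Continuous fun p : E d × E d => (-innerₗ (E d)) p.1 p.2 :=
  (continuous_inner (𝕜 := ℝ) (E := E d)).neg

open SchwartzMap in
/-- Self-adjointness of the inverse Fourier transform. -/
lemma integral_fourierInv_schwartz_mul {d : ℕ} (t : 𝓢(E d, ℂ)) {g : E d → ℂ}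
    (h1 : Integrable g) : ∫ ξ, 𝓕⁻ t ξ * g ξ = ∫ x, t x * 𝓕⁻ g x := by
  have h := VectorFourier.integral_fourierIntegral_smul_eq_flip (e := Real.fourierChar)
    (L := -innerₗ (E d)) (f := (t : E d → ℂ)) (g := g) Real.continuous_fourierChar
    (continuous_neg_innerₗ d) (t.integrable (μ := volume)) h1
  have hflip : (-innerₗ (E d)).flip = -innerₗ (E d) := by
    ext x y; simp [real_inner_comm]
  rw [hflip] at h
  simpa [fourierInv_coe] using! h

lemma continuous_fourierInv {d : ℕ} {g : E d → ℂ} (h1 : Integrable g) : Continuous (𝓕⁻ g) :=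
  VectorFourier.fourierIntegral_continuous Real.continuous_fourierChar
    (continuous_neg_innerₗ d) h1

/-- On `L_1 ∩ L_2` the inverse Fourier transform of `L_2` is given by the Fourier integral. -/
lemma fourierInv_toLp_ae {d : ℕ} {g : E d → ℂ} (h1 : Integrable g) (h2 : MemLp g 2) :
    (𝓕⁻ (h2.toLp g) : L2 d) =ᵐ[volume] 𝓕⁻ g := by
  refine ae_eq_of_integral_contDiff_smul_eq ?_ (continuous_fourierInv h1).locallyIntegrable ?_
  · exact (Lp.memLp _).locallyIntegrable (by norm_num)
  · intro t ht hc
    have hc' : HasCompactSupport fun x => (t x : ℂ) := hc.comp_left Complex.ofReal_zero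
    have ht' : ContDiff ℝ ((⊤ : ℕ∞) : WithTop ℕ∞) fun x => (t x : ℂ) := Complex.ofRealCLM.contDiff.comp ht
    set T := hc'.toSchwartzMap ht'
    have h3 := congrArg (fun D => D T) (Lp.fourierInv_toTemperedDistribution_eq (h2.toLp g))
    simp only [TemperedDistribution.fourierInv_apply, Lp.toTemperedDistribution_apply,
      smul_eq_mul] at h3
    have h4 : ∫ x, (𝓕⁻ T) x * (h2.toLp g : L2 d) x = ∫ x, (𝓕⁻ T) x * g x := by
      refine integral_congr_ae ?_
      filter_upwards [h2.coeFn_toLp] with x hx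
      rw [hx]
    rw [h4, integral_fourierInv_schwartz_mul T h1] at h3
    simp only [Complex.real_smul]
    exact h3.symm

section ChangeOfVariables

variable {d : ℕ}

lemma det_toEuclideanLin (A : Matrix (Fin d) (Fin d) ℝ) :
    LinearMap.det (Matrix.toEuclideanLin A) = A.det := by
  rw [Matrix.toEuclideanLin, Matrix.toLpLin_eq_toLin, LinearMap.det_toLin]

lemma map_toEuclideanLin (A : Matrix (Fin d) (Fin d) ℝ) (hA : A.det ≠ 0) :
    Measure.map (Matrix.toEuclideanLin A) volume =
      ENNReal.ofReal |A.det⁻¹| • (volume : Measure (E d)) := by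
  rw [Measure.map_linearMap_addHaar_eq_smul_addHaar volume (by rwa [det_toEuclideanLin]),
    det_toEuclideanLin]

lemma continuous_toEuclideanLin (A : Matrix (Fin d) (Fin d) ℝ) :
    Continuous (Matrix.toEuclideanLin A) := LinearMap.continuous_of_finiteDimensional _

lemma measurableEmbedding_toEuclideanLin (A : Matrix (Fin d) (Fin d) ℝ) (hA : A.det ≠ 0) :
    MeasurableEmbedding (Matrix.toEuclideanLin A) := by
  have h : LinearMap.det (Matrix.toEuclideanLin A) ≠ 0 := by rwa [det_toEuclideanLin]
  exact (LinearEquiv.ofIsUnitDet (f := Matrix.toEuclideanLin A) (v := Module.finBasis ℝ (E d))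
    (v' := Module.finBasis ℝ (E d)) (by rw [LinearMap.det_toMatrix]; exact h.isUnit)
    ).toContinuousLinearEquiv.toHomeomorph.measurableEmbedding

lemma integral_comp_toEuclideanLin (A : Matrix (Fin d) (Fin d) ℝ) (hA : A.det ≠ 0)
    (f : E d → ℂ) :
    ∫ x, f (Matrix.toEuclideanLin A x) = (|A.det⁻¹| : ℝ) • ∫ x, f x := by
  rw [← (measurableEmbedding_toEuclideanLin A hA).integral_map, map_toEuclideanLin A hA,
    integral_smul_measure, ENNReal.toReal_ofReal (abs_nonneg _)]

lemma quasiMeasurePreserving_toEuclideanLin (A : Matrix (Fin d) (Fin d) ℝ) (hA : A.det ≠ 0) :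
    Measure.QuasiMeasurePreserving (Matrix.toEuclideanLin A) (volume : Measure (E d)) volume := by
  refine ⟨(continuous_toEuclideanLin A).measurable, ?_⟩
  rw [map_toEuclideanLin A hA]
  exact Measure.smul_absolutelyContinuous

lemma integrable_comp_toEuclideanLin (A : Matrix (Fin d) (Fin d) ℝ) (hA : A.det ≠ 0)
    {f : E d → ℂ} (hf : Integrable f) : Integrable fun x => f (Matrix.toEuclideanLin A x) := by
  have := (measurableEmbedding_toEuclideanLin A hA).integrable_map_iff (μ := volume) (g := f)
  rw [Function.comp_def] at this
  rw [← this, map_toEuclideanLin A hA]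
  exact hf.smul_measure ENNReal.ofReal_ne_top

lemma affine_eq (A : Matrix (Fin d) (Fin d) ℝ) (k : Fin d → ℤ) (x : E d) :
    affine A k x = Matrix.toEuclideanLin A x - WithLp.toLp 2 fun i => (k i : ℝ) := by
  ext i
  simp [affine, Matrix.toLpLin_apply]

lemma moveAbout_eq (A : Matrix (Fin d) (Fin d) ℝ) (c x : E d) :
    moveAbout A c x = Matrix.toEuclideanLin A (x - c) + c := by
  ext i
  simp [moveAbout, Matrix.toLpLin_apply]

lemma quasiMeasurePreserving_affine (A : Matrix (Fin d) (Fin d) ℝ) (hA : A.det ≠ 0)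
    (k : Fin d → ℤ) :
    Measure.QuasiMeasurePreserving (affine A k) (volume : Measure (E d)) volume := by
  have h := (measurePreserving_sub_right (volume : Measure (E d))
    (WithLp.toLp 2 fun i => (k i : ℝ))).quasiMeasurePreserving.comp
      (quasiMeasurePreserving_toEuclideanLin A hA)
  convert h using 1
  funext x
  exact affine_eq A k x

lemma quasiMeasurePreserving_moveAbout (A : Matrix (Fin d) (Fin d) ℝ) (hA : A.det ≠ 0) (c : E d) :
    Measure.QuasiMeasurePreserving (moveAbout A c) (volume : Measure (E d)) volume := by
  have h := (measurePreserving_add_right (volume : Measure (E d)) c).quasiMeasurePreserving.comp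
    ((quasiMeasurePreserving_toEuclideanLin A hA).comp
      (measurePreserving_sub_right (volume : Measure (E d)) c).quasiMeasurePreserving)
  convert h using 1
  funext x
  exact moveAbout_eq A c x

lemma inner_toEuclideanLin (A : Matrix (Fin d) (Fin d) ℝ) (x y : E d) :
    inner ℝ (Matrix.toEuclideanLin A x) y = inner ℝ x (Matrix.toEuclideanLin A.transpose y) := by
  simp only [Matrix.toLpLin_apply, PiLp.inner_apply, RCLike.inner_apply, conj_trivial]
  have h := Matrix.dotProduct_mulVec y.ofLp A x.ofLp
  simp only [dotProduct, ← Matrix.mulVec_transpose] at h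
  exact h

/-- The inverse Fourier transform of a modulated dilate is a dilated translate. -/
lemma fourierInv_dilate (P : Matrix (Fin d) (Fin d) ℝ) (hP : P.det ≠ 0) (k : Fin d → ℤ)
    (G : E d → ℂ) (x : E d) :
    𝓕⁻ (fun ξ : E d => Complex.exp (-(Complex.I * (dotR k (fun i => 2 * Real.pi *
        Matrix.toEuclideanLin P.transpose⁻¹ ξ i) : ℂ))) *
          G (Matrix.toEuclideanLin P.transpose⁻¹ ξ)) x =
      (|P.det| : ℝ) • 𝓕⁻ G (affine P k x) := by
  have hdet : P.transpose.det ≠ 0 := by rwa [Matrix.det_transpose]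
  have hinv : (P.transpose⁻¹).det = P.det⁻¹ := by
    rw [Matrix.det_nonsing_inv, Matrix.det_transpose, Ring.inverse_eq_inv']
  have hd : (P.transpose⁻¹).det ≠ 0 := by rw [hinv]; exact inv_ne_zero hP
  rw [Real.fourierInv_eq', Real.fourierInv_eq']
  have h := integral_comp_toEuclideanLin P.transpose⁻¹ hd
    (fun η => Complex.exp ((2 * Real.pi * inner ℝ η (affine P k x) : ℝ) * Complex.I) • G η)
  rw [hinv, inv_inv] at h
  rw [← h]
  congr 1
  funext ξ
  simp only [smul_eq_mul, ← mul_assoc, ← Complex.exp_add]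
  congr 2
  have e1 : inner ℝ (Matrix.toEuclideanLin P.transpose⁻¹ ξ) (Matrix.toEuclideanLin P x) =
      inner ℝ ξ x := by
    rw [inner_toEuclideanLin, Matrix.transpose_nonsing_inv, Matrix.transpose_transpose]
    congr 1
    simp only [Matrix.toLpLin_apply, Matrix.mulVec_mulVec]
    rw [Matrix.nonsing_inv_mul _ hP.isUnit, Matrix.one_mulVec]
  have e2 : inner ℝ (Matrix.toEuclideanLin P.transpose⁻¹ ξ) (WithLp.toLp 2 fun i => (k i : ℝ)) =
      dotR k fun i => Matrix.toEuclideanLin P.transpose⁻¹ ξ i := by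
    simp [PiLp.inner_apply, dotR]
  have e3 : dotR k (fun i => 2 * Real.pi * Matrix.toEuclideanLin P.transpose⁻¹ ξ i) =
      2 * Real.pi * dotR k fun i => Matrix.toEuclideanLin P.transpose⁻¹ ξ i := by
    unfold dotR
    rw [Finset.mul_sum]
    exact Finset.sum_congr rfl fun i _ => by ring
  rw [affine_eq, inner_sub_right, e1, e2, e3]
  push_cast
  ring

end ChangeOfVariables

/-! ### The generated functions -/

section Decay

lemma norm_le_abs_add_abs (ξ : E 2) : ‖ξ‖ ≤ |ξ 0| + |ξ 1| := by
  rw [EuclideanSpace.norm_eq, Fin.sum_univ_two, Real.sqrt_le_left (by positivity)]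
  simp only [Real.norm_eq_abs]
  nlinarith [abs_nonneg (ξ 0), abs_nonneg (ξ 1)]

lemma one_add_norm_le (ξ : E 2) : 1 + ‖ξ‖ ≤ 1 + (|2 * Real.pi * ξ 0| + |2 * Real.pi * ξ 1|) := by
  have h := norm_le_abs_add_abs ξ
  rw [abs_mul, abs_mul _ (ξ 1), abs_of_pos Real.two_pi_pos]
  nlinarith [abs_nonneg (ξ 0), abs_nonneg (ξ 1), Real.pi_gt_three]

lemma integrable_one_add_norm_pow {p : ℝ} (hp : 2 < p) :
    Integrable fun ξ : E 2 => (1 + ‖ξ‖) ^ (-p) :=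
  integrable_one_add_norm (by simpa using hp)

lemma integrable_and_memLp_of_decay {F : E 2 → ℂ} (hm : AEStronglyMeasurable F) {C : ℝ} {p : ℕ}
    (hp : 3 ≤ p) (h : ∀ ξ, ‖F ξ‖ ≤ C / (1 + (|2 * Real.pi * ξ 0| + |2 * Real.pi * ξ 1|)) ^ p) :
    Integrable F ∧ MemLp F 2 := by
  have hC : 0 ≤ C := by simpa using (norm_nonneg _).trans (h 0)
  have h3 : Integrable fun ξ : E 2 => C * (1 + ‖ξ‖) ^ (-(3 : ℝ)) :=
    (integrable_one_add_norm_pow (by norm_num)).const_mul C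
  have hb : ∀ ξ, ‖F ξ‖ ≤ C * (1 + ‖ξ‖) ^ (-(3 : ℝ)) := by
    intro ξ
    refine (h ξ).trans ?_
    rw [Real.rpow_neg (by positivity), ← div_eq_mul_inv]
    norm_cast
    have h1 : 1 + ‖ξ‖ ≤ _ := one_add_norm_le ξ
    calc C / (1 + (|2 * Real.pi * ξ 0| + |2 * Real.pi * ξ 1|)) ^ p
        ≤ C / (1 + ‖ξ‖) ^ p := by gcongr
      _ ≤ C / (1 + ‖ξ‖) ^ 3 := by
          gcongr
          linarith [norm_nonneg ξ]
  have hi : Integrable F := h3.mono' hm (.of_forall hb)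
  refine ⟨hi, (memLp_two_iff_integrable_sq_norm hm).2 ?_⟩
  refine (hi.norm.const_mul C).mono' (hm.norm.pow 2) (.of_forall fun ξ => ?_)
  rw [norm_pow, norm_norm, sq]
  gcongr
  refine (h ξ).trans (div_le_self hC (one_le_pow₀ ?_))
  have := abs_nonneg (2 * Real.pi * ξ 0)
  have := abs_nonneg (2 * Real.pi * ξ 1)
  linarith

/-- Polynomial decay of the Fourier transform bounds the smoothness exponent from below. -/
lemma le_funSm_of_decay {φ : L2 2} {F : (Fin 2 → ℝ) → ℂ} (hF : HasFourier φ F) {C : ℝ} {p : ℕ}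
    (h : ∀ ω, ‖F ω‖ ≤ C / (1 + (|ω 0| + |ω 1|)) ^ p) {τ : ℝ} (h0 : 0 ≤ τ) (hτ : τ + 1 < p) :
    (τ : EReal) ≤ funSm φ := by
  refine le_iSup₂_of_le τ ?_ le_rfl
  have hC : 0 ≤ C := by simpa using (norm_nonneg _).trans (h 0)
  have hi : Integrable fun ξ : E 2 => C ^ 2 * (1 + ‖ξ‖) ^ (-(2 * p - 2 * τ)) :=
    (integrable_one_add_norm_pow (by linarith)).const_mul _
  refine lt_of_le_of_lt (lintegral_mono_ae ?_) hi.lintegral_lt_top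
  filter_upwards [hF] with ξ hξ
  rw [hξ, ← ofReal_norm, ← ENNReal.ofReal_pow (norm_nonneg _),
    ← ENNReal.ofReal_mul (by positivity)]
  apply ENNReal.ofReal_le_ofReal
  set r := ‖(2 * Real.pi) • ξ‖
  have hr0 : 0 ≤ r := norm_nonneg _
  have hr : ‖ξ‖ ≤ r := by
    simp only [r, norm_smul, Real.norm_eq_abs, abs_of_pos Real.two_pi_pos]
    nlinarith [norm_nonneg ξ, Real.pi_gt_three]
  have hr2 : r ≤ |2 * Real.pi * ξ 0| + |2 * Real.pi * ξ 1| := by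
    simpa using norm_le_abs_add_abs ((2 * Real.pi) • ξ)
  have h1 : ‖F fun i => 2 * Real.pi * ξ i‖ ^ 2 ≤ C ^ 2 * (1 + r) ^ (-(2 * p : ℝ)) := by
    have h2 : ‖F fun i => 2 * Real.pi * ξ i‖ ≤ C / (1 + r) ^ p :=
      (h _).trans (by gcongr)
    calc ‖F fun i => 2 * Real.pi * ξ i‖ ^ 2 ≤ (C / (1 + r) ^ p) ^ 2 := by gcongr
      _ = _ := by
        rw [Real.rpow_neg (by positivity), div_pow, ← div_eq_mul_inv, ← pow_mul, mul_comm p 2]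
        norm_cast
  have h2 : (1 + r ^ 2) ^ τ ≤ (1 + r) ^ (2 * τ) := by
    rw [Real.rpow_mul (by positivity)]
    refine Real.rpow_le_rpow (by positivity) ?_ h0
    rw [Real.rpow_two]
    nlinarith
  calc _ ≤ C ^ 2 * (1 + r) ^ (-(2 * p : ℝ)) * (1 + r) ^ (2 * τ) := by gcongr
    _ = C ^ 2 * (1 + r) ^ (-(2 * p - 2 * τ)) := by
      rw [mul_assoc, ← Real.rpow_add (by positivity)]
      congr 2; ring
    _ ≤ C ^ 2 * (1 + ‖ξ‖) ^ (-(2 * p - 2 * τ)) := by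
      gcongr ?_ * ?_
      exact Real.rpow_le_rpow_of_nonpos (by positivity) (by linarith) (by linarith)

end Decay

lemma continuous_interpSymbol (n : ℕ) : Continuous (interpSymbol n) := by
  unfold interpSymbol interpPoly
  fun_prop

lemma continuous_partialProd (n J : ℕ) : Continuous (partialProd n J) := by
  have := continuous_interpSymbol n
  unfold partialProd
  fun_prop

lemma measurable_infProd {n : ℕ} (hn : 1 ≤ n) : Measurable (infProd n) :=
  measurable_of_tendsto_metrizable (fun J => (continuous_partialProd n J).measurable)
    (tendsto_pi_nhds.2 (tendsto_partialProd hn))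

lemma measurable_refinableSymbol {n : ℕ} (hn : 1 ≤ n) : Measurable (refinableSymbol n) := by
  have := measurable_infProd hn
  unfold refinableSymbol
  fun_prop

/-- The Fourier transform (in Mathlib's normalization) of the refinable function. -/
def refFreq (n : ℕ) (ξ : E 2) : ℂ := (refinableSymbol n fun i => 2 * Real.pi * ξ i : ℝ)

/-- The refinable function of the filter `a^I_{2n} ⊗ a^I_{2n}`, a continuous function. -/
def refFun (n : ℕ) : E 2 → ℂ := 𝓕⁻ (refFreq n)

/-- The function `ξ ↦ β̂((Mᵀ)⁻¹ 2πξ) φ̂((Mᵀ)⁻¹ 2πξ)`. -/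
def genFreq (M : Matrix (Fin 2) (Fin 2) ℤ) (n : ℕ) (β : Mask 2) (ξ : E 2) : ℂ :=
  symbol β ((toReal M).transpose⁻¹.mulVec fun i => 2 * Real.pi * ξ i) *
    (refinableSymbol n ((toReal M).transpose⁻¹.mulVec fun i => 2 * Real.pi * ξ i) : ℝ)

/-- The function `2 ∑ k, β(k) φ(M x - k)` generated by the filter `β`. -/
def genFun (M : Matrix (Fin 2) (Fin 2) ℤ) (n : ℕ) (β : Mask 2) (x : E 2) : ℂ :=
  2 * β.sum fun k c => c * refFun n (affine (toReal M) k x)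

lemma norm_symbol_le {d : ℕ} (β : Mask d) (ω : Fin d → ℝ) :
    ‖symbol β ω‖ ≤ β.sum fun _ c => ‖c‖ := by
  unfold symbol Finsupp.sum
  refine (norm_sum_le _ _).trans (Finset.sum_le_sum fun k _ => ?_)
  rw [norm_mul, norm_exp_neg_I_mul, mul_one]

section Generated

variable {n : ℕ} {M : Matrix (Fin 2) (Fin 2) ℤ}

lemma exists_refFreq_decay (n : ℕ) : ∃ C : ℝ, 0 ≤ C ∧ ∀ ω : Fin 2 → ℝ,
    ‖((refinableSymbol (n + 1) ω : ℝ) : ℂ)‖ ≤ C / (1 + (|ω 0| + |ω 1|)) ^ (2 * (2 + n / 3)) := by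
  obtain ⟨C, hC, h⟩ := exists_refinableSymbol_le n
  refine ⟨C, hC, fun ω => ?_⟩
  rw [Complex.norm_real, Real.norm_of_nonneg (refinableSymbol_nonneg _ _)]
  exact h ω

lemma exists_genFreq_decay (n : ℕ) (hM : M = quincunxM ∨ M = quincunxN) (β : Mask 2) :
    ∃ C : ℝ, 0 ≤ C ∧ ∀ ω : Fin 2 → ℝ,
      ‖symbol β ((toReal M).transpose⁻¹.mulVec ω) *
        (refinableSymbol (n + 1) ((toReal M).transpose⁻¹.mulVec ω) : ℝ)‖ ≤
          C / (1 + (|ω 0| + |ω 1|)) ^ (2 * (2 + n / 3)) := by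
  obtain ⟨C, hC, h⟩ := exists_refFreq_decay n
  generalize 2 * (2 + n / 3) = p at h ⊢
  set B := β.sum fun _ c => ‖c‖
  have hB : 0 ≤ B := Finset.sum_nonneg fun _ _ => norm_nonneg _
  refine ⟨B * (C * 2 ^ p), by positivity, fun ω => ?_⟩
  rw [norm_mul, mul_div_assoc]
  refine mul_le_mul (norm_symbol_le β _) ((h _).trans ?_) (norm_nonneg _) hB
  set v := (toReal M).transpose⁻¹.mulVec ω
  have hv : (|ω 0| + |ω 1|) / 2 ≤ |v 0| + |v 1| := by
    have e0 := abs_add_le ((ω 0 + ω 1) / 2) ((ω 0 - ω 1) / 2)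
    have e1 := abs_sub ((ω 0 + ω 1) / 2) ((ω 0 - ω 1) / 2)
    rw [show (ω 0 + ω 1) / 2 + (ω 0 - ω 1) / 2 = ω 0 by ring] at e0
    rw [show (ω 0 + ω 1) / 2 - (ω 0 - ω 1) / 2 = ω 1 by ring] at e1
    rcases sameAbs_transpose_inv_mulVec hM ω with ⟨h0, h1⟩ | ⟨h0, h1⟩ <;>
    · simp only [Matrix.cons_val_zero, Matrix.cons_val_one] at h0 h1
      rw [h0, h1]
      linarith
  rw [div_le_div_iff₀ (by positivity) (by positivity), mul_assoc, ← mul_pow]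
  gcongr
  linarith

lemma measurable_refFreq (hn : 1 ≤ n) : Measurable (refFreq n) := by
  have := measurable_refinableSymbol hn
  unfold refFreq
  fun_prop

lemma measurable_genFreq (hn : 1 ≤ n) (M : Matrix (Fin 2) (Fin 2) ℤ) (β : Mask 2) :
    Measurable (genFreq M n β) := by
  have h1 := measurable_refinableSymbol hn
  have h2 := continuous_symbol β
  have h3 : Continuous fun ξ : E 2 =>
      (toReal M).transpose⁻¹.mulVec fun i => 2 * Real.pi * ξ i :=
    Continuous.matrix_mulVec continuous_const (by fun_prop)
  exact (h2.comp h3).measurable.mul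
    (Complex.measurable_ofReal.comp (h1.comp h3.measurable))

lemma integrable_memLp_refFreq (hn : 1 ≤ n) : Integrable (refFreq n) ∧ MemLp (refFreq n) 2 := by
  obtain ⟨n, rfl⟩ : ∃ m, n = m + 1 := ⟨n - 1, by omega⟩
  obtain ⟨C, -, h⟩ := exists_refFreq_decay n
  exact integrable_and_memLp_of_decay (measurable_refFreq hn).aestronglyMeasurable
    (by omega) fun ξ => h _

lemma integrable_memLp_genFreq (hn : 1 ≤ n) (hM : M = quincunxM ∨ M = quincunxN) (β : Mask 2) :
    Integrable (genFreq M n β) ∧ MemLp (genFreq M n β) 2 := by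
  obtain ⟨n, rfl⟩ : ∃ m, n = m + 1 := ⟨n - 1, by omega⟩
  obtain ⟨C, -, h⟩ := exists_genFreq_decay n hM β
  exact integrable_and_memLp_of_decay (measurable_genFreq hn M β).aestronglyMeasurable
    (by omega) fun ξ => h _

lemma det_toReal_quincunx (hM : M = quincunxM ∨ M = quincunxN) : |(toReal M).det| = 2 := by
  rcases hM with rfl | rfl <;> simp [toReal, quincunxM, quincunxN, Matrix.det_fin_two] <;> norm_num

lemma det_toReal_quincunx_ne_zero (hM : M = quincunxM ∨ M = quincunxN) : (toReal M).det ≠ 0 := by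
  intro h
  have := det_toReal_quincunx hM
  simp [h] at this

lemma det_quincunx (hM : M = quincunxM ∨ M = quincunxN) : |M.det| = 2 := by
  rcases hM with rfl | rfl
  exacts [quincunxM_det, quincunxN_det]

lemma mulVec_two_pi (A : Matrix (Fin 2) (Fin 2) ℝ) (ξ : E 2) :
    (A.mulVec fun i => 2 * Real.pi * ξ i) =
      fun i => 2 * Real.pi * Matrix.toEuclideanLin A ξ i := by
  funext i
  simp only [Matrix.toLpLin_apply, Matrix.mulVec, dotProduct, Finset.mul_sum]
  exact Finset.sum_congr rfl fun j _ => by ring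

/-- The inverse Fourier transform of `genFreq`. -/
lemma fourierInv_genFreq (hn : 1 ≤ n) (hM : M = quincunxM ∨ M = quincunxN) (β : Mask 2) (x : E 2) :
    𝓕⁻ (genFreq M n β) x = genFun M n β x := by
  have hdet := det_toReal_quincunx_ne_zero hM
  have hd : ((toReal M).transpose⁻¹).det ≠ 0 := by
    rw [Matrix.det_nonsing_inv, Matrix.det_transpose, Ring.inverse_eq_inv']
    exact inv_ne_zero hdet
  have hterm := fun k : Fin 2 → ℤ => fourierInv_dilate (toReal M) hdet k (refFreq n) x
  have hG := integrable_comp_toEuclideanLin _ hd (integrable_memLp_refFreq hn).1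
  have hint : ∀ k : Fin 2 → ℤ, Integrable fun ξ : E 2 =>
      Complex.exp ((2 * Real.pi * inner ℝ ξ x : ℝ) * Complex.I) •
        (Complex.exp (-(Complex.I * (dotR k (fun i => 2 * Real.pi *
        Matrix.toEuclideanLin (toReal M).transpose⁻¹ ξ i) : ℂ))) *
          refFreq n (Matrix.toEuclideanLin (toReal M).transpose⁻¹ ξ)) := by
    intro k
    have hc := continuous_toEuclideanLin (toReal M).transpose⁻¹
    simp only [smul_eq_mul, ← mul_assoc]
    refine hG.bdd_mul (c := 1) (Continuous.aestronglyMeasurable ?_) (.of_forall fun ξ => ?_)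
    · unfold dotR
      fun_prop
    · rw [norm_mul, norm_exp_neg_I_mul, Complex.norm_exp_ofReal_mul_I, mul_one]
  rw [Real.fourierInv_eq']
  simp only [Real.fourierInv_eq'] at hterm
  unfold genFun Finsupp.sum
  rw [Finset.mul_sum]
  have hsum : ∀ ξ : E 2, Complex.exp ((2 * Real.pi * inner ℝ ξ x : ℝ) * Complex.I) •
      genFreq M n β ξ = ∑ k ∈ β.support, β k *
        (Complex.exp ((2 * Real.pi * inner ℝ ξ x : ℝ) * Complex.I) •
        (Complex.exp (-(Complex.I * (dotR k (fun i => 2 * Real.pi *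
        Matrix.toEuclideanLin (toReal M).transpose⁻¹ ξ i) : ℂ))) *
          refFreq n (Matrix.toEuclideanLin (toReal M).transpose⁻¹ ξ))) := by
    intro ξ
    simp only [genFreq, refFreq, mulVec_two_pi, symbol, Finsupp.sum, smul_eq_mul, Finset.sum_mul,
      Finset.mul_sum]
    exact Finset.sum_congr rfl fun k _ => by ring
  simp only [hsum]
  rw [integral_finsetSum _ fun k _ => (hint k).const_mul _]
  refine Finset.sum_congr rfl fun k _ => ?_
  rw [integral_const_mul, hterm k, det_toReal_quincunx hM, refFun, Real.fourierInv_eq',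
    Complex.real_smul]
  push_cast
  ring

/-- The refinement equation. -/
lemma genFreq_tensor (hn : 1 ≤ n) (hM : M = quincunxM ∨ M = quincunxN) :
    genFreq M n (tensor (interpMask n) (interpMask n)) = refFreq n := by
  funext ξ
  exact symbol_mul_refinableSymbol hn hM _

/-- The refinable function as an element of `L_2(ℝ²)`. -/
def refL2 (hn : 1 ≤ n) : L2 2 := 𝓕⁻ (integrable_memLp_refFreq hn).2.toLp

/-- The function generated by the filter `β` as an element of `L_2(ℝ²)`. -/
def genL2 (hn : 1 ≤ n) (hM : M = quincunxM ∨ M = quincunxN) (β : Mask 2) : L2 2 :=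
  𝓕⁻ (integrable_memLp_genFreq hn hM β).2.toLp

lemma refL2_ae (hn : 1 ≤ n) : refL2 hn =ᵐ[volume] refFun n :=
  fourierInv_toLp_ae (integrable_memLp_refFreq hn).1 (integrable_memLp_refFreq hn).2

lemma genL2_ae (hn : 1 ≤ n) (hM : M = quincunxM ∨ M = quincunxN) (β : Mask 2) :
    genL2 hn hM β =ᵐ[volume] genFun M n β := by
  refine (fourierInv_toLp_ae (integrable_memLp_genFreq hn hM β).1
    (integrable_memLp_genFreq hn hM β).2).trans (.of_forall fun x => ?_)
  exact fourierInv_genFreq hn hM β x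

lemma genL2_tensor (hn : 1 ≤ n) (hM : M = quincunxM ∨ M = quincunxN) :
    genL2 hn hM (tensor (interpMask n) (interpMask n)) = refL2 hn := by
  unfold genL2 refL2
  congr 2
  exact genFreq_tensor hn hM

lemma isGenerated (hn : 1 ≤ n) (hM : M = quincunxM ∨ M = quincunxN) {ι : Type} (β : ι → Mask 2) :
    IsGenerated M (tensor (interpMask n) (interpMask n)) β (refL2 hn)
      fun l => genL2 hn hM (β l) := by
  refine ⟨fun ω => (refinableSymbol n ω : ℝ), isRefinableProduct_refinableSymbol hn hM, ?_,
    fun l => ?_⟩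
  · unfold HasFourier refL2
    rw [FourierTransform.fourier_fourierInv_eq]
    exact (integrable_memLp_refFreq hn).2.coeFn_toLp
  · unfold HasFourier genL2
    rw [FourierTransform.fourier_fourierInv_eq]
    exact (integrable_memLp_genFreq hn hM (β l)).2.coeFn_toLp

/-- Any functions generated by the filters built on `a^I_{2(n+1)}` have a smoothness exponent that
grows linearly in `n`. -/
lemma le_funSm_of_isGenerated (hM : M = quincunxM ∨ M = quincunxN) {ι : Type} {β : ι → Mask 2}
    {φ : L2 2} {ψ : ι → L2 2} {τ : ℝ} (h0 : 0 ≤ τ) (hτ : 3 * τ ≤ n)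
    (h : IsGenerated M (tensor (interpMask (n + 1)) (interpMask (n + 1))) β φ ψ) :
    (τ : EReal) ≤ funSm φ ∧ ∀ l, (τ : EReal) ≤ funSm (ψ l) := by
  obtain ⟨Φ, hΦ, hφ, hψ⟩ := h
  have hΦ' : Φ = fun ω => ((refinableSymbol (n + 1) ω : ℝ) : ℂ) := by
    funext ω
    exact tendsto_nhds_unique (hΦ ω) (isRefinableProduct_refinableSymbol (by omega) hM ω)
  have hp : τ + 1 < (2 * (2 + n / 3) : ℕ) := by
    have h1 : n < 3 * (n / 3) + 3 := by omega
    have h2 : (n : ℝ) < 3 * ((n / 3 : ℕ) : ℝ) + 3 := by exact_mod_cast h1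
    push_cast
    have h3 : (0 : ℝ) ≤ ((n / 3 : ℕ) : ℝ) := by positivity
    linarith
  subst hΦ'
  constructor
  · obtain ⟨C, -, hC⟩ := exists_refFreq_decay n
    exact le_funSm_of_decay hφ hC h0 hp
  · intro l
    obtain ⟨C, -, hC⟩ := exists_genFreq_decay n hM (β l)
    exact le_funSm_of_decay (hψ l) hC h0 hp

end Generated

/-! ### Symmetry of the generated functions -/

section Symmetry

variable {n : ℕ} {M : Matrix (Fin 2) (Fin 2) ℤ}

lemma dotR_zero_left {d : ℕ} (ω : Fin d → ℝ) : dotR 0 ω = 0 := by simp [dotR]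

/-- Invariance of `φ` under the orthogonal matrices that only exchange coordinates and change signs,
as these leave `φ̂` unchanged. -/
lemma refFun_toEuclideanLin {A : Matrix (Fin 2) (Fin 2) ℝ} (hA : A.transpose * A = 1)
    (hs : ∀ ω, SameAbs (A.mulVec ω) ω) (x : E 2) :
    refFun n (Matrix.toEuclideanLin A x) = refFun n x := by
  have hdet : A.det * A.det = 1 := by
    have := congrArg Matrix.det hA
    rwa [Matrix.det_mul, Matrix.det_transpose, Matrix.det_one] at this
  have h0 : A.det ≠ 0 := fun h => by simp [h] at hdet
  have habs : |A.det| = 1 := by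
    have : |A.det| ^ 2 = 1 := by rw [sq_abs, sq, hdet]
    exact (pow_eq_one_iff_of_nonneg (abs_nonneg _) two_ne_zero).1 this
  have hinv : A.transpose⁻¹ = A := Matrix.inv_eq_right_inv hA
  have h := fourierInv_dilate A h0 0 (refFreq n) x
  rw [habs, one_smul, affine_eq, hinv] at h
  have hG : ∀ ξ : E 2, refFreq n (Matrix.toEuclideanLin A ξ) = refFreq n ξ := by
    intro ξ
    unfold refFreq
    rw [← mulVec_two_pi, refinableSymbol_congr n (hs _)]
  simp only [dotR_zero_left, hG] at h
  simp only [Complex.ofReal_zero, mul_zero, neg_zero, Complex.exp_zero, one_mul] at h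
  unfold refFun
  have h2 : (WithLp.toLp 2 fun i => (((0 : Fin 2 → ℤ) i : ℤ) : ℝ) : E 2) = 0 := by
    ext i
    simp
  rw [h, h2, sub_zero]

lemma D4_transpose_mul {A : Matrix (Fin 2) (Fin 2) ℤ} (hA : A ∈ D4) :
    (toReal A).transpose * toReal A = 1 ∧ ∀ ω, SameAbs ((toReal A).mulVec ω) ω := by
  simp only [D4, Set.mem_insert_iff, Set.mem_singleton_iff] at hA
  constructor
  · rcases hA with rfl | rfl | rfl | rfl | rfl | rfl | rfl | rfl <;>
    · ext i j
      fin_cases i <;> fin_cases j <;> simp [toReal, Matrix.mul_apply]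
  · intro ω
    rcases hA with rfl | rfl | rfl | rfl | rfl | rfl | rfl | rfl <;>
      simp [SameAbs, toReal, Matrix.mulVec, dotProduct]

lemma det_ne_zero_of_transpose_mul {A : Matrix (Fin 2) (Fin 2) ℝ} (hA : A.transpose * A = 1) :
    A.det ≠ 0 := by
  have := congrArg Matrix.det hA
  rw [Matrix.det_mul, Matrix.det_transpose, Matrix.det_one] at this
  intro h
  simp [h] at this

lemma funD4Symmetric_refL2 (hn : 1 ≤ n) : FunD4Symmetric (refL2 hn) := by
  refine ⟨0, fun A hA => ?_⟩
  obtain ⟨h1, h2⟩ := D4_transpose_mul hA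
  have hq := quasiMeasurePreserving_moveAbout (toReal A) (det_ne_zero_of_transpose_mul h1) 0
  filter_upwards [refL2_ae hn, hq.ae (refL2_ae hn)] with x hx hx'
  rw [hx, hx', moveAbout_eq, sub_zero, add_zero, refFun_toEuclideanLin h1 h2]

/-- Conjugation by a quincunx matrix turns the elements of `D4minus` into diagonal sign
matrices. -/
lemma exists_diagonal_of_mem_D4minus (hM : M = quincunxM ∨ M = quincunxN)
    {A : Matrix (Fin 2) (Fin 2) ℤ} (hA : A ∈ D4minus) :
    ∃ s : Fin 2 → ℤˣ, M * A = Matrix.diagonal (fun i => ((s i : ℤˣ) : ℤ)) * M := by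
  simp only [D4minus, Set.mem_insert_iff, Set.mem_singleton_iff] at hA
  rcases hM with rfl | rfl <;> rcases hA with rfl | rfl | rfl | rfl
  · exact ⟨![1, 1], by decide⟩
  · exact ⟨![-1, -1], by decide⟩
  · exact ⟨![1, -1], by decide⟩
  · exact ⟨![-1, 1], by decide⟩
  · exact ⟨![1, 1], by decide⟩
  · exact ⟨![-1, -1], by decide⟩
  · exact ⟨![-1, 1], by decide⟩
  · exact ⟨![1, -1], by decide⟩

/-- The reflections of the integer lattice about the centre of symmetry of a filter, in an arbitrary
set of coordinates. -/
lemma HasSymmetry.exists_involution {β : Mask 2} (h : HasSymmetry β) :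
    ∃ c : Fin 2 → ℤ, ∀ s : Fin 2 → ℤˣ, ∃ ε : ℤˣ, ∃ σ : (Fin 2 → ℤ) → (Fin 2 → ℤ),
      (∀ k, σ (σ k) = k) ∧ (∀ k, β (σ k) = ((ε : ℤ) : ℂ) * β k) ∧
      ∀ k i, (2 * σ k i - c i : ℤ) = (s i : ℤ) * (2 * k i - c i) := by
  obtain ⟨c, ε, hc⟩ := h
  refine ⟨c, fun s => ?_⟩
  have hstep : ∀ i : Fin 2, ∃ δ : ℤˣ, ∃ σ : (Fin 2 → ℤ) → (Fin 2 → ℤ),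
      (∀ k, β (σ k) = ((δ : ℤ) : ℂ) * β k) ∧ (∀ k, 2 * σ k i - c i = (s i : ℤ) * (2 * k i - c i)) ∧
      ∀ k j, j ≠ i → σ k j = k j := by
    intro i
    rcases Int.units_eq_one_or (s i) with h | h
    · exact ⟨1, id, by simp, by simp [h], by simp⟩
    · refine ⟨ε i, fun k => Function.update k i (c i - k i), fun k => hc k i, fun k => ?_,
        fun k j hj => by simp [hj]⟩
      simp only [h, Function.update_self]
      push_cast
      ring
  obtain ⟨δ₀, σ₀, h01, h02, h03⟩ := hstep 0
  obtain ⟨δ₁, σ₁, h11, h12, h13⟩ := hstep 1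
  have hfin : ∀ k i, (2 * σ₁ (σ₀ k) i - c i : ℤ) = (s i : ℤ) * (2 * k i - c i) := by
    intro k i
    fin_cases i
    · have := h13 (σ₀ k) 0 (by decide)
      simp only [Fin.zero_eta, Fin.isValue, this, h02]
    · have := h03 k 1 (by decide)
      simp only [Fin.mk_one, Fin.isValue, h12, this]
  refine ⟨δ₁ * δ₀, fun k => σ₁ (σ₀ k), fun k => ?_, fun k => ?_, hfin⟩
  · funext i
    have e := hfin (σ₁ (σ₀ k)) i
    rw [hfin k i, ← mul_assoc] at e
    have hs : ((s i : ℤˣ) : ℤ) * ((s i : ℤˣ) : ℤ) = 1 := by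
      rcases Int.units_eq_one_or (s i) with h | h <;> simp [h]
    rw [hs, one_mul] at e
    linarith
  · rw [h11, h01]
    push_cast
    ring

lemma diagonal_units_transpose_mul (s : Fin 2 → ℤˣ) :
    (Matrix.diagonal fun i => (((s i : ℤˣ) : ℤ) : ℝ)).transpose *
      (Matrix.diagonal fun i => (((s i : ℤˣ) : ℤ) : ℝ)) = 1 := by
  rw [Matrix.diagonal_transpose, Matrix.diagonal_mul_diagonal, ← Matrix.diagonal_one]
  congr 1
  funext i
  rcases Int.units_eq_one_or (s i) with h | h <;> simp [h]

lemma sameAbs_diagonal_units (s : Fin 2 → ℤˣ) (ω : Fin 2 → ℝ) :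
    SameAbs ((Matrix.diagonal fun i => (((s i : ℤˣ) : ℤ) : ℝ)).mulVec ω) ω := by
  refine Or.inl ⟨?_, ?_⟩ <;> rw [Matrix.mulVec_diagonal, abs_mul]
  · rcases Int.units_eq_one_or (s 0) with h | h <;> simp [h]
  · rcases Int.units_eq_one_or (s 1) with h | h <;> simp [h]

/-- If `A` is one of the four matrices, then `M A = D M` with a diagonal sign matrix `D`. The filter
is symmetric under `D` and `φ` is invariant under `D`, so `ψ` is symmetric under `A`. -/
lemma funSymmetric_genL2 (hn : 1 ≤ n) (hM : M = quincunxM ∨ M = quincunxN) {β : Mask 2}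
    (hβ : HasSymmetry β) : FunSymmetric (genL2 hn hM β) := by
  obtain ⟨c, hc⟩ := hβ.exists_involution
  have hdet := det_toReal_quincunx_ne_zero hM
  -- the centre of `ψ` is `M⁻¹ c / 2`
  set x₀ : E 2 := Matrix.toEuclideanLin (toReal M)⁻¹ (WithLp.toLp 2 fun i => (c i : ℝ) / 2) with hx₀
  have hMx₀ : Matrix.toEuclideanLin (toReal M) x₀ = WithLp.toLp 2 fun i => (c i : ℝ) / 2 := by
    simp only [hx₀, Matrix.toLpLin_apply, Matrix.mulVec_mulVec]
    rw [Matrix.mul_nonsing_inv _ hdet.isUnit, Matrix.one_mulVec]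
  refine ⟨x₀, fun A hA => ?_⟩
  obtain ⟨s, hs⟩ := exists_diagonal_of_mem_D4minus hM hA
  obtain ⟨ε, σ, hσ, hβσ, hσs⟩ := hc s
  refine ⟨ε, ?_⟩
  set D : Matrix (Fin 2) (Fin 2) ℝ := Matrix.diagonal fun i => (((s i : ℤˣ) : ℤ) : ℝ) with hD
  have hMA : toReal M * toReal A = D * toReal M := by
    have h1 : toReal (M * A) = toReal M * toReal A := by
      ext i j; simp [toReal, Matrix.mul_apply]
    have h2 : toReal (Matrix.diagonal (fun i => ((s i : ℤˣ) : ℤ)) * M) = D * toReal M := by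
      ext i j; simp [toReal, D, Matrix.diagonal_mul]
    rw [← h1, hs, h2]
  have hA4 : A ∈ D4 := by
    simp only [D4minus, D4, Set.mem_insert_iff, Set.mem_singleton_iff] at hA ⊢
    tauto
  have hq := quasiMeasurePreserving_moveAbout (toReal A)
    (det_ne_zero_of_transpose_mul (D4_transpose_mul hA4).1) x₀
  filter_upwards [genL2_ae hn hM β, hq.ae (genL2_ae hn hM β)] with x hx hx'
  rw [hx, hx']
  have hpt : ∀ k, affine (toReal M) k (moveAbout (toReal A) x₀ x) =
      Matrix.toEuclideanLin D (affine (toReal M) (σ k) x) := by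
    intro k
    have e1 : Matrix.toEuclideanLin (toReal M) (Matrix.toEuclideanLin (toReal A) (x - x₀)) =
        Matrix.toEuclideanLin D (Matrix.toEuclideanLin (toReal M) (x - x₀)) := by
      simp only [Matrix.toLpLin_apply, Matrix.mulVec_mulVec, hMA]
    rw [affine_eq, affine_eq, moveAbout_eq, map_add, e1, map_sub (Matrix.toEuclideanLin (toReal M)),
      hMx₀]
    ext i
    have h2 : (2 * (σ k i : ℝ) - c i) = ((s i : ℤ) : ℝ) * (2 * k i - c i) := by
      exact_mod_cast hσs k i
    have h3 : (((s i : ℤˣ) : ℤ) : ℝ) * (((s i : ℤˣ) : ℤ) : ℝ) = 1 := by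
      rcases Int.units_eq_one_or (s i) with h | h <;> simp [h]
    simp only [Matrix.toLpLin_apply, hD, PiLp.add_apply, PiLp.sub_apply, Matrix.mulVec_diagonal,
      WithLp.ofLp_sub, Pi.sub_apply]
    linear_combination (((s i : ℤ) : ℝ) / 2) * h2 + ((k i : ℝ) - c i / 2) * h3
  unfold genFun
  simp only [hpt]
  rw [mul_left_comm]
  congr 1
  have hsupp : ∀ k, k ∈ β.support → σ k ∈ β.support := by
    intro k hk
    rw [Finsupp.mem_support_iff] at hk ⊢
    rw [hβσ]
    refine mul_ne_zero ?_ hk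
    rcases Int.units_eq_one_or ε with h | h <;> simp [h]
  unfold Finsupp.sum
  rw [Finset.mul_sum]
  refine Finset.sum_bij' (fun k _ => σ k) (fun k _ => σ k) hsupp hsupp (fun k _ => hσ k)
    (fun k _ => hσ k) fun k _ => ?_
  have hε : ((ε : ℤ) : ℂ) * ((ε : ℤ) : ℂ) = 1 := by
    rcases Int.units_eq_one_or ε with h | h <;> simp [h]
  change β k * refFun n (Matrix.toEuclideanLin D (affine (toReal M) (σ k) x)) = _
  rw [refFun_toEuclideanLin (diagonal_units_transpose_mul s) (sameAbs_diagonal_units s),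
    hβσ, ← mul_assoc, ← mul_assoc, hε, one_mul]

end Symmetry

/-! ### Compact support of the refinable function -/

section CompactSupport

variable {n : ℕ}

/-- `F` is a finite linear combination of the exponentials `ξ ↦ e^{-2πi⟨v, ξ⟩}` with
`‖v‖ ≤ r`. -/
def IsExpSum (r : ℝ) (F : E 2 → ℂ) : Prop :=
  ∃ (ι : Type) (_ : Fintype ι) (c : ι → ℂ) (v : ι → E 2), (∀ i, ‖v i‖ ≤ r) ∧
    ∀ ξ, F ξ = ∑ i, c i * Complex.exp (-(2 * Real.pi * inner ℝ ξ (v i) : ℝ) * Complex.I)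

lemma IsExpSum.mono {r r' : ℝ} {F : E 2 → ℂ} (h : IsExpSum r F) (hr : r ≤ r') : IsExpSum r' F := by
  obtain ⟨ι, _, c, v, hv, hF⟩ := h
  exact ⟨ι, _, c, v, fun i => (hv i).trans hr, hF⟩

lemma isExpSum_one : IsExpSum 0 fun _ => 1 :=
  ⟨Unit, inferInstance, fun _ => 1, fun _ => 0, by simp, by simp⟩

lemma IsExpSum.mul {r r' : ℝ} {F G : E 2 → ℂ} (hF : IsExpSum r F) (hG : IsExpSum r' G) :
    IsExpSum (r + r') fun ξ => F ξ * G ξ := by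
  obtain ⟨ι, _, c, v, hv, hF⟩ := hF
  obtain ⟨κ, _, d, w, hw, hG⟩ := hG
  refine ⟨ι × κ, inferInstance, fun p => c p.1 * d p.2, fun p => v p.1 + w p.2, fun p => ?_,
    fun ξ => ?_⟩
  · exact (norm_add_le _ _).trans (add_le_add (hv _) (hw _))
  · beta_reduce
    rw [hF, hG, Finset.sum_mul_sum, Fintype.sum_prod_type]
    refine Finset.sum_congr rfl fun i _ => Finset.sum_congr rfl fun j _ => ?_
    rw [mul_mul_mul_comm, ← Complex.exp_add, inner_add_right]
    congr 2
    push_cast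
    ring

lemma exists_isExpSum_interpSymbol (n : ℕ) : ∃ K : ℝ, 0 ≤ K ∧ ∀ w : E 2,
    IsExpSum (K * ‖w‖) fun ξ => (interpSymbol n (2 * Real.pi * inner ℝ ξ w) : ℂ) := by
  set u := interpMask n
  refine ⟨∑ k ∈ u.support, |(k 0 : ℝ)|, Finset.sum_nonneg fun _ _ => abs_nonneg _, fun w => ?_⟩
  refine ⟨u.support, inferInstance, fun k => u k, fun k => (k.1 0 : ℝ) • w, fun k => ?_,
    fun ξ => ?_⟩
  · rw [norm_smul]
    gcongr
    exact Finset.single_le_sum (f := fun k : Fin 1 → ℤ => |(k 0 : ℝ)|)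
      (fun _ _ => abs_nonneg _) k.2
  · have h := symbol_interpMask_eq n ![2 * Real.pi * inner ℝ ξ w]
    simp only [Matrix.cons_val_zero] at h
    beta_reduce
    rw [← h, symbol, Finsupp.sum, ← Finset.sum_coe_sort]
    refine Finset.sum_congr rfl fun k _ => ?_
    congr 2
    simp only [dotR, inner_smul_right, Finset.univ_unique, Fin.default_eq_zero, Finset.sum_singleton,
      Matrix.cons_val_zero]
    push_cast
    ring

/-- The frequencies of the factors form a geometric series, so those of the products stay
bounded. -/
lemma exists_isExpSum_partialProd (n : ℕ) : ∃ K : ℝ, 0 ≤ K ∧ ∀ (J : ℕ) (w : E 2),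
    IsExpSum (K * ‖w‖) fun ξ => (partialProd n J (2 * Real.pi * inner ℝ ξ w) : ℂ) := by
  obtain ⟨K, hK, h⟩ := exists_isExpSum_interpSymbol n
  refine ⟨K, hK, fun J w => ?_⟩
  have key : IsExpSum (K * ‖w‖ * (1 - 1 / 2 ^ J))
      fun ξ => (partialProd n J (2 * Real.pi * inner ℝ ξ w) : ℂ) := by
    induction J with
    | zero => simpa [partialProd] using isExpSum_one
    | succ J ih =>
      have h1 := ih.mul (h ((1 / 2 ^ (J + 1) : ℝ) • w))
      have e : K * ‖w‖ * (1 - 1 / 2 ^ J) + K * ‖(1 / 2 ^ (J + 1) : ℝ) • w‖ =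
          K * ‖w‖ * (1 - 1 / 2 ^ (J + 1)) := by
        rw [norm_smul, Real.norm_of_nonneg (by positivity), pow_succ]
        field_simp
        ring
      rw [e] at h1
      convert! h1 using 2 with ξ
      rw [partialProd_succ, inner_smul_right, Complex.ofReal_mul]
      congr 3
      field_simp
  refine key.mono (mul_le_of_le_one_right (by positivity) ?_)
  have : (0 : ℝ) ≤ 1 / 2 ^ J := by positivity
  linarith

open SchwartzMap in
/-- The integral of `𝓕⁻ t` against the exponentials gives values of `t` at the frequencies, which
vanish. -/
lemma IsExpSum.integral_eq_zero {r : ℝ} {F : E 2 → ℂ} (hF : IsExpSum r F) {t : 𝓢(E 2, ℂ)}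
    (ht : ∀ x, ‖x‖ ≤ r → t x = 0) : ∫ ξ, 𝓕⁻ t ξ * F ξ = 0 := by
  obtain ⟨ι, _, c, v, hv, hF⟩ := hF
  simp only [hF, Finset.mul_sum]
  have hi : ∀ i, Integrable fun ξ : E 2 => 𝓕⁻ t ξ *
      (c i * Complex.exp (-(2 * Real.pi * inner ℝ ξ (v i) : ℝ) * Complex.I)) := by
    intro i
    refine (SchwartzMap.integrable (μ := volume) (𝓕⁻ t)).mul_bdd (c := ‖c i‖)
      (Continuous.aestronglyMeasurable (by fun_prop)) (.of_forall fun ξ => ?_)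
    rw [norm_mul, ← Complex.ofReal_neg, Complex.norm_exp_ofReal_mul_I, mul_one]
  rw [integral_finsetSum _ fun i _ => hi i]
  refine Finset.sum_eq_zero fun i _ => ?_
  have h1 : 𝓕 (𝓕⁻ t) (v i) = 0 := by
    rw [FourierTransform.fourier_fourierInv_eq]
    exact ht _ (hv i)
  rw [SchwartzMap.fourier_coe, Real.fourier_eq'] at h1
  calc _ = c i * ∫ ξ, Complex.exp ((-2 * Real.pi * inner ℝ ξ (v i) : ℝ) * Complex.I) •
        (𝓕⁻ t) ξ := by
        rw [← integral_const_mul]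
        congr 1
        funext ξ
        rw [smul_eq_mul, mul_left_comm]
        congr 1
        rw [mul_comm]
        congr 3
        push_cast
        ring
    _ = 0 := by rw [h1, mul_zero]

/-- The refinable function has compact support: the partial products of its Fourier transform are
exponential sums with frequencies in a fixed ball, so their pairings with a test function supported
outside that ball vanish, and so does the limit. -/
lemma exists_refFun_eq_zero (hn : 1 ≤ n) : ∃ R : ℝ, ∀ x : E 2, R < ‖x‖ → refFun n x = 0 := by
  obtain ⟨K, hK, h⟩ := exists_isExpSum_partialProd n
  set e₀ : E 2 := EuclideanSpace.single 0 1
  set e₁ : E 2 := EuclideanSpace.single 1 1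
  set R := K * ‖e₀‖ + K * ‖e₁‖ + (K * ‖e₀ + e₁‖ + K * ‖e₀ - e₁‖)
  have h0 : ∀ ξ : E 2, inner ℝ ξ e₀ = ξ 0 := fun ξ => by
    simp [e₀, EuclideanSpace.inner_single_right]
  have h1 : ∀ ξ : E 2, inner ℝ ξ e₁ = ξ 1 := fun ξ => by
    simp [e₁, EuclideanSpace.inner_single_right]
  set P : ℕ → E 2 → ℂ := fun J ξ =>
    (partialProd n J (2 * Real.pi * inner ℝ ξ e₀) : ℂ) *
      (partialProd n J (2 * Real.pi * inner ℝ ξ e₁) : ℂ) *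
    ((partialProd n J (2 * Real.pi * inner ℝ ξ (e₀ + e₁)) : ℂ) *
      (partialProd n J (2 * Real.pi * inner ℝ ξ (e₀ - e₁)) : ℂ)) with hP
  have hPexp : ∀ J, IsExpSum R (P J) := fun J =>
    ((h J e₀).mul (h J e₁)).mul ((h J (e₀ + e₁)).mul (h J (e₀ - e₁)))
  have hPlim : ∀ ξ, Tendsto (fun J => P J ξ) atTop (𝓝 (refFreq n ξ)) := by
    intro ξ
    have hT : ∀ y : ℝ, Tendsto (fun J => (partialProd n J y : ℂ)) atTop (𝓝 (infProd n y : ℂ)) :=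
      fun y => (Complex.continuous_ofReal.tendsto _).comp (tendsto_partialProd hn y)
    have := ((hT (2 * Real.pi * inner ℝ ξ e₀)).mul (hT (2 * Real.pi * inner ℝ ξ e₁))).mul
      ((hT (2 * Real.pi * inner ℝ ξ (e₀ + e₁))).mul (hT (2 * Real.pi * inner ℝ ξ (e₀ - e₁))))
    convert! this using 2
    simp only [refFreq, refinableSymbol, inner_add_right, inner_sub_right, h0, h1, mul_add, mul_sub]
    push_cast
    rfl
  have hPle : ∀ J ξ, ‖P J ξ‖ ≤ 1 := by
    intro J ξ
    have hb : ∀ y : ℝ, ‖(partialProd n J y : ℂ)‖ ≤ 1 := fun y => by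
      rw [Complex.norm_real, Real.norm_of_nonneg (partialProd_nonneg _ _ _)]
      exact partialProd_le_one hn J y
    simp only [hP, norm_mul]
    exact mul_le_one₀ (mul_le_one₀ (hb _) (norm_nonneg _) (hb _)) (by positivity)
      (mul_le_one₀ (hb _) (norm_nonneg _) (hb _))
  have hPc : ∀ J, Continuous (P J) := by
    intro J
    have := continuous_partialProd n J
    simp only [hP]
    fun_prop
  have hint := (integrable_memLp_refFreq hn).1
  have hcont : Continuous (refFun n) := continuous_fourierInv hint
  set U : Set (E 2) := (Metric.closedBall 0 R)ᶜ
  have hU : IsOpen U := Metric.isClosed_closedBall.isOpen_compl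
  have hae : ∀ᵐ x, x ∈ U → refFun n x = 0 := by
    refine hU.ae_eq_zero_of_integral_contDiff_smul_eq_zero
      (hcont.locallyIntegrable.locallyIntegrableOn _) ?_
    intro g hg hgc hgU
    have hc' : HasCompactSupport fun x => (g x : ℂ) := hgc.comp_left Complex.ofReal_zero
    have hg' : ContDiff ℝ ((⊤ : ℕ∞) : WithTop ℕ∞) fun x => (g x : ℂ) :=
      Complex.ofRealCLM.contDiff.comp hg
    set T := hc'.toSchwartzMap hg'
    have hT0 : ∀ x, ‖x‖ ≤ R → T x = 0 := by
      intro x hx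
      change (g x : ℂ) = 0
      rw [Complex.ofReal_eq_zero]
      by_contra hgx
      exact hgU (subset_tsupport g hgx) (by simpa using hx)
    have e1 : ∫ x, g x • refFun n x = ∫ ξ, 𝓕⁻ T ξ * refFreq n ξ := by
      rw [integral_fourierInv_schwartz_mul T hint]
      simp only [Complex.real_smul]
      rfl
    rw [e1]
    have hlim : Tendsto (fun J => ∫ ξ, 𝓕⁻ T ξ * P J ξ) atTop
        (𝓝 (∫ ξ, 𝓕⁻ T ξ * refFreq n ξ)) := by
      refine tendsto_integral_of_dominated_convergence (fun ξ => ‖𝓕⁻ T ξ‖)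
        (fun J => ?_) (SchwartzMap.integrable (μ := volume) (𝓕⁻ T)).norm (fun J => ?_) ?_
      · exact ((𝓕⁻ T).continuous.mul (hPc J)).aestronglyMeasurable
      · refine .of_forall fun ξ => ?_
        rw [norm_mul]
        exact mul_le_of_le_one_right (norm_nonneg _) (hPle J ξ)
      · exact .of_forall fun ξ => (hPlim ξ).const_mul _
    simp only [fun J => (hPexp J).integral_eq_zero hT0] at hlim
    exact (tendsto_nhds_unique tendsto_const_nhds hlim).symm
  refine ⟨R, fun x hx => ?_⟩
  have hEq : Set.EqOn (refFun n) 0 U :=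
    Measure.eqOn_open_of_ae_eq ((ae_restrict_iff' hU.measurableSet).2 hae) hU
      hcont.continuousOn continuousOn_const
  exact hEq (by simpa [U] using hx)

lemma continuous_refFun (hn : 1 ≤ n) : Continuous (refFun n) :=
  continuous_fourierInv (integrable_memLp_refFreq hn).1

lemma hasCompactSupport_refFun (hn : 1 ≤ n) : HasCompactSupport (refFun n) := by
  obtain ⟨R, hR⟩ := exists_refFun_eq_zero hn
  refine HasCompactSupport.intro (isCompact_closedBall (0 : E 2) R) fun x hx => hR x ?_
  simpa using hx

end CompactSupport

/-! ### Vanishing moments of the generated functions -/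

section Moments

variable {β : Mask 2} {m : ℕ}

lemma dotR_smul_right {d : ℕ} (k : Fin d → ℤ) (t : ℝ) (v : Fin d → ℝ) :
    dotR k (t • v) = t * dotR k v := by
  unfold dotR
  rw [Finset.mul_sum]
  exact Finset.sum_congr rfl fun i _ => by simp; ring

/-- Vanishing moments of a filter give discrete moment conditions for powers of linear forms, by
differentiating the symbol along a line. -/
lemma HasVanishingMoments.sum_dotR_pow {d : ℕ} {β : Mask d} (h : HasVanishingMoments β m)
    (v : Fin d → ℝ) {j : ℕ} (hj : j < m) :
    β.sum (fun k c => c * (dotR k v : ℂ) ^ j) = 0 := by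
  set f : ℝ → ℂ := fun t => ∑ k ∈ β.support,
    β k * Complex.exp ((t : ℂ) * (-(Complex.I * (dotR k v : ℂ)))) with hf
  have hfs : ∀ t, f t = symbol β (t • v) := by
    intro t
    simp only [hf, symbol, Finsupp.sum, dotR_smul_right]
    refine Finset.sum_congr rfl fun k _ => ?_
    congr 2
    push_cast
    ring
  have hfan : AnalyticAt ℝ f 0 := by
    rw [hf]
    refine Finset.analyticAt_fun_sum _ fun k _ => analyticAt_const.mul ?_
    have h2 : AnalyticAt ℝ (fun t : ℝ => (t : ℂ) * (-(Complex.I * (dotR k v : ℂ)))) 0 :=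
      (Complex.ofRealCLM.analyticAt 0).mul analyticAt_const
    exact (AnalyticAt.restrictScalars (𝕜 := ℝ) analyticAt_cexp).fun_comp h2
  have hO : f =O[𝓝 0] fun t => t ^ m := by
    have hT : Tendsto (fun t : ℝ => t • v) (𝓝 0) (𝓝 0) := by
      have : Continuous fun t : ℝ => t • v := by fun_prop
      simpa using this.tendsto 0
    have h1 := h.comp_tendsto hT
    have h2 : (f : ℝ → ℂ) = symbol β ∘ fun t : ℝ => t • v := funext hfs
    rw [h2]
    refine h1.trans (IsBigO.of_bound (‖v‖ ^ m) (.of_forall fun t => ?_))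
    simp only [Function.comp, norm_smul, norm_pow, norm_mul, norm_norm, mul_pow]
    rw [mul_comm]
  rw [isBigO_pow_iff_le_analyticOrderAt hfan,
    natCast_le_analyticOrderAt_iff_iteratedDeriv_eq_zero hfan] at hO
  have hD : ∀ i : ℕ, iteratedDeriv i f = fun t : ℝ => ∑ k ∈ β.support, β k *
      ((-(Complex.I * (dotR k v : ℂ))) ^ i *
        Complex.exp ((t : ℂ) * (-(Complex.I * (dotR k v : ℂ))))) := by
    intro i
    induction i with
    | zero => simp [hf]
    | succ i ih =>
      rw [iteratedDeriv_succ, ih]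
      funext t
      refine HasDerivAt.deriv (HasDerivAt.fun_sum fun k _ => ?_)
      have h1 : HasDerivAt (fun t : ℝ => (t : ℂ) * (-(Complex.I * (dotR k v : ℂ))))
          (-(Complex.I * (dotR k v : ℂ))) t := by
        simpa using (Complex.ofRealCLM.hasDerivAt (x := t)).mul_const (-(Complex.I * (dotR k v : ℂ)))
      have h2 := (h1.cexp.const_mul ((-(Complex.I * (dotR k v : ℂ))) ^ i)).const_mul (β k)
      convert! h2 using 1
      rw [pow_succ]
      ring
  have h0 := hO j hj
  rw [hD] at h0
  have hne : (-Complex.I) ^ j ≠ 0 := pow_ne_zero _ (neg_ne_zero.2 Complex.I_ne_zero)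
  refine (mul_eq_zero.1 ?_).resolve_left hne
  rw [← h0, Finsupp.sum, Finset.mul_sum]
  refine Finset.sum_congr rfl fun k _ => ?_
  rw [neg_mul_eq_neg_mul, mul_pow]
  simp
  ring

lemma HasVanishingMoments.sum_monomial (h : HasVanishingMoments β m) {a b : ℕ} (hab : a + b < m) :
    ∑ k ∈ β.support, β k * ((k 0 : ℂ) ^ a * (k 1 : ℂ) ^ b) = 0 := by
  -- the moments of degree `a + b` are the coefficients of a polynomial with infinitely many roots
  set q : Polynomial ℂ := ∑ i ∈ Finset.range (a + b + 1), Polynomial.C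
    (((a + b).choose i : ℂ) * ∑ k ∈ β.support, β k * ((k 1 : ℂ) ^ i * (k 0 : ℂ) ^ (a + b - i))) *
      Polynomial.X ^ i with hq
  have hroot : ∀ s : ℝ, q.eval (s : ℂ) = 0 := by
    intro s
    have h1 := h.sum_dotR_pow ![1, s] hab
    rw [← h1, hq, Polynomial.eval_finsetSum, Finsupp.sum]
    have hk : ∀ k : Fin 2 → ℤ, (dotR k ![1, s] : ℂ) = s * k 1 + k 0 := by
      intro k
      simp [dotR]
      ring
    simp only [hk, add_pow, Polynomial.eval_mul, Polynomial.eval_C, Polynomial.eval_pow,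
      Polynomial.eval_X, Finset.mul_sum, Finset.sum_mul]
    rw [Finset.sum_comm]
    refine Finset.sum_congr rfl fun k _ => Finset.sum_congr rfl fun i _ => ?_
    rw [mul_pow]
    ring
  have hq0 : q = 0 := by
    refine Polynomial.eq_zero_of_infinite_isRoot q (Set.Infinite.mono ?_
      (Set.infinite_range_of_injective Complex.ofReal_injective))
    rintro _ ⟨s, rfl⟩
    exact hroot s
  have hc := congrArg (fun p => Polynomial.coeff p b) hq0
  simp only [hq, Polynomial.finsetSum_coeff, Polynomial.coeff_C_mul_X_pow, Polynomial.coeff_zero,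
    Finset.sum_ite_eq, Finset.mem_range, show b < a + b + 1 by omega, if_true,
    Nat.add_sub_cancel] at hc
  have hch : ((a + b).choose b : ℂ) ≠ 0 := by
    exact_mod_cast (Nat.choose_pos (by omega)).ne'
  rw [← (mul_eq_zero.1 hc).resolve_left hch]
  exact Finset.sum_congr rfl fun k _ => by ring

/-- A filter with `m` vanishing moments annihilates the polynomials of degree less than `m`. -/
lemma HasVanishingMoments.sum_eval (h : HasVanishingMoments β m) (p : MvPolynomial (Fin 2) ℂ)
    (hp : p.totalDegree < m) :
    ∑ k ∈ β.support, β k * MvPolynomial.eval (fun i => (k i : ℂ)) p = 0 := by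
  simp only [MvPolynomial.eval_eq', Finset.mul_sum]
  rw [Finset.sum_comm]
  refine Finset.sum_eq_zero fun e he => ?_
  have hdeg : e 0 + e 1 < m := by
    have := (MvPolynomial.le_totalDegree he).trans_lt hp
    rwa [Finsupp.sum_fintype _ _ (by simp), Fin.sum_univ_two] at this
  have h1 := h.sum_monomial hdeg
  calc _ = p.coeff e * ∑ k ∈ β.support, β k * ((k 0 : ℂ) ^ e 0 * (k 1 : ℂ) ^ e 1) := by
        rw [Finset.mul_sum]
        refine Finset.sum_congr rfl fun k _ => ?_
        rw [Fin.prod_univ_two]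
        ring
    _ = 0 := by rw [h1, mul_zero]

/-- Discrete moment conditions for the polynomials `k ↦ (B (y + k))^μ`. -/
lemma HasVanishingMoments.sum_affine (h : HasVanishingMoments β m) (B : Matrix (Fin 2) (Fin 2) ℝ)
    (y : Fin 2 → ℝ) {μ : Fin 2 → ℕ} (hμ : ∑ i, μ i < m) :
    ∑ k ∈ β.support, β k * ((∏ i, B.mulVec (fun j => y j + (k j : ℝ)) i ^ μ i : ℝ) : ℂ) = 0 := by
  set p : MvPolynomial (Fin 2) ℂ := ∏ i, (∑ j, MvPolynomial.C (B i j : ℂ) *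
    (MvPolynomial.C (y j : ℂ) + MvPolynomial.X j)) ^ μ i with hp
  have hdeg : p.totalDegree < m := by
    refine lt_of_le_of_lt ((MvPolynomial.totalDegree_finsetProd _ _).trans
      (Finset.sum_le_sum fun i _ => ?_)) hμ
    refine (MvPolynomial.totalDegree_pow _ _).trans (mul_le_of_le_one_right (Nat.zero_le _) ?_)
    refine (MvPolynomial.totalDegree_finsetSum _ _).trans (Finset.sup_le fun j _ => ?_)
    refine (MvPolynomial.totalDegree_mul _ _).trans ?_
    rw [MvPolynomial.totalDegree_C, zero_add]
    refine (MvPolynomial.totalDegree_add _ _).trans ?_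
    rw [MvPolynomial.totalDegree_C, MvPolynomial.totalDegree_X]
    decide
  rw [← h.sum_eval p hdeg]
  refine Finset.sum_congr rfl fun k _ => ?_
  simp only [hp, map_prod, map_pow, map_sum, map_mul, map_add, MvPolynomial.eval_C,
    MvPolynomial.eval_X, Matrix.mulVec, dotProduct]
  push_cast
  rfl

lemma hasVanishingMoments_of_le_vm {d : ℕ} {β : Mask d} {m : ℕ} (h : (m : ℕ∞) ≤ vm β) :
    HasVanishingMoments β m := by
  obtain ⟨r, hr, hmr⟩ : ∃ r, HasVanishingMoments β r ∧ m ≤ r := by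
    rcases Nat.eq_zero_or_pos m with rfl | hm
    · refine ⟨0, ?_, le_rfl⟩
      unfold HasVanishingMoments
      simp only [pow_zero]
      exact ((continuous_symbol β).tendsto 0).isBigO_one ℝ
    · have hlt : ((m - 1 : ℕ) : ℕ∞) < vm β :=
        lt_of_lt_of_le (by exact_mod_cast Nat.sub_lt hm one_pos) h
      unfold vm at hlt
      simp only [lt_iSup_iff] at hlt
      obtain ⟨r, hr, hlt⟩ := hlt
      have : m - 1 < r := by exact_mod_cast hlt
      exact ⟨r, hr, by omega⟩
  refine IsBigO.trans hr ?_
  refine IsBigO.of_bound 1 ?_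
  filter_upwards [Metric.ball_mem_nhds (0 : Fin d → ℝ) one_pos] with ω hω
  rw [mem_ball_zero_iff] at hω
  rw [one_mul, norm_pow, norm_pow, norm_norm]
  exact pow_le_pow_of_le_one (norm_nonneg _) hω.le hmr

variable {n : ℕ} {M : Matrix (Fin 2) (Fin 2) ℤ}

/-- `∫ x^μ φ(M x - k) dx`, computed by the substitution `y = M x - k`. -/
lemma integral_moment_affine (hn : 1 ≤ n) (hM : M = quincunxM ∨ M = quincunxN)
    (k : Fin 2 → ℤ) (μ : Fin 2 → ℕ) :
    Integrable (fun x : E 2 => ((∏ i, x i ^ μ i : ℝ) : ℂ) * refFun n (affine (toReal M) k x)) ∧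
    Integrable (fun y : E 2 => ((∏ i, (toReal M)⁻¹.mulVec (fun j => y j + (k j : ℝ)) i ^ μ i : ℝ) : ℂ)
      * refFun n y) ∧
    ∫ x : E 2, ((∏ i, x i ^ μ i : ℝ) : ℂ) * refFun n (affine (toReal M) k x) =
      (1 / 2 : ℝ) • ∫ y : E 2, ((∏ i, (toReal M)⁻¹.mulVec (fun j => y j + (k j : ℝ)) i ^ μ i : ℝ) : ℂ)
        * refFun n y := by
  have hdet := det_toReal_quincunx_ne_zero hM
  set h : E 2 → ℂ := fun y =>
    ((∏ i, (toReal M)⁻¹.mulVec (fun j => y j + (k j : ℝ)) i ^ μ i : ℝ) : ℂ) * refFun n y with hh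
  have hpol : Continuous fun y : E 2 =>
      ((∏ i, (toReal M)⁻¹.mulVec (fun j => y j + (k j : ℝ)) i ^ μ i : ℝ) : ℂ) := by
    have : Continuous fun y : E 2 => (toReal M)⁻¹.mulVec (fun j => y j + (k j : ℝ)) :=
      Continuous.matrix_mulVec continuous_const (by fun_prop)
    have h2 : ∀ i, Continuous fun y : E 2 => (toReal M)⁻¹.mulVec (fun j => y j + (k j : ℝ)) i :=
      fun i => (continuous_apply i).comp this
    fun_prop
  have hint : Integrable h :=
    (hpol.mul (continuous_refFun hn)).integrable_of_hasCompactSupport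
      (hasCompactSupport_refFun hn).mul_left
  have hx : ∀ x : E 2, ((∏ i, x i ^ μ i : ℝ) : ℂ) * refFun n (affine (toReal M) k x) =
      h (Matrix.toEuclideanLin (toReal M) x - WithLp.toLp 2 fun i => (k i : ℝ)) := by
    intro x
    simp only [hh, affine_eq]
    congr 2
    have e : (fun j => (Matrix.toEuclideanLin (toReal M) x -
        WithLp.toLp 2 fun i => (k i : ℝ) : E 2) j + (k j : ℝ)) = (toReal M).mulVec x.ofLp := by
      funext j
      simp [Matrix.toLpLin_apply]
    rw [e, Matrix.mulVec_mulVec, Matrix.nonsing_inv_mul _ hdet.isUnit, Matrix.one_mulVec]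
  simp only [hx]
  refine ⟨integrable_comp_toEuclideanLin _ hdet (f := fun y =>
    h (y - WithLp.toLp 2 fun i => (k i : ℝ))) (hint.comp_sub_right _), hint, ?_⟩
  rw [integral_comp_toEuclideanLin _ hdet (fun y => h (y - WithLp.toLp 2 fun i => (k i : ℝ))),
    integral_sub_right_eq_self, abs_inv, det_toReal_quincunx hM, one_div]

/-- After the substitution `y = M x - k` the sum over `k` under the integral vanishes for
every `y`. -/
lemma funVanishingMoments_genL2 (hn : 1 ≤ n) (hM : M = quincunxM ∨ M = quincunxN)
    (h : HasVanishingMoments β m) : FunVanishingMoments (genL2 hn hM β) m := by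
  intro μ hμ
  have hae : (fun x : E 2 => ((∏ i, x i ^ μ i : ℝ) : ℂ) * genL2 hn hM β x) =ᵐ[volume]
      fun x => ∑ k ∈ β.support, (2 * β k) *
        (((∏ i, x i ^ μ i : ℝ) : ℂ) * refFun n (affine (toReal M) k x)) := by
    filter_upwards [genL2_ae hn hM β] with x hx
    rw [hx, genFun, Finsupp.sum, Finset.mul_sum, Finset.mul_sum]
    exact Finset.sum_congr rfl fun k _ => by ring
  have hI := fun k => integral_moment_affine hn hM k μ
  have hint := fun k : Fin 2 → ℤ => (hI k).1.const_mul (2 * β k)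
  refine ⟨(integrable_congr hae).2 (integrable_finsetSum _ fun k _ => hint k), ?_⟩
  rw [integral_congr_ae hae, integral_finsetSum _ fun k _ => hint k]
  simp only [integral_const_mul, (hI _).2.2]
  have h1 : ∀ k ∈ β.support, 2 * β k * ((1 / 2 : ℝ) •
      ∫ y : E 2, ((∏ i, (toReal M)⁻¹.mulVec (fun j => y j + (k j : ℝ)) i ^ μ i : ℝ) : ℂ)
        * refFun n y) =
      ∫ y : E 2, β k * (((∏ i, (toReal M)⁻¹.mulVec (fun j => y j + (k j : ℝ)) i ^ μ i : ℝ) : ℂ)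
        * refFun n y) := by
    intro k _
    rw [integral_const_mul, Complex.real_smul]
    push_cast
    ring
  rw [Finset.sum_congr rfl h1, ← integral_finsetSum _ fun k _ => (hI k).2.1.const_mul (β k)]
  refine integral_eq_zero_of_ae (.of_forall fun y => ?_)
  have h2 := h.sum_affine (toReal M)⁻¹ y.ofLp hμ
  simp only [← mul_assoc, ← Finset.sum_mul, h2, zero_mul, Pi.zero_apply]

end Moments

/-! ### The discrete unitary extension principle -/

section DiscreteUEP

lemma conjMask_apply {d : ℕ} (u : Mask d) (n : Fin d → ℤ) : conjMask u n = conj (u (-n)) := by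
  unfold conjMask Finsupp.sum
  rw [Finsupp.finsetSum_apply]
  simp only [Finsupp.single_apply, neg_eq_iff_eq_neg]
  rw [Finset.sum_ite_eq']
  split_ifs with h
  · rfl
  · rw [Finsupp.notMem_support_iff.1 h, map_zero]

/-- The filter `k ↦ (-1)^{k_1 + ⋯ + k_d} u(k)`. -/
def modMask {d : ℕ} (u : Mask d) : Mask d :=
  u.sum fun k α => Finsupp.single k ((-1 : ℂ) ^ (∑ i, k i) * α)

lemma modMask_apply {d : ℕ} (u : Mask d) (n : Fin d → ℤ) :
    modMask u n = (-1 : ℂ) ^ (∑ i, n i) * u n := by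
  unfold modMask Finsupp.sum
  rw [Finsupp.finsetSum_apply]
  simp only [Finsupp.single_apply]
  rw [Finset.sum_ite_eq']
  split_ifs with h
  · rfl
  · rw [Finsupp.notMem_support_iff.1 h, mul_zero]

lemma symbol_modMask {d : ℕ} (u : Mask d) (ω : Fin d → ℝ) :
    symbol (modMask u) ω = symbol u (shiftPi ω) := by
  unfold modMask Finsupp.sum
  simp only [symbol_sum, symbol_single]
  unfold symbol Finsupp.sum
  refine Finset.sum_congr rfl fun k _ => ?_
  have h : Complex.exp (-(Complex.I * (dotR k (shiftPi ω) : ℂ))) =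
      (-1 : ℂ) ^ (∑ i, k i) * Complex.exp (-(Complex.I * (dotR k ω : ℂ))) := by
    have h1 : ((-1 : ℂ) ^ (∑ i, k i)) = ((-1 : ℂ) ^ (-∑ i, k i)) := by
      rw [zpow_neg, ← inv_zpow]; norm_num
    rw [h1, ← Complex.exp_pi_mul_I, ← Complex.exp_int_mul, ← Complex.exp_add]
    congr 1
    simp only [dotR, shiftPi, mul_add, Finset.sum_add_distrib, ← Finset.sum_mul]
    push_cast
    ring
  beta_reduce
  rw [h]
  ring

variable {ι : Type} [Fintype ι] {β : ι → Mask 2} {M : Matrix (Fin 2) (Fin 2) ℤ}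

/-- The two conditions for tightness in terms of the coefficients. The parameter `s` combines them;
for `s = ±1` the weight `1 + s (-1)^n` selects a coset of the quincunx lattice. -/
lemma IsTightFilterBank.sum_coeff (ht : IsTightFilterBank M β)
    (hM : M = quincunxM ∨ M = quincunxN) (s : ℂ) (t : Fin 2 → ℤ) :
    ∑ p, ∑ j ∈ (β p).support,
      β p j * ((1 + s * (-1 : ℂ) ^ (∑ i, (t - j) i)) * conj (β p (j - t))) =
      if t = 0 then 1 else 0 := by
  set G : Mask 2 := ∑ p, (convMask (β p) (conjMask (β p)) +
    s • convMask (β p) (modMask (conjMask (β p)))) with hG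
  have h1 : G = Finsupp.single 0 1 := by
    apply symbol_injective
    intro ω
    rw [hG, symbol_sum, symbol_single]
    simp only [symbol_add, symbol_smul, symbol_convMask, symbol_modMask, symbol_conjMask]
    rw [Finset.sum_add_distrib, ← Finset.mul_sum]
    have e1 : ∑ p, symbol (β p) ω * conj (symbol (β p) ω) = 1 := by
      have := ht.1 ω
      simp only [Complex.mul_conj, Complex.normSq_eq_norm_sq]
      rw [← Complex.ofReal_sum, this, Complex.ofReal_one]
    have e2 : ∑ p, symbol (β p) ω * conj (symbol (β p) (shiftPi ω)) = 0 := by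
      have := ht.2 _ (half_mem_omegaM_quincunx hM) half_ne_zero ω
      rw [shift2Pi_half] at this
      have h3 := congrArg conj this
      rw [map_sum, map_zero] at h3
      rw [← h3]
      exact Finset.sum_congr rfl fun p _ => by rw [map_mul, Complex.conj_conj]
    rw [e1, e2]
    simp [dotR]
  have h2 := congrArg (fun u : Mask 2 => u t) h1
  simp only [hG, Finsupp.finsetSum_apply, Finsupp.add_apply, Finsupp.smul_apply, convMask_apply,
    modMask_apply, conjMask_apply, Finsupp.single_apply, smul_eq_mul, Finsupp.sum, neg_sub,
    eq_comm (a := (0 : Fin 2 → ℤ))] at h2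
  rw [← h2]
  refine Finset.sum_congr rfl fun p _ => ?_
  rw [Finset.mul_sum, ← Finset.sum_add_distrib]
  exact Finset.sum_congr rfl fun j _ => by ring

lemma mulVec_quincunx_injective (hM : M = quincunxM ∨ M = quincunxN) :
    Function.Injective M.mulVec := by
  intro x y h
  have h0 := congrFun h 0
  have h1 := congrFun h 1
  rcases hM with rfl | rfl <;>
  · simp [quincunxM, quincunxN, Matrix.mulVec, dotProduct] at h0 h1
    funext i
    fin_cases i <;> simp <;> linarith

lemma exists_mulVec_quincunx (hM : M = quincunxM ∨ M = quincunxN) (z : Fin 2 → ℤ) :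
    (∃ k, M.mulVec k = z) ↔ Even (∑ i, z i) := by
  rw [Fin.sum_univ_two]
  constructor
  · rintro ⟨k, rfl⟩
    rcases hM with rfl | rfl
    · exact ⟨k 0, by simp [quincunxM, Matrix.mulVec, dotProduct]; ring⟩
    · exact ⟨k 0, by simp [quincunxN, Matrix.mulVec, dotProduct]; ring⟩
  · rintro ⟨r, hr⟩
    rcases hM with rfl | rfl
    · refine ⟨![r, r - z 1], ?_⟩
      funext i
      fin_cases i <;> simp [quincunxM, Matrix.mulVec, dotProduct] ; linarith
    · refine ⟨![r, r - z 0], ?_⟩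
      funext i
      fin_cases i <;> simp [quincunxN, Matrix.mulVec, dotProduct] ; linarith

/-- The analysis filters form a resolution of the identity on sequences. -/
lemma IsTightFilterBank.sum_mul_conj (ht : IsTightFilterBank M β)
    (hM : M = quincunxM ∨ M = quincunxN) (m n : Fin 2 → ℤ) (K : Finset (Fin 2 → ℤ))
    (hK : ∀ p k, β p (m - M.mulVec k) ≠ 0 → k ∈ K) :
    ∑ p, ∑ k ∈ K, 2 * (β p (m - M.mulVec k) * conj (β p (n - M.mulVec k))) =
      if m = n then 1 else 0 := by
  classical
  have h := ht.sum_coeff hM ((-1 : ℂ) ^ (∑ i, n i)) (m - n)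
  simp only [sub_eq_zero] at h
  rw [← h]
  refine Finset.sum_congr rfl fun p _ => ?_
  set F : (Fin 2 → ℤ) → ℂ := fun j => β p j *
    ((1 + (-1 : ℂ) ^ (∑ i, n i) * (-1 : ℂ) ^ (∑ i, (m - n - j) i)) * conj (β p (j - (m - n))))
    with hF
  have hsign : ∀ j : Fin 2 → ℤ, (-1 : ℂ) ^ (∑ i, n i) * (-1 : ℂ) ^ (∑ i, (m - n - j) i) =
      (-1 : ℂ) ^ (∑ i, (m - j) i) := by
    intro j
    rw [← zpow_add₀ (by norm_num)]
    congr 1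
    rw [← Finset.sum_add_distrib]
    exact Finset.sum_congr rfl fun i _ => by simp; ring
  have h1 : ∑ k ∈ K, 2 * (β p (m - M.mulVec k) * conj (β p (n - M.mulVec k))) =
      ∑ k ∈ K, F (m - M.mulVec k) := by
    refine Finset.sum_congr rfl fun k _ => ?_
    simp only [hF]
    rw [hsign, sub_sub_cancel, Even.neg_one_zpow ((exists_mulVec_quincunx hM _).1 ⟨k, rfl⟩)]
    have : m - M.mulVec k - (m - n) = n - M.mulVec k := by abel
    rw [this]
    ring
  have hinj : Set.InjOn (fun k => m - M.mulVec k) K := fun x _ y _ hxy =>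
    mulVec_quincunx_injective hM (sub_right_injective hxy)
  rw [h1, ← Finset.sum_image (f := F) hinj]
  -- both sides reduce to the sum over the `j` in the support with `m - j ∈ M ℤ²`
  set L := (K.image fun k => m - M.mulVec k) ∩ (β p).support
  trans ∑ j ∈ L, F j
  · refine (Finset.sum_subset Finset.inter_subset_left fun j hj hjL => ?_).symm
    have : β p j = 0 := by
      by_contra hne
      exact hjL (Finset.mem_inter.2 ⟨hj, Finsupp.mem_support_iff.2 hne⟩)
    simp [hF, this]
  · refine Finset.sum_subset Finset.inter_subset_right fun j hj hjL => ?_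
    have hodd : ¬ Even (∑ i, (m - j) i) := by
      intro he
      obtain ⟨k, hk⟩ := (exists_mulVec_quincunx hM _).2 he
      have hk' : m - M.mulVec k = j := by rw [hk]; abel
      refine hjL (Finset.mem_inter.2 ⟨Finset.mem_image.2 ⟨k, hK p k ?_, hk'⟩, hj⟩)
      rw [hk']
      exact Finsupp.mem_support_iff.1 hj
    simp only [hF]
    rw [hsign, Odd.neg_one_zpow (Int.not_even_iff_odd.1 hodd)]
    simp

/-- One step of the framelet decomposition of a sequence,
`k ↦ √2 ∑ n, conj (β(n)) d(n + M k)`. -/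
def analysis (M : Matrix (Fin 2) (Fin 2) ℤ) (β : Mask 2) (d : (Fin 2 → ℤ) → ℂ)
    (k : Fin 2 → ℤ) : ℂ :=
  (√2 : ℝ) * β.sum fun n c => conj c * d (n + M.mulVec k)

lemma analysis_eq (M : Matrix (Fin 2) (Fin 2) ℤ) (β : Mask 2) (d : (Fin 2 → ℤ) → ℂ)
    (k : Fin 2 → ℤ) (N : Finset (Fin 2 → ℤ)) (hN : ∀ n ∈ β.support, n + M.mulVec k ∈ N) :
    analysis M β d k = (√2 : ℝ) * ∑ n ∈ N, conj (β (n - M.mulVec k)) * d n := by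
  classical
  unfold analysis Finsupp.sum
  congr 1
  have hinj : Set.InjOn (fun n => n + M.mulVec k) (β.support : Set (Fin 2 → ℤ)) :=
    fun x _ y _ hxy => add_left_injective _ hxy
  have h1 : ∑ n ∈ β.support, conj (β n) * d (n + M.mulVec k) =
      ∑ n ∈ β.support.image (fun n => n + M.mulVec k), conj (β (n - M.mulVec k)) * d n := by
    rw [Finset.sum_image hinj]
    exact Finset.sum_congr rfl fun n _ => by rw [add_sub_cancel_right]
  rw [h1]
  refine Finset.sum_subset (fun n hn => ?_) fun n _ hn => ?_
  · obtain ⟨j, hj, rfl⟩ := Finset.mem_image.1 hn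
    exact hN j hj
  · have : β (n - M.mulVec k) = 0 := by
      by_contra hne
      exact hn (Finset.mem_image.2 ⟨n - M.mulVec k, Finsupp.mem_support_iff.2 hne, by abel⟩)
    rw [this, map_zero, zero_mul]

lemma exists_finset_shift (hM : M = quincunxM ∨ M = quincunxN) (β : ι → Mask 2)
    (S K₀ : Finset (Fin 2 → ℤ)) : ∃ K : Finset (Fin 2 → ℤ), K₀ ⊆ K ∧
      ∀ m ∈ S, ∀ p k, β p (m - M.mulVec k) ≠ 0 → k ∈ K := by
  classical
  have hfin : Set.Finite (⋃ p, ⋃ m ∈ S, {k | β p (m - M.mulVec k) ≠ 0}) := by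
    refine Set.finite_iUnion fun p => Set.Finite.biUnion S.finite_toSet fun m _ => ?_
    have hinj : Function.Injective fun k => m - M.mulVec k := fun x y hxy =>
      mulVec_quincunx_injective hM (sub_right_injective hxy)
    exact ((β p).support.finite_toSet.preimage hinj.injOn).subset fun k hk => by simpa using hk
  refine ⟨K₀ ∪ hfin.toFinset, Finset.subset_union_left, fun m hm p k hk => ?_⟩
  refine Finset.mem_union_right _ ?_
  simp only [Set.Finite.mem_toFinset, Set.mem_iUnion]
  exact ⟨p, m, hm, hk⟩

/-- The polarized form of the energy identity of the framelet decomposition, for a sequence and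
one of its truncations. -/
lemma IsTightFilterBank.sum_analysis (ht : IsTightFilterBank M β)
    (hM : M = quincunxM ∨ M = quincunxN) (d : (Fin 2 → ℤ) → ℂ) (S K : Finset (Fin 2 → ℤ))
    (hK : ∀ m ∈ S, ∀ p k, β p (m - M.mulVec k) ≠ 0 → k ∈ K) :
    ∑ p, ∑ k ∈ K, analysis M (β p) d k *
      conj (analysis M (β p) ((S : Set (Fin 2 → ℤ)).indicator d) k) =
      ((∑ m ∈ S, ‖d m‖ ^ 2 : ℝ) : ℂ) := by
  classical
  set N : Finset (Fin 2 → ℤ) := S ∪ Finset.univ.biUnion fun p => K.biUnion fun k =>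
    (β p).support.image fun n => n + M.mulVec k
  have hN : ∀ p, ∀ k ∈ K, ∀ n ∈ (β p).support, n + M.mulVec k ∈ N := fun p k hk n hn =>
    Finset.mem_union_right _ (Finset.mem_biUnion.2 ⟨p, Finset.mem_univ _,
      Finset.mem_biUnion.2 ⟨k, hk, Finset.mem_image.2 ⟨n, hn, rfl⟩⟩⟩)
  have hSN : S ⊆ N := Finset.subset_union_left
  have hsq : ((√2 : ℝ) : ℂ) * ((√2 : ℝ) : ℂ) = 2 := by
    rw [← Complex.ofReal_mul, Real.mul_self_sqrt zero_le_two]; norm_num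
  have hind : ∀ p, ∀ k ∈ K, analysis M (β p) ((S : Set (Fin 2 → ℤ)).indicator d) k =
      (√2 : ℝ) * ∑ m ∈ S, conj (β p (m - M.mulVec k)) * d m := by
    intro p k hk
    rw [analysis_eq M (β p) _ k N (hN p k hk)]
    congr 1
    rw [← Finset.sum_subset hSN]
    · exact Finset.sum_congr rfl fun m hm => by rw [Set.indicator_of_mem (by simpa using hm)]
    · intro m _ hm
      rw [Set.indicator_of_notMem (by simpa using hm), mul_zero]
  have hterm : ∀ p, ∀ k ∈ K, analysis M (β p) d k *
      conj (analysis M (β p) ((S : Set (Fin 2 → ℤ)).indicator d) k) =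
      ∑ m ∈ S, ∑ n ∈ N, conj (d m) * d n *
        (2 * (β p (m - M.mulVec k) * conj (β p (n - M.mulVec k)))) := by
    intro p k hk
    rw [hind p k hk, analysis_eq M (β p) d k N (hN p k hk), map_mul, Complex.conj_ofReal,
      mul_mul_mul_comm, hsq, map_sum, Finset.sum_mul_sum, Finset.sum_comm, Finset.mul_sum]
    refine Finset.sum_congr rfl fun m _ => ?_
    rw [Finset.mul_sum]
    refine Finset.sum_congr rfl fun n _ => ?_
    rw [map_mul, Complex.conj_conj]
    ring
  calc _ = ∑ p, ∑ k ∈ K, ∑ m ∈ S, ∑ n ∈ N, conj (d m) * d n *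
        (2 * (β p (m - M.mulVec k) * conj (β p (n - M.mulVec k)))) :=
        Finset.sum_congr rfl fun p _ => Finset.sum_congr rfl fun k hk => hterm p k hk
    _ = ∑ m ∈ S, ∑ n ∈ N, conj (d m) * d n * ∑ p, ∑ k ∈ K,
        (2 * (β p (m - M.mulVec k) * conj (β p (n - M.mulVec k)))) := by
        simp only [Finset.mul_sum]
        rw [Finset.sum_congr rfl fun p _ => Finset.sum_comm, Finset.sum_comm]
        refine Finset.sum_congr rfl fun m _ => ?_
        rw [Finset.sum_congr rfl fun p _ => Finset.sum_comm, Finset.sum_comm]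
    _ = ∑ m ∈ S, conj (d m) * d m := by
        refine Finset.sum_congr rfl fun m hm => ?_
        simp only [ht.sum_mul_conj hM m _ K (hK m hm), mul_ite, mul_one, mul_zero]
        rw [Finset.sum_ite_eq, if_pos (hSN hm)]
    _ = _ := by
        rw [Complex.ofReal_sum]
        refine Finset.sum_congr rfl fun m _ => ?_
        rw [Complex.conj_mul']
        push_cast
        rfl

lemma sum_enorm_sq {α : Type*} (s : Finset α) (f : α → ℂ) :
    ∑ i ∈ s, ‖f i‖ₑ ^ 2 = ENNReal.ofReal (∑ i ∈ s, ‖f i‖ ^ 2) := by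
  rw [ENNReal.ofReal_sum_of_nonneg fun _ _ => by positivity]
  exact Finset.sum_congr rfl fun i _ => by rw [← ofReal_norm, ENNReal.ofReal_pow (norm_nonneg _)]

/-- A tight filter bank preserves the energy of every sequence. -/
lemma IsTightFilterBank.tsum_analysis (ht : IsTightFilterBank M β)
    (hM : M = quincunxM ∨ M = quincunxN) (d : (Fin 2 → ℤ) → ℂ) :
    ∑ p, ∑' k, ‖analysis M (β p) d k‖ₑ ^ 2 = ∑' n, ‖d n‖ₑ ^ 2 := by
  classical
  rw [← Summable.tsum_finsetSum fun _ _ => ENNReal.summable]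
  -- the energy identity for truncations
  have hfin : ∀ S K : Finset (Fin 2 → ℤ),
      (∀ m ∈ S, ∀ p k, β p (m - M.mulVec k) ≠ 0 → k ∈ K) →
      ∑ x ∈ Finset.univ ×ˢ K, ‖analysis M (β x.1) ((S : Set (Fin 2 → ℤ)).indicator d) x.2‖ ^ 2 =
        ∑ m ∈ S, ‖d m‖ ^ 2 := by
    intro S K hK
    have h := ht.sum_analysis hM ((S : Set (Fin 2 → ℤ)).indicator d) S K hK
    rw [Set.indicator_indicator, Set.inter_self] at h
    simp only [Complex.mul_conj, Complex.normSq_eq_norm_sq] at h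
    have h2 : ∑ m ∈ S, ‖(S : Set (Fin 2 → ℤ)).indicator d m‖ ^ 2 = ∑ m ∈ S, ‖d m‖ ^ 2 :=
      Finset.sum_congr rfl fun m hm => by rw [Set.indicator_of_mem (by simpa using hm)]
    rw [h2] at h
    rw [Finset.sum_product]
    exact_mod_cast h
  apply le_antisymm
  · rw [ENNReal.tsum_eq_iSup_sum]
    refine iSup_le fun K₀ => ?_
    set S : Finset (Fin 2 → ℤ) := Finset.univ.biUnion fun p => K₀.biUnion fun k =>
      (β p).support.image fun n => n + M.mulVec k
    have hS : ∀ p, ∀ k ∈ K₀, ∀ n ∈ (β p).support, n + M.mulVec k ∈ S := fun p k hk n hn =>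
      Finset.mem_biUnion.2 ⟨p, Finset.mem_univ _,
        Finset.mem_biUnion.2 ⟨k, hk, Finset.mem_image.2 ⟨n, hn, rfl⟩⟩⟩
    obtain ⟨K, hK₀, hK⟩ := exists_finset_shift hM β S K₀
    have heq : ∀ p, ∀ k ∈ K₀, analysis M (β p) d k =
        analysis M (β p) ((S : Set (Fin 2 → ℤ)).indicator d) k := by
      intro p k hk
      unfold analysis Finsupp.sum
      congr 1
      refine Finset.sum_congr rfl fun n hn => ?_
      beta_reduce
      rw [Set.indicator_of_mem (Finset.mem_coe.2 (hS p k hk n hn))]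
    calc ∑ k ∈ K₀, ∑ p, ‖analysis M (β p) d k‖ₑ ^ 2
        = ∑ k ∈ K₀, ∑ p, ‖analysis M (β p) ((S : Set (Fin 2 → ℤ)).indicator d) k‖ₑ ^ 2 :=
          Finset.sum_congr rfl fun k hk => Finset.sum_congr rfl fun p _ => by rw [heq p k hk]
      _ ≤ ∑ k ∈ K, ∑ p, ‖analysis M (β p) ((S : Set (Fin 2 → ℤ)).indicator d) k‖ₑ ^ 2 :=
          Finset.sum_le_sum_of_subset hK₀
      _ = ∑ m ∈ S, ‖d m‖ₑ ^ 2 := by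
          rw [Finset.sum_comm, ← Finset.sum_product', sum_enorm_sq, sum_enorm_sq, hfin S K hK]
      _ ≤ ∑' n, ‖d n‖ₑ ^ 2 := ENNReal.sum_le_tsum S
  · rw [ENNReal.tsum_eq_iSup_sum]
    refine iSup_le fun S => ?_
    obtain ⟨K, -, hK⟩ := exists_finset_shift hM β S ∅
    refine le_trans ?_ (ENNReal.sum_le_tsum K)
    rw [Finset.sum_comm, ← Finset.sum_product', sum_enorm_sq, sum_enorm_sq]
    apply ENNReal.ofReal_le_ofReal
    set X := ∑ m ∈ S, ‖d m‖ ^ 2 with hX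
    have hX0 : 0 ≤ X := Finset.sum_nonneg fun _ _ => by positivity
    set Y := ∑ x ∈ Finset.univ ×ˢ K, ‖analysis M (β x.1) d x.2‖ ^ 2
    have h1 := ht.sum_analysis hM d S K hK
    rw [← Finset.sum_product'] at h1
    -- Cauchy–Schwarz in the polarized identity
    have h2 : X ^ 2 ≤ Y * X := by
      have h3 : X ≤ ∑ x ∈ Finset.univ ×ˢ K, ‖analysis M (β x.1) d x.2‖ *
          ‖analysis M (β x.1) ((S : Set (Fin 2 → ℤ)).indicator d) x.2‖ := by
        have h4 := congrArg norm h1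
        rw [Complex.norm_real, Real.norm_of_nonneg hX0] at h4
        rw [← h4]
        refine (norm_sum_le _ _).trans (Finset.sum_le_sum fun x _ => ?_)
        rw [norm_mul, RCLike.norm_conj]
      calc X ^ 2 ≤ _ := pow_le_pow_left₀ hX0 h3 2
        _ ≤ _ := Finset.sum_mul_sq_le_sq_mul_sq _ _ _
        _ = Y * X := by rw [hfin S K hK]
    rcases hX0.eq_or_lt with h0 | h0
    · rw [← h0]
      exact Finset.sum_nonneg fun _ _ => by positivity
    · nlinarith

end DiscreteUEP

/-! ### Parseval's identity on a cube of frequencies -/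

/-- The cube of frequencies centred at the origin, in units of `2π`. -/
def centeredCube (d : ℕ) : Set (Fin d → ℝ) := {x | ∀ i, x i ∈ Set.Ioc (-1 / 2 : ℝ) (-1 / 2 + 1)}

lemma measurableSet_centeredCube (d : ℕ) : MeasurableSet (centeredCube d) :=
  MeasurableSet.univ_pi' fun _ => measurableSet_Ioc

/-- Parseval's identity for Fourier series on the centred cube. -/
lemma tsum_fourierCoeff_centeredCube {d : ℕ} {h : (Fin d → ℝ) → ℂ} (hh : MemLp h 2) :
    ∑' k : Fin d → ℤ, ‖∫ x in centeredCube d,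
      Complex.exp (Complex.I * (dotR k fun i => 2 * Real.pi * x i : ℝ)) * h x‖ₑ ^ 2 =
      ∫⁻ x in centeredCube d, ‖h x‖ₑ ^ 2 := by
  let : MeasureSpace UnitAddCircle := ⟨AddCircle.haarAddCircle⟩
  have : IsProbabilityMeasure (volume : Measure UnitAddCircle) :=
    inferInstanceAs (IsProbabilityMeasure AddCircle.haarAddCircle)
  set a : Fin d → ℝ := fun _ => -1 / 2 with ha
  set e := UnitAddTorus.measurableEquivPiIoc a with he
  set T : UnitAddTorus (Fin d) → ℂ := fun t => h (e t).1 with hT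
  have hmp : MeasurePreserving e volume (Measure.comap Subtype.val volume) :=
    UnitAddTorus.measurePreserving_equivPiIoc a
  have hTx : ∀ x ∈ centeredCube d, T (fun i => (x i : UnitAddCircle)) = h x := by
    intro x hx
    have h1 : e (fun i => (x i : UnitAddCircle)) = ⟨x, hx⟩ := by
      rw [← MeasurableEquiv.eq_symm_apply]
      rfl
    rw [hT]
    simp only [h1]
  have hg : MemLp (fun y : {x : Fin d → ℝ // ∀ i, x i ∈ Set.Ioc (a i) (a i + 1)} => h y.1) 2
      (Measure.comap Subtype.val volume) := by
    have hemb := MeasurableEmbedding.subtype_coe (measurableSet_centeredCube d)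
    refine (hemb.memLp_map_measure_iff (g := h) (p := 2)
      (μ := Measure.comap Subtype.val volume)).1 ?_
    rw [map_comap_subtype_coe (measurableSet_centeredCube d)]
    exact hh.restrict _
  have hTm : MemLp T 2 := hg.comp_measurePreserving hmp
  have hco : ∀ k : Fin d → ℤ, UnitAddTorus.mFourierCoeff (hTm.toLp T) (-k) =
      ∫ x in centeredCube d,
        Complex.exp (Complex.I * (dotR k fun i => 2 * Real.pi * x i : ℝ)) * h x := by
    intro k
    have h1 : UnitAddTorus.mFourierCoeff (hTm.toLp T) (-k) = UnitAddTorus.mFourierCoeff T (-k) := by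
      unfold UnitAddTorus.mFourierCoeff
      refine integral_congr_ae ?_
      filter_upwards [hTm.coeFn_toLp] with t ht
      rw [ht]
    rw [h1, UnitAddTorus.mFourierCoeff_eq_integral _ _ a]
    refine setIntegral_congr_fun (measurableSet_centeredCube d) fun x hx => ?_
    rw [hTx x hx, neg_neg, smul_eq_mul]
    congr 1
    simp only [UnitAddTorus.mFourier, ContinuousMap.coe_mk, fourier_coe_apply]
    rw [← Complex.exp_sum]
    congr 1
    simp only [dotR]
    push_cast
    rw [Finset.mul_sum]
    exact Finset.sum_congr rfl fun i _ => by ring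
  have hs := UnitAddTorus.hasSum_sq_mFourierCoeff (hTm.toLp T)
  rw [← (Equiv.neg (Fin d → ℤ)).hasSum_iff, Function.comp_def] at hs
  have h2 : ∑' k : Fin d → ℤ, ‖UnitAddTorus.mFourierCoeff (hTm.toLp T) (-k)‖ₑ ^ 2 =
      ENNReal.ofReal (∫ t, ‖hTm.toLp T t‖ ^ 2) := by
    rw [← hs.tsum_eq, ENNReal.ofReal_tsum_of_nonneg (fun _ => sq_nonneg _) hs.summable]
    refine tsum_congr fun k => ?_
    rw [ENNReal.ofReal_pow (norm_nonneg _), ofReal_norm]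
    rfl
  simp only [hco] at h2
  rw [h2, ofReal_integral_eq_lintegral_ofReal ((Lp.memLp _).integrable_norm_pow (by norm_num))
    (.of_forall fun _ => sq_nonneg _)]
  have h3 : ∫⁻ t, ENNReal.ofReal (‖hTm.toLp T t‖ ^ 2) = ∫⁻ t, ‖T t‖ₑ ^ 2 := by
    refine lintegral_congr_ae ?_
    filter_upwards [hTm.coeFn_toLp] with t ht
    rw [ht, ENNReal.ofReal_pow (norm_nonneg _), ofReal_norm]
  rw [h3, UnitAddTorus.lintegral_preimage _ a]
  refine setLIntegral_congr_fun (measurableSet_centeredCube d) fun x hx => ?_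
  rw [hTx x hx]

/-- Parseval's identity for a function on `ℝ^d` that vanishes outside a cube of side one. -/
lemma tsum_integral_exp_mul {d : ℕ} {h : E d → ℂ} (hh : MemLp h 2)
    (h0 : ∀ η : E d, η.ofLp ∉ centeredCube d → h η = 0) :
    ∑' k : Fin d → ℤ, ‖∫ η : E d,
      Complex.exp (Complex.I * (dotR k fun i => 2 * Real.pi * η i : ℝ)) * h η‖ₑ ^ 2 =
      ∫⁻ η, ‖h η‖ₑ ^ 2 := by
  have hmp := PiLp.volume_preserving_toLp (Fin d)
  have hemb : MeasurableEmbedding (WithLp.toLp 2 : (Fin d → ℝ) → E d) :=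
    (MeasurableEquiv.toLp 2 (Fin d → ℝ)).measurableEmbedding
  have key := tsum_fourierCoeff_centeredCube (hh.comp_measurePreserving hmp)
  have h1 : ∫⁻ η, ‖h η‖ₑ ^ 2 = ∫⁻ x in centeredCube d, ‖h (WithLp.toLp 2 x)‖ₑ ^ 2 := by
    rw [← hmp.lintegral_comp_emb hemb, ← lintegral_indicator (measurableSet_centeredCube d)]
    refine lintegral_congr fun x => ?_
    by_cases hx : x ∈ centeredCube d
    · rw [Set.indicator_of_mem hx]
    · rw [Set.indicator_of_notMem hx, h0 _ hx]; simp
  rw [h1]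
  refine Eq.trans (tsum_congr fun k => ?_) key
  congr 2
  rw [← hmp.integral_comp hemb, ← integral_indicator (measurableSet_centeredCube d)]
  refine integral_congr_ae (.of_forall fun x => ?_)
  beta_reduce
  by_cases hx : x ∈ centeredCube d
  · rw [Set.indicator_of_mem hx]; rfl
  · rw [Set.indicator_of_notMem hx, h0 _ hx, mul_zero]

/-! ### Frame coefficients in the frequency domain -/

section Coefficients

variable {n : ℕ} {M : Matrix (Fin 2) (Fin 2) ℤ}

/-- Frame coefficients may be computed from any representative of the generator. -/
lemma frameCoeff_congr {d : ℕ} {M : Matrix (Fin d) (Fin d) ℤ} (hdet : (toReal M).det ≠ 0)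
    (f : L2 d) {g : L2 d} {g₀ : E d → ℂ} (h : g =ᵐ[volume] g₀) (j : ℕ) (k : Fin d → ℤ) :
    frameCoeff M f g j k = ∫ x : E d, f x *
      conj ((((((|M.det| : ℤ) : ℝ) ^ ((j : ℝ) / 2)) : ℝ) : ℂ) *
        g₀ (affine (toReal M ^ j) k x)) := by
  have hd : (toReal M ^ j).det ≠ 0 := by rw [Matrix.det_pow]; exact pow_ne_zero _ hdet
  refine integral_congr_ae ?_
  filter_upwards [(quasiMeasurePreserving_affine _ hd k).ae_eq_comp h] with x hx
  simp only [Function.comp_apply] at hx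
  rw [hx]

lemma transpose_pow_inv (M : Matrix (Fin 2) (Fin 2) ℤ) (J : ℕ) :
    (toReal M ^ J).transpose⁻¹ = (toReal M).transpose⁻¹ ^ J := by
  rw [Matrix.transpose_pow, Matrix.inv_pow']

/-- The Fourier transform of `|det M|^J φ(M^J · - k)`. -/
def atomFreq (M : Matrix (Fin 2) (Fin 2) ℤ) (n J : ℕ) (k : Fin 2 → ℤ) (ξ : E 2) : ℂ :=
  Complex.exp (-(Complex.I * (dotR k (fun i => 2 * Real.pi *
    Matrix.toEuclideanLin (toReal M ^ J).transpose⁻¹ ξ i) : ℂ))) *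
      refFreq n (Matrix.toEuclideanLin (toReal M ^ J).transpose⁻¹ ξ)

lemma det_toReal_pow_ne_zero (hM : M = quincunxM ∨ M = quincunxN) (J : ℕ) :
    (toReal M ^ J).det ≠ 0 := by
  rw [Matrix.det_pow]
  exact pow_ne_zero _ (det_toReal_quincunx_ne_zero hM)

lemma abs_det_toReal_pow (hM : M = quincunxM ∨ M = quincunxN) (J : ℕ) :
    |(toReal M ^ J).det| = 2 ^ J := by
  rw [Matrix.det_pow, abs_pow, det_toReal_quincunx hM]

lemma det_transpose_inv_ne_zero {P : Matrix (Fin 2) (Fin 2) ℝ} (hP : P.det ≠ 0) :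
    P.transpose⁻¹.det ≠ 0 := by
  rw [Matrix.det_nonsing_inv, Matrix.det_transpose, Ring.inverse_eq_inv']
  exact inv_ne_zero hP

lemma memLp_comp_toEuclideanLin {A : Matrix (Fin 2) (Fin 2) ℝ} (hA : A.det ≠ 0)
    {f : E 2 → ℂ} (hf : MemLp f 2) : MemLp (fun x => f (Matrix.toEuclideanLin A x)) 2 := by
  refine ((measurableEmbedding_toEuclideanLin A hA).memLp_map_measure_iff (g := f)).1 ?_
  rw [map_toEuclideanLin A hA]
  exact hf.smul_measure ENNReal.ofReal_ne_top

lemma integrable_memLp_atomFreq (hn : 1 ≤ n) (hM : M = quincunxM ∨ M = quincunxN) (J : ℕ)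
    (k : Fin 2 → ℤ) : Integrable (atomFreq M n J k) ∧ MemLp (atomFreq M n J k) 2 := by
  have hd := det_transpose_inv_ne_zero (det_toReal_pow_ne_zero hM J)
  have hc := continuous_toEuclideanLin (toReal M ^ J).transpose⁻¹
  have hm : AEStronglyMeasurable (fun ξ : E 2 => Complex.exp (-(Complex.I * (dotR k (fun i =>
      2 * Real.pi * Matrix.toEuclideanLin (toReal M ^ J).transpose⁻¹ ξ i) : ℂ)))) := by
    refine Continuous.aestronglyMeasurable ?_
    unfold dotR
    fun_prop
  have h1 := integrable_comp_toEuclideanLin _ hd (integrable_memLp_refFreq hn).1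
  have h2 := memLp_comp_toEuclideanLin hd (integrable_memLp_refFreq hn).2
  refine ⟨h1.bdd_mul (c := 1) hm (.of_forall fun ξ => (norm_exp_neg_I_mul _).le), ?_⟩
  refine h2.mono (hm.mul h2.1) (.of_forall fun ξ => ?_)
  unfold atomFreq
  rw [norm_mul, norm_exp_neg_I_mul, one_mul]

/-- The function `|det M|^{J/2} φ(M^J · - k)` as an element of `L_2(ℝ²)`. -/
def atomL2 (hn : 1 ≤ n) (hM : M = quincunxM ∨ M = quincunxN) (J : ℕ) (k : Fin 2 → ℤ) : L2 2 :=
  ((((2 : ℝ) ^ ((J : ℝ) / 2))⁻¹ : ℝ) : ℂ) • 𝓕⁻ (integrable_memLp_atomFreq hn hM J k).2.toLp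

lemma two_rpow_half_mul_self (J : ℕ) :
    (2 : ℝ) ^ ((J : ℝ) / 2) * (2 : ℝ) ^ ((J : ℝ) / 2) = 2 ^ J := by
  rw [← Real.rpow_add two_pos, add_halves, Real.rpow_natCast]

lemma atomL2_ae (hn : 1 ≤ n) (hM : M = quincunxM ∨ M = quincunxN) (J : ℕ) (k : Fin 2 → ℤ) :
    atomL2 hn hM J k =ᵐ[volume] fun x => (((2 : ℝ) ^ ((J : ℝ) / 2) : ℝ) : ℂ) *
      refFun n (affine (toReal M ^ J) k x) := by
  obtain ⟨h1, h2⟩ := integrable_memLp_atomFreq hn hM J k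
  filter_upwards [Lp.coeFn_smul ((((2 : ℝ) ^ ((J : ℝ) / 2))⁻¹ : ℝ) : ℂ) (𝓕⁻ (h2.toLp) : L2 2),
    fourierInv_toLp_ae h1 h2] with x hx1 hx2
  have h3 := fourierInv_dilate (toReal M ^ J) (det_toReal_pow_ne_zero hM J) k (refFreq n) x
  change 𝓕⁻ (atomFreq M n J k) x = _ at h3
  unfold atomL2
  rw [hx1, Pi.smul_apply, hx2, h3, abs_det_toReal_pow hM, smul_eq_mul, Complex.real_smul,
    ← mul_assoc, ← Complex.ofReal_mul, ← two_rpow_half_mul_self]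
  congr 2
  have : (2 : ℝ) ^ ((J : ℝ) / 2) ≠ 0 := by positivity
  field_simp

/-- The frame coefficients with respect to `φ` are inner products with its dilated translates. -/
lemma frameCoeff_refL2 (hn : 1 ≤ n) (hM : M = quincunxM ∨ M = quincunxN) (f : L2 2) (J : ℕ)
    (k : Fin 2 → ℤ) : frameCoeff M f (refL2 hn) J k = inner ℂ (atomL2 hn hM J k) f := by
  rw [frameCoeff_congr (det_toReal_quincunx_ne_zero hM) f (refL2_ae hn), L2.inner_def]
  refine integral_congr_ae ?_
  filter_upwards [atomL2_ae hn hM J k] with x hx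
  rw [hx, RCLike.inner_apply, det_quincunx hM]
  norm_num

/-- The frame coefficients are Fourier coefficients. -/
lemma inner_atomL2 (hn : 1 ≤ n) (hM : M = quincunxM ∨ M = quincunxN) (J : ℕ)
    (k : Fin 2 → ℤ) {f : L2 2} {F : E 2 → ℂ} (hF : (𝓕 f : L2 2) =ᵐ[volume] F) :
    inner ℂ (atomL2 hn hM J k) f = ∫ η : E 2,
      Complex.exp (Complex.I * (dotR k fun i => 2 * Real.pi * η i : ℝ)) *
        ((((2 : ℝ) ^ ((J : ℝ) / 2) : ℝ) : ℂ) * (refFreq n η *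
          F (Matrix.toEuclideanLin (toReal M ^ J).transpose η))) := by
  have hdet := det_toReal_pow_ne_zero hM J
  have hdet' : (toReal M ^ J).transpose.det ≠ 0 := by rwa [Matrix.det_transpose]
  rw [← Lp.inner_fourier_eq]
  unfold atomL2
  rw [FourierTransform.fourier_smul, FourierTransform.fourier_fourierInv_eq, inner_smul_left,
    Complex.conj_ofReal, L2.inner_def]
  set B := (toReal M ^ J).transpose⁻¹ with hB
  have h1 : ∫ ξ, inner ℂ (((integrable_memLp_atomFreq hn hM J k).2.toLp) ξ) ((𝓕 f : L2 2) ξ) =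
      ∫ ξ : E 2, Complex.exp (Complex.I * (dotR k fun i => 2 * Real.pi *
        Matrix.toEuclideanLin B ξ i : ℝ)) * (refFreq n (Matrix.toEuclideanLin B ξ) * F ξ) := by
    refine integral_congr_ae ?_
    filter_upwards [(integrable_memLp_atomFreq hn hM J k).2.coeFn_toLp, hF] with ξ h2 h3
    rw [h2, h3, RCLike.inner_apply]
    unfold atomFreq refFreq
    rw [map_mul, ← Complex.exp_conj, Complex.conj_ofReal]
    simp only [map_neg, map_mul, Complex.conj_I, Complex.conj_ofReal, neg_mul, neg_neg]
    ring
  have h4 := integral_comp_toEuclideanLin _ hdet' fun ξ : E 2 =>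
    Complex.exp (Complex.I * (dotR k fun i => 2 * Real.pi *
        Matrix.toEuclideanLin B ξ i : ℝ)) * (refFreq n (Matrix.toEuclideanLin B ξ) * F ξ)
  rw [Matrix.det_transpose, abs_inv, abs_det_toReal_pow hM] at h4
  have h5 : ∀ η : E 2, Matrix.toEuclideanLin B
      (Matrix.toEuclideanLin (toReal M ^ J).transpose η) = η := by
    intro η
    simp only [Matrix.toLpLin_apply, Matrix.mulVec_mulVec]
    rw [hB, Matrix.nonsing_inv_mul _ hdet'.isUnit, Matrix.one_mulVec]
  simp only [h5] at h4
  rw [h1, ← mul_right_injective₀ (a := ((((2 : ℝ) ^ J)⁻¹ : ℝ) : ℂ))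
    (by rw [Ne, Complex.ofReal_eq_zero]; positivity) |>.eq_iff]
  beta_reduce
  rw [mul_left_comm, ← Complex.real_smul (x := ((2 : ℝ) ^ J)⁻¹), ← h4, ← integral_const_mul,
    ← integral_const_mul]
  refine integral_congr_ae (.of_forall fun η => ?_)
  beta_reduce
  rw [← two_rpow_half_mul_self]
  have : (((2 : ℝ) ^ ((J : ℝ) / 2) : ℝ) : ℂ) ≠ 0 := by
    rw [Ne, Complex.ofReal_eq_zero]; positivity
  push_cast
  field_simp

lemma lintegral_comp_toEuclideanLin {A : Matrix (Fin 2) (Fin 2) ℝ} (hA : A.det ≠ 0)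
    (f : E 2 → ℝ≥0∞) : ∫⁻ x, f (Matrix.toEuclideanLin A x) =
      ENNReal.ofReal |A.det⁻¹| * ∫⁻ x, f x := by
  rw [← (measurableEmbedding_toEuclideanLin A hA).lintegral_map, map_toEuclideanLin A hA,
    lintegral_smul_measure, smul_eq_mul]

lemma norm_refFreq_le_one (n : ℕ) (ξ : E 2) : ‖refFreq n ξ‖ ≤ 1 := by
  unfold refFreq
  rw [Complex.norm_real, Real.norm_of_nonneg (refinableSymbol_nonneg _ _)]
  exact refinableSymbol_le_one _ _

/-- For a band-limited function the energy of the coefficients at a fine scale is an integral in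
the frequency domain, since no aliasing occurs. -/
lemma tsum_inner_atomL2 (hn : 1 ≤ n) (hM : M = quincunxM ∨ M = quincunxN) {f : L2 2}
    {F : E 2 → ℂ} (hF : (𝓕 f : L2 2) =ᵐ[volume] F) {R : ℝ} (hR : ∀ ξ, R < ‖ξ‖ → F ξ = 0) (J : ℕ)
    (hJ : 4 * R ^ 2 < 2 ^ J) :
    ∑' k : Fin 2 → ℤ, ‖inner ℂ (atomL2 hn hM J k) f‖ₑ ^ 2 =
      ∫⁻ ξ, ‖refFreq n (Matrix.toEuclideanLin (toReal M ^ J).transpose⁻¹ ξ)‖ₑ ^ 2 *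
        ‖F ξ‖ₑ ^ 2 := by
  have hdet := det_toReal_pow_ne_zero hM J
  have hdet' : (toReal M ^ J).transpose.det ≠ 0 := by rwa [Matrix.det_transpose]
  have h5 : ∀ η : E 2, Matrix.toEuclideanLin (toReal M ^ J).transpose⁻¹
      (Matrix.toEuclideanLin (toReal M ^ J).transpose η) = η := by
    intro η
    simp only [Matrix.toLpLin_apply, Matrix.mulVec_mulVec]
    rw [Matrix.nonsing_inv_mul _ hdet'.isUnit, Matrix.one_mulVec]
  have hnorm : ∀ η : E 2, ‖Matrix.toEuclideanLin (toReal M ^ J).transpose η‖ ^ 2 =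
      2 ^ J * (η 0 ^ 2 + η 1 ^ 2) := by
    intro η
    have h6 := transpose_inv_pow_sq_sum hM J
      (Matrix.toEuclideanLin (toReal M ^ J).transpose η).ofLp
    rw [← transpose_pow_inv] at h6
    have h7 : (toReal M ^ J).transpose⁻¹.mulVec
        (Matrix.toEuclideanLin (toReal M ^ J).transpose η).ofLp = η.ofLp :=
      congrArg WithLp.ofLp (h5 η)
    rw [h7] at h6
    rw [EuclideanSpace.norm_sq_eq, Fin.sum_univ_two, Real.norm_eq_abs, Real.norm_eq_abs, sq_abs,
      sq_abs, h6]
    field_simp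
  simp only [inner_atomL2 hn hM J _ hF]
  have hFL : MemLp F 2 := (memLp_congr_ae hF).1 (Lp.memLp _)
  have hG : MemLp (fun η : E 2 => (((2 : ℝ) ^ ((J : ℝ) / 2) : ℝ) : ℂ) * (refFreq n η *
      F (Matrix.toEuclideanLin (toReal M ^ J).transpose η))) 2 := by
    refine MemLp.const_mul ?_ _
    have h8 := memLp_comp_toEuclideanLin hdet' hFL
    refine h8.mono ((measurable_refFreq hn).aestronglyMeasurable.mul h8.1) (.of_forall fun η => ?_)
    rw [norm_mul]
    exact mul_le_of_le_one_left (norm_nonneg _) (norm_refFreq_le_one n η)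
  rw [tsum_integral_exp_mul hG]
  · have h9 := lintegral_comp_toEuclideanLin hdet' fun ξ =>
      ‖refFreq n (Matrix.toEuclideanLin (toReal M ^ J).transpose⁻¹ ξ)‖ₑ ^ 2 * ‖F ξ‖ₑ ^ 2
    simp only [h5] at h9
    rw [Matrix.det_transpose, abs_inv, abs_det_toReal_pow hM] at h9
    have h10 : ∀ η : E 2, ‖(((2 : ℝ) ^ ((J : ℝ) / 2) : ℝ) : ℂ) * (refFreq n η *
        F (Matrix.toEuclideanLin (toReal M ^ J).transpose η))‖ₑ ^ 2 = ENNReal.ofReal (2 ^ J) *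
        (‖refFreq n η‖ₑ ^ 2 *
          ‖F (Matrix.toEuclideanLin (toReal M ^ J).transpose η)‖ₑ ^ 2) := by
      intro η
      rw [enorm_mul, enorm_mul, mul_pow, mul_pow, ← ofReal_norm (((2 : ℝ) ^ ((J : ℝ) / 2) : ℝ) : ℂ),
        Complex.norm_real, Real.norm_of_nonneg (by positivity),
        ← ENNReal.ofReal_pow (by positivity), sq, two_rpow_half_mul_self]
    simp only [h10]
    rw [lintegral_const_mul' _ _ ENNReal.ofReal_ne_top, h9, ← mul_assoc,
      ← ENNReal.ofReal_mul (by positivity), mul_inv_cancel₀ (by positivity), ENNReal.ofReal_one,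
      one_mul]
  · intro η hη
    rw [hR, mul_zero, mul_zero]
    -- a frequency outside the cube is mapped beyond the band limit
    have h11 : 1 / 4 ≤ η 0 ^ 2 + η 1 ^ 2 := by
      by_contra! hlt
      refine hη fun i => ?_
      have hi : η i ^ 2 < (1 / 2) ^ 2 := by
        fin_cases i <;> simp <;> nlinarith [sq_nonneg (η 0), sq_nonneg (η 1)]
      have := abs_lt_of_sq_lt_sq hi (by norm_num)
      rw [abs_lt] at this
      constructor <;> linarith
    refine lt_of_pow_lt_pow_left₀ 2 (norm_nonneg _) ?_
    rw [hnorm]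
    nlinarith [pow_pos (two_pos (α := ℝ)) J]

lemma enorm_sq_eq_lintegral {d : ℕ} (f : L2 d) : ‖f‖ₑ ^ 2 = ∫⁻ x, ‖f x‖ₑ ^ 2 := by
  rw [Lp.enorm_def]
  simpa using eLpNorm_nnreal_pow_eq_lintegral (μ := volume) (f := f) (p := 2) two_ne_zero

/-- For a band-limited function the energies of the coefficients with respect to `φ` tend to the
squared norm, by dominated convergence in the frequency domain. -/
lemma tendsto_tsum_inner_atomL2 (hn : 1 ≤ n) (hM : M = quincunxM ∨ M = quincunxN) {f : L2 2}
    {F : E 2 → ℂ} (hF : (𝓕 f : L2 2) =ᵐ[volume] F) {R : ℝ} (hR : ∀ ξ, R < ‖ξ‖ → F ξ = 0) :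
    Tendsto (fun J => ∑' k : Fin 2 → ℤ, ‖inner ℂ (atomL2 hn hM J k) f‖ₑ ^ 2) atTop
      (𝓝 (‖f‖ₑ ^ 2)) := by
  have hFL : MemLp F 2 := (memLp_congr_ae hF).1 (Lp.memLp _)
  have hfF : ‖f‖ₑ ^ 2 = ∫⁻ ξ, ‖F ξ‖ₑ ^ 2 := by
    have h1 : ‖f‖ₑ = ‖(𝓕 f : L2 2)‖ₑ := by
      rw [← ofReal_norm, ← ofReal_norm, Lp.norm_fourier_eq]
    rw [h1, enorm_sq_eq_lintegral]
    refine lintegral_congr_ae ?_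
    filter_upwards [hF] with ξ hξ
    rw [hξ]
  have hfin : ∫⁻ ξ, ‖F ξ‖ₑ ^ 2 ≠ ∞ := by
    rw [← hfF]
    exact ENNReal.pow_ne_top enorm_ne_top
  have hlarge : ∀ᶠ J : ℕ in atTop, 4 * R ^ 2 < 2 ^ J :=
    (tendsto_pow_atTop_atTop_of_one_lt one_lt_two).eventually_gt_atTop _
  rw [hfF]
  refine Tendsto.congr' (f₁ := fun J => ∫⁻ ξ, ‖refFreq n
    (Matrix.toEuclideanLin (toReal M ^ J).transpose⁻¹ ξ)‖ₑ ^ 2 * ‖F ξ‖ₑ ^ 2)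
    (hlarge.mono fun J hJ => (tsum_inner_atomL2 hn hM hF hR J hJ).symm) ?_
  refine tendsto_lintegral_of_dominated_convergence' (fun ξ => ‖F ξ‖ₑ ^ 2) (fun J => ?_)
    (fun J => .of_forall fun ξ => ?_) hfin (.of_forall fun ξ => ?_)
  · have h2 := (measurable_refFreq hn).comp
      (continuous_toEuclideanLin (toReal M ^ J).transpose⁻¹).measurable
    exact (h2.enorm.pow_const 2).aemeasurable.mul (hFL.1.enorm.pow_const 2)
  · refine mul_le_of_le_one_left (by positivity) (pow_le_one₀ (by positivity) ?_)
    rw [← ofReal_norm, ENNReal.ofReal_le_one]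
    exact norm_refFreq_le_one _ _
  · have h3 : Tendsto (fun J : ℕ => refFreq n
        (Matrix.toEuclideanLin (toReal M ^ J).transpose⁻¹ ξ)) atTop (𝓝 1) := by
      have h4 := tendsto_refinableSymbol_pow hn hM fun i => 2 * Real.pi * ξ i
      have h5 := (Complex.continuous_ofReal.tendsto 1).comp h4
      rw [Complex.ofReal_one] at h5
      refine h5.congr fun J => ?_
      simp only [Function.comp_apply, refFreq, ← transpose_pow_inv, mulVec_two_pi]
    have h6 := ENNReal.Tendsto.mul_const (b := ‖F ξ‖ₑ ^ 2)
      (((ENNReal.continuous_pow 2).tendsto _).comp ((continuous_enorm.tendsto (1 : ℂ)).comp h3))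
      (Or.inr (ENNReal.pow_ne_top enorm_ne_top))
    simpa using h6

end Coefficients

/-! ### The tight framelet -/

section Cascade

variable {n : ℕ} {M : Matrix (Fin 2) (Fin 2) ℤ}

lemma affine_affine (M : Matrix (Fin 2) (Fin 2) ℤ) (j : ℕ) (k m : Fin 2 → ℤ) (x : E 2) :
    affine (toReal M) m (affine (toReal M ^ j) k x) =
      affine (toReal M ^ (j + 1)) (m + M.mulVec k) x := by
  have h : (toReal M).mulVec (fun i => (k i : ℝ)) = fun i => ((M.mulVec k i : ℤ) : ℝ) := by
    funext i
    simp [toReal, Matrix.mulVec, dotProduct]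
  unfold affine
  congr 1
  funext i
  have h1 : (fun i => (toReal M ^ j).mulVec x.ofLp i - (k i : ℝ)) =
      (toReal M ^ j).mulVec x.ofLp - fun i => (k i : ℝ) := rfl
  beta_reduce
  rw [h1, Matrix.mulVec_sub, Matrix.mulVec_mulVec, ← pow_succ', h, Pi.sub_apply, Pi.add_apply]
  push_cast
  ring

/-- The coefficients of a generated function are obtained from those of the refinable function at
the next finer scale. -/
lemma frameCoeff_genL2 (hn : 1 ≤ n) (hM : M = quincunxM ∨ M = quincunxN) (β : Mask 2) (f : L2 2)
    (j : ℕ) (k : Fin 2 → ℤ) :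
    frameCoeff M f (genL2 hn hM β) j k =
      analysis M β (fun m => frameCoeff M f (refL2 hn) (j + 1) m) k := by
  have hdet := det_toReal_quincunx_ne_zero hM
  have hint : ∀ m, Integrable fun x : E 2 => f x * conj ((((2 : ℝ) ^ (((j + 1 : ℕ) : ℝ) / 2) : ℝ) : ℂ) *
      refFun n (affine (toReal M ^ (j + 1)) m x)) := by
    intro m
    refine (L2.integrable_inner (𝕜 := ℂ) (atomL2 hn hM (j + 1) m) f).congr ?_
    filter_upwards [atomL2_ae hn hM (j + 1) m] with x hx
    rw [hx, RCLike.inner_apply]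
  rw [frameCoeff_congr hdet f (genL2_ae hn hM β)]
  unfold analysis Finsupp.sum
  simp only [frameCoeff_congr hdet f (refL2_ae hn), det_quincunx hM, Int.cast_ofNat]
  simp only [← integral_const_mul]
  rw [← integral_finsetSum _ fun m _ => (hint _).const_mul _, ← integral_const_mul]
  refine integral_congr_ae (.of_forall fun x => ?_)
  beta_reduce
  unfold genFun Finsupp.sum
  have hs : (2 : ℝ) * 2 ^ ((j : ℝ) / 2) = √2 * 2 ^ (((j + 1 : ℕ) : ℝ) / 2) := by
    have h2 : √2 * √2 = (2 : ℝ) := Real.mul_self_sqrt zero_le_two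
    have h3 : (2 : ℝ) ^ (((j + 1 : ℕ) : ℝ) / 2) = 2 ^ ((j : ℝ) / 2) * √2 := by
      rw [Real.sqrt_eq_rpow, ← Real.rpow_add two_pos]
      congr 1
      push_cast
      ring
    rw [h3, mul_left_comm, h2, mul_comm]
  have hs' : (((2 : ℝ) ^ ((j : ℝ) / 2) : ℝ) : ℂ) * 2 =
      ((√2 : ℝ) : ℂ) * (((2 : ℝ) ^ (((j + 1 : ℕ) : ℝ) / 2) : ℝ) : ℂ) := by
    rw [← Complex.ofReal_mul, ← hs]
    push_cast
    ring
  rw [← mul_assoc, hs', map_mul, map_sum, map_mul, Complex.conj_ofReal, Complex.conj_ofReal,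
    Finset.mul_sum, Finset.mul_sum, Finset.mul_sum]
  refine Finset.sum_congr rfl fun m _ => ?_
  beta_reduce
  rw [affine_affine, map_mul, map_mul, Complex.conj_ofReal]
  ring

/-- One step of the decomposition preserves the energy of the coefficients. -/
lemma IsTightFilterBank.tsum_frameCoeff (hn : 1 ≤ n) (hM : M = quincunxM ∨ M = quincunxN)
    {ι : Type} [Fintype ι] {β : ι → Mask 2} (ht : IsTightFilterBank M β) (f : L2 2) (j : ℕ) :
    ∑ p, ∑' k, ‖frameCoeff M f (genL2 hn hM (β p)) j k‖ₑ ^ 2 =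
      ∑' k, ‖frameCoeff M f (refL2 hn) (j + 1) k‖ₑ ^ 2 := by
  rw [← ht.tsum_analysis hM]
  simp only [frameCoeff_genL2]

end Cascade

/-- If the energies of the coefficients with respect to a sequence of families increase, and tend
to the squared norm for the vectors of a dense set, then they do so for every vector. -/
lemma tendsto_tsum_inner_of_dense {H κ : Type*} [NormedAddCommGroup H] [InnerProductSpace ℂ H]
    {g : ℕ → κ → H} {D : Set H} (hD : Dense D)
    (hmono : ∀ f, Monotone fun J => ∑' k, ‖inner ℂ (g J k) f‖ₑ ^ 2)
    (hlim : ∀ f ∈ D, Tendsto (fun J => ∑' k, ‖inner ℂ (g J k) f‖ₑ ^ 2) atTop (𝓝 (‖f‖ₑ ^ 2)))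
    (f : H) : Tendsto (fun J => ∑' k, ‖inner ℂ (g J k) f‖ₑ ^ 2) atTop (𝓝 (‖f‖ₑ ^ 2)) := by
  -- finite families of coefficients, as vectors of a Euclidean space
  let T : (J : ℕ) → (K : Finset κ) → H → EuclideanSpace ℂ K :=
    fun J K f => WithLp.toLp 2 fun k => inner ℂ (g J k) f
  have hTsub : ∀ J K f f', T J K (f - f') = T J K f - T J K f' := by
    intro J K f f'
    ext k
    simp [T]
  have hTcont : ∀ J K, Continuous (T J K) := by
    intro J K
    refine (PiLp.continuous_toLp 2 _).comp (continuous_pi fun k => ?_)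
    exact continuous_const.inner continuous_id
  have hTsum : ∀ J K f, ∑ k ∈ K, ‖inner ℂ (g J k) f‖ₑ ^ 2 = ENNReal.ofReal (‖T J K f‖ ^ 2) := by
    intro J K f
    rw [EuclideanSpace.norm_sq_eq, sum_enorm_sq]
    congr 1
    exact (Finset.sum_coe_sort K fun k => ‖inner ℂ (g J k) f‖ ^ 2).symm
  have hnorm : ∀ f : H, ‖f‖ₑ ^ 2 = ENNReal.ofReal (‖f‖ ^ 2) := by
    intro f
    rw [ENNReal.ofReal_pow (norm_nonneg _), ofReal_norm]
  have hsup : ∀ f ∈ D, ⨆ J, ∑' k, ‖inner ℂ (g J k) f‖ₑ ^ 2 = ‖f‖ₑ ^ 2 := fun f hf =>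
    tendsto_nhds_unique (tendsto_atTop_iSup (hmono f)) (hlim f hf)
  have hbesselD : ∀ J K, ∀ f ∈ D, ‖T J K f‖ ≤ ‖f‖ := by
    intro J K f hf
    have h1 : ENNReal.ofReal (‖T J K f‖ ^ 2) ≤ ENNReal.ofReal (‖f‖ ^ 2) := by
      rw [← hTsum, ← hnorm, ← hsup f hf]
      exact (ENNReal.sum_le_tsum K).trans (le_iSup (fun J => ∑' k, ‖inner ℂ (g J k) f‖ₑ ^ 2) J)
    rw [ENNReal.ofReal_le_ofReal_iff (by positivity)] at h1
    exact (sq_le_sq₀ (norm_nonneg _) (norm_nonneg _)).1 h1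
  have hbessel : ∀ J K f, ‖T J K f‖ ≤ ‖f‖ := by
    intro J K
    have hcl : IsClosed {f | ‖T J K f‖ ≤ ‖f‖} := isClosed_le (hTcont J K).norm continuous_norm
    have : closure D ⊆ {f | ‖T J K f‖ ≤ ‖f‖} := hcl.closure_subset_iff.2 (hbesselD J K)
    intro f
    exact this (hD f)
  suffices h : ⨆ J, ∑' k, ‖inner ℂ (g J k) f‖ₑ ^ 2 = ‖f‖ₑ ^ 2 by
    rw [← h]
    exact tendsto_atTop_iSup (hmono f)
  apply le_antisymm
  · refine iSup_le fun J => ?_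
    rw [ENNReal.tsum_eq_iSup_sum]
    refine iSup_le fun K => ?_
    rw [hTsum, hnorm]
    exact ENNReal.ofReal_le_ofReal (pow_le_pow_left₀ (norm_nonneg _) (hbessel J K f) 2)
  · refine le_of_forall_lt fun c hc => ?_
    have hc' : c ≠ ∞ := hc.ne_top
    lift c to NNReal using hc'
    have hcr : √(c : ℝ) < ‖f‖ := by
      rw [Real.sqrt_lt' ?_]
      · have h1 := hc
        rw [hnorm, ENNReal.ofReal, ENNReal.coe_lt_coe] at h1
        exact (NNReal.coe_lt_coe.2 h1).trans_eq (Real.coe_toNNReal _ (by positivity))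
      · by_contra! h0
        have : f = 0 := norm_le_zero_iff.1 h0
        simp [this] at hc
    set ε := (‖f‖ - √(c : ℝ)) / 2 with hε
    have hε0 : 0 < ε := by rw [hε]; linarith
    obtain ⟨f₀, hf₀, hdist⟩ := Metric.dense_iff.1 hD f ε hε0
    rw [Metric.mem_ball, dist_eq_norm] at hf₀
    -- enough coefficients of the nearby vector
    have hlow : √(c : ℝ) + ε < ‖f₀‖ := by
      have := norm_sub_norm_le f f₀
      rw [norm_sub_rev] at this
      rw [hε] at hf₀ ⊢
      linarith
    have h0 : 0 ≤ √(c : ℝ) + ε := add_nonneg (Real.sqrt_nonneg _) hε0.le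
    have h2 : ENNReal.ofReal ((√(c : ℝ) + ε) ^ 2) <
        ⨆ J, ∑' k, ‖inner ℂ (g J k) f₀‖ₑ ^ 2 := by
      rw [hsup f₀ hdist, hnorm, ENNReal.ofReal_lt_ofReal_iff (pow_pos (h0.trans_lt hlow) 2)]
      exact pow_lt_pow_left₀ hlow h0 two_ne_zero
    obtain ⟨J, hJ⟩ := lt_iSup_iff.1 h2
    rw [ENNReal.tsum_eq_iSup_sum] at hJ
    obtain ⟨K, hK⟩ := lt_iSup_iff.1 hJ
    rw [hTsum] at hK
    have h3 := lt_of_pow_lt_pow_left₀ 2 (norm_nonneg _) (ENNReal.ofReal_lt_ofReal_iff'.1 hK).1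
    have h4 : √(c : ℝ) < ‖T J K f‖ := by
      have h5 := hbessel J K (f₀ - f)
      rw [hTsub] at h5
      have h6 := norm_sub_norm_le (T J K f₀) (T J K f)
      linarith
    refine lt_of_lt_of_le ?_ ((ENNReal.sum_le_tsum K).trans
      (le_iSup (fun J => ∑' k, ‖inner ℂ (g J k) f‖ₑ ^ 2) J))
    rw [hTsum, ← ENNReal.ofReal_coe_nnreal, ENNReal.ofReal_lt_ofReal_iff
      (pow_pos ((Real.sqrt_nonneg _).trans_lt h4) 2)]
    exact (Real.sqrt_lt' ((Real.sqrt_nonneg _).trans_lt h4)).1 h4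

/-- Band-limited functions are dense. -/
lemma dense_bandLimited (d : ℕ) : Dense {f : L2 d | ∃ (F : E d → ℂ) (R : ℝ),
    (𝓕 f : L2 d) =ᵐ[volume] F ∧ ∀ ξ, R < ‖ξ‖ → F ξ = 0} := by
  refine Metric.dense_iff.2 fun f r hr => ?_
  obtain ⟨g, hgc, hg, -, hgL⟩ := (Lp.memLp (𝓕 f : L2 d)).exists_hasCompactSupport_eLpNorm_sub_le
    (by norm_num) (ε := ENNReal.ofReal (r / 2)) (by simpa using hr)
  refine ⟨𝓕⁻ (hgL.toLp g), ?_, ?_⟩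
  · rw [Metric.mem_ball, dist_eq_norm, ← Lp.norm_fourier_eq, sub_eq_add_neg,
      FourierTransform.fourier_add, FourierTransform.fourier_neg, ← sub_eq_add_neg,
      FourierTransform.fourier_fourierInv_eq, norm_sub_rev]
    have h1 : ‖(𝓕 f : L2 d) - hgL.toLp g‖ₑ ≤ ENNReal.ofReal (r / 2) := by
      rw [Lp.enorm_def]
      refine le_trans (eLpNorm_congr_ae ?_).le hg
      filter_upwards [Lp.coeFn_sub (𝓕 f : L2 d) (hgL.toLp g), hgL.coeFn_toLp] with x hx1 hx2
      rw [hx1, Pi.sub_apply, Pi.sub_apply, hx2]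
    rw [← ofReal_norm, ENNReal.ofReal_le_ofReal_iff (by positivity)] at h1
    linarith
  · obtain ⟨R, hR⟩ := hgc.isCompact.isBounded.exists_norm_le
    refine ⟨g, R, ?_, fun ξ hξ => ?_⟩
    · rw [FourierTransform.fourier_fourierInv_eq]
      exact hgL.coeFn_toLp
    · by_contra hne
      exact absurd (hR ξ (subset_tsupport _ hne)) (not_le.2 hξ)

/-- The unitary extension principle for the quincunx matrices: the functions generated by a tight
filter bank with low-pass filter `a^I_{2n} ⊗ a^I_{2n}` form a tight framelet. -/
lemma isTightFramelet_genL2 {n s : ℕ} {M : Matrix (Fin 2) (Fin 2) ℤ} (hn : 1 ≤ n)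
    (hM : M = quincunxM ∨ M = quincunxN) {β : Fin (s + 1) → Mask 2} (ht : IsTightFilterBank M β)
    (h0 : β 0 = tensor (interpMask n) (interpMask n)) :
    IsTightFramelet M (refL2 hn) fun l : Fin s => genL2 hn hM (β l.succ) := by
  intro f
  -- the low-pass filter of the bank generates `φ` itself
  have hstep : ∀ (f : L2 2) (j : ℕ), ∑' k, ‖frameCoeff M f (refL2 hn) (j + 1) k‖ₑ ^ 2 =
      ∑' k, ‖frameCoeff M f (refL2 hn) j k‖ₑ ^ 2 +
        ∑ l : Fin s, ∑' k, ‖frameCoeff M f (genL2 hn hM (β l.succ)) j k‖ₑ ^ 2 := by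
    intro f j
    rw [← ht.tsum_frameCoeff hn hM f j, Fin.sum_univ_succ, h0, genL2_tensor hn hM]
  have hQ : ∀ J, ∑' k, ‖frameCoeff M f (refL2 hn) J k‖ₑ ^ 2 =
      ∑' k, ‖frameCoeff M f (refL2 hn) 0 k‖ₑ ^ 2 + ∑ j ∈ Finset.range J,
        ∑ l : Fin s, ∑' k, ‖frameCoeff M f (genL2 hn hM (β l.succ)) j k‖ₑ ^ 2 := by
    intro J
    induction J with
    | zero => simp
    | succ J ih => rw [hstep, ih, Finset.sum_range_succ, add_assoc]
  have hlim : Tendsto (fun J => ∑' k, ‖frameCoeff M f (refL2 hn) J k‖ₑ ^ 2) atTop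
      (𝓝 (‖f‖ₑ ^ 2)) := by
    have h1 := tendsto_tsum_inner_of_dense (g := atomL2 hn hM) (dense_bandLimited 2)
      (fun f => monotone_nat_of_le_succ fun J => ?_)
      (fun f ⟨F, R, hF, hR⟩ => tendsto_tsum_inner_atomL2 hn hM hF hR) f
    · simpa only [frameCoeff_refL2 hn hM] using h1
    · simp only [← frameCoeff_refL2 hn hM]
      rw [hstep]
      exact le_self_add
  refine tendsto_nhds_unique hlim ?_
  exact (tendsto_const_nhds.add ENNReal.summable.hasSum.tendsto_sum_nat).congr fun J => (hQ J).symm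

end Framelet

end

open Framelet in
theorem theorem4p6 :
    (∀ a : Mask 1, IsSymLowPass a →
      (∃ b u, IsIngredients a b u) ∧
      ∀ b u, IsIngredients a b u →
        bank2D b u 0 = tensor a a ∧
        IsMultipleCanonicalTightBank quincunxM 6 (bank2D b u) ∧
        IsRealMask (tensor a a) ∧
        (∃ c : Fin 2 → ℝ, IsGSymmetricAbout D4 c (tensor a a)) ∧
        sr (tensor a a) quincunxM = sr (tensor a a) quincunxN ∧
        2 * sr a dil2 ≤ sr (tensor a a) quincunxM ∧
        sm (tensor a a) quincunxM = sm (tensor a a) quincunxN ∧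
        2 * sm a dil2 ≤ sm (tensor a a) quincunxM ∧
        ∀ p, p ≠ 0 → IsRealMask (bank2D b u p) ∧ HasSymmetry (bank2D b u p) ∧
          min (4 * sr a dil2) (lpm a) ≤ 2 * vm (bank2D b u p)) ∧
    (∀ n : ℕ, 1 ≤ n → IsSymLowPass (interpMask n) ∧
      (∃ c : Fin 2 → ℝ, IsGSymmetricAbout D4 c (tensor (interpMask n) (interpMask n))) ∧
      sr (tensor (interpMask n) (interpMask n)) quincunxM =
        sr (tensor (interpMask n) (interpMask n)) quincunxN ∧
      ((4 * n : ℕ) : ℕ∞) ≤ sr (tensor (interpMask n) (interpMask n)) quincunxM ∧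
      ∀ b u, IsIngredients (interpMask n) b u →
        IsMultipleCanonicalTightBank quincunxM 6 (bank2D b u) ∧
        ∀ p, p ≠ 0 → HasSymmetry (bank2D b u p) ∧ (n : ℕ∞) ≤ vm (bank2D b u p)) ∧
    (∀ M ∈ ({quincunxM, quincunxN} : Set (Matrix (Fin 2) (Fin 2) ℤ)),
      Tendsto (fun n => sm (tensor (interpMask n) (interpMask n)) M) atTop (𝓝 ⊤) ∧
      (∀ n : ℕ, 1 ≤ n → ∀ b u, IsIngredients (interpMask n) b u →
        ∃ (φ : L2 2) (ψ : Fin 11 → L2 2),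
          IsGenerated M (tensor (interpMask n) (interpMask n))
            (fun l : Fin 11 => bank2D b u l.succ) φ ψ ∧
          IsTightFramelet M φ ψ ∧ FunD4Symmetric φ ∧
          ∀ l, FunSymmetric (ψ l) ∧ FunVanishingMoments (ψ l) n) ∧
      ∀ R : ℝ, ∃ n₀ : ℕ, ∀ n ≥ n₀, ∀ b u, IsIngredients (interpMask n) b u →
        ∀ (φ : L2 2) (ψ : Fin 11 → L2 2),
          IsGenerated M (tensor (interpMask n) (interpMask n))
            (fun l : Fin 11 => bank2D b u l.succ) φ ψ →
          (R : EReal) ≤ funSm φ ∧ ∀ l, (R : EReal) ≤ funSm (ψ l)) := by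
  have hsr : ∀ a : Mask 1, IsSymLowPass a → ∀ M, M = quincunxM ∨ M = quincunxN →
      sr (tensor a a) M = 2 * sr a dil2 := fun a ha M hM => sr_tensor ha.low hM
  refine ⟨fun a ha => ⟨exists_isIngredients ha, fun b u h => ?_⟩, fun n hn => ?_, fun M hM => ?_⟩
  · refine ⟨h.bank2D_zero, h.isMultipleCanonicalTightBank, ha.real.tensor ha.real,
      ha.isGSymmetricAbout, ?_, ?_, sm_quincunx_eq ha.real ha.low, ha.two_mul_sm_le,
      fun p hp => ⟨h.isRealMask_bank2D p, h.hasSymmetry_bank2D p, h.min_le_two_vm hp⟩⟩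
    · rw [hsr a ha _ (Or.inl rfl), hsr a ha _ (Or.inr rfl)]
    · exact (hsr a ha _ (Or.inl rfl)).ge
  · have ha := isSymLowPass_interpMask hn
    refine ⟨ha, ha.isGSymmetricAbout, ?_, le_sr_tensor_interpMask hn, fun b u h =>
      ⟨h.isMultipleCanonicalTightBank, fun p hp =>
        ⟨h.hasSymmetry_bank2D p, le_vm_bank2D_interpMask hn h hp⟩⟩⟩
    rw [hsr _ ha _ (Or.inl rfl), hsr _ ha _ (Or.inr rfl)]
  · have hM' : M = quincunxM ∨ M = quincunxN := by simpa using hM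
    refine ⟨?_, fun n hn b u h => ?_, fun R => ?_⟩
    · rcases hM' with rfl | rfl
      · exact tendsto_sm_tensor_interpMask
      · refine tendsto_sm_tensor_interpMask.congr' ?_
        filter_upwards [eventually_ge_atTop 1] with n hn
        have ha := isSymLowPass_interpMask hn
        exact sm_quincunx_eq ha.real ha.low
    · have hvm : ∀ l : Fin 11, HasVanishingMoments (bank2D b u l.succ) n := fun l =>
        hasVanishingMoments_of_le_vm (le_vm_bank2D_interpMask hn h (Fin.succ_ne_zero l))
      exact ⟨refL2 hn, fun l => genL2 hn hM' (bank2D b u l.succ), isGenerated hn hM' _,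
        isTightFramelet_genL2 (s := 11) hn hM' (h.tight hM') h.bank2D_zero,
        funD4Symmetric_refL2 hn, fun l => ⟨funSymmetric_genL2 hn hM' (h.hasSymmetry_bank2D _),
          funVanishingMoments_genL2 hn hM' (hvm l)⟩⟩
    · obtain ⟨N, hN⟩ := exists_nat_ge (3 * max R 0)
      refine ⟨N + 1, fun n hn b u _ φ ψ hφψ => ?_⟩
      obtain ⟨m, rfl⟩ : ∃ m, n = m + 1 := ⟨n - 1, by omega⟩
      have hm : 3 * max R 0 ≤ (m : ℝ) := hN.trans (by exact_mod_cast (by omega : N ≤ m))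
      obtain ⟨h1, h2⟩ := le_funSm_of_isGenerated hM' (le_max_right R 0) hm hφψ
      have hR : (R : EReal) ≤ (max R 0 : ℝ) := EReal.coe_le_coe_iff.2 (le_max_left R 0)
      exact ⟨hR.trans h1, fun l => hR.trans (h2 l)⟩
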